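/- Let $\boldsymbol\alpha=(\alpha_1,\alpha_2)\in\mathbb R^2$ and let $\tau\in\mathbb C$ with $\operatorname{Im}\tau>0$. For $\boldsymbol w=(w_1,w_2)$ with $\operatorname{Im}w_1,\operatorname{Im}w_2>0$ put \begin{align*} \theta_3(\boldsymbol\alpha;\boldsymbol w)&:=\sum_{\boldsymbol n\in\boldsymbol\alpha+\mathbb Z^2}(2n_1+n_2)\,e^{\frac{3\pi i}{2}(2n_1+n_2)^2w_1+\frac{\pi i n_2^2w_2}{2}},\\ \theta_4(\boldsymbol\alpha;\boldsymbol w)&:=\sum_{\boldsymbol n\in\boldsymbol\alpha+\mathbb Z^2}(3n_1+2n_2)\,e^{\frac{\pi i}{2}(3n_1+2n_2)^2w_1+\frac{3\pi i n_1^2w_2}{2}},\\ \theta_5(\boldsymbol\alpha;\boldsymbol w)&:=\sum_{\boldsymbol n\in\boldsymbol\alpha+\mathbb Z^2}n_1\,e^{\frac{\pi i}{2}(3n_1+2n_2)^2w_1+\frac{3\pi i n_1^2w_2}{2}}, \end{align*} and, integrating along vertical rays and using principal branches of the powers, \begin{align*} H_{2,\boldsymbol\alpha}(\tau):={}&\frac{\sqrt3\,i}{2\pi}\int_0^{i\infty}\int_{w_1}^{i\infty}\frac{2\theta_3(\boldsymbol\alpha;\boldsymbol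 w)-\theta_4(\boldsymbol\alpha;\boldsymbol w)}{(-i(w_1+\tau))^{1/2}(-i(w_2+\tau))^{3/2}}\,dw_2\,dw_1\\ &+\frac{\sqrt3\,i}{2\pi}\int_0^{i\infty}\int_{w_1}^{i\infty}\frac{\theta_5(\boldsymbol\alpha;\boldsymbol w)}{(-i(w_1+\tau))^{3/2}(-i(w_2+\tau))^{1/2}}\,dw_2\,dw_1. \end{align*} For real $a,x$ let $$\mathcal F_a(x):=\frac{\sinh(2\pi x)}{\cosh(2\pi x)-\cos(2\pi a)},\qquad \mathcal G_a(x):=\frac{\sin(2\pi a)}{\cosh(2\pi x)-\cos(2\pi a)},\qquad \mathcal G_a^*(x):=x\,\mathcal G_a(x),$$ let $Q(\boldsymbol w):=3w_1^2+w_2^2+3w_1w_2$ and, for almost every $\boldsymbol w\in\mathbb R^2$, $$g_{2,\boldsymbol\alpha}(\boldsymbol w):=\begin{cases}-2i\,w_2\left(\mathcal G_{\alpha_1}(w_1)\mathcal F_{\alpha_2}(w_2)+\mathcal F_{\alpha_1}(w_1)\mathcal G_{\alpha_2}(w_2)\right)&\text{if }\alpha_1\notin\mathbb Z,\\[1mm]-2i\left(\mathcal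 F_0(w_1)\,\mathcal G_{\alpha_2}^*(w_2)-\frac1{\pi w_1}\,\mathcal G^*_{\alpha_2}\!\left(w_2+\frac{3w_1}{2}\right)\right)&\text{if }\alpha_1\in\mathbb Z.\end{cases}$$ Then the theta series converge absolutely for all $w_1,w_2$ in the upper half-plane. In each of the two iterated integrals defining $H_{2,\boldsymbol\alpha}(\tau)$, the inner integral converges absolutely for every $w_1$ on the positive imaginary axis, and the resulting outer integral converges absolutely. The function $g_{2,\boldsymbol\alpha}(\boldsymbol w)e^{2\pi i\tau Q(\boldsymbol w)}$ is integrable on $\mathbb R^2$, and $$H_{2,\boldsymbol\alpha}(\tau)=\int_{\mathbb R^2}g_{2,\boldsymbol\alpha}(\boldsymbol w)\,e^{2\pi i\tau Q(\boldsymbol w)}\,dw_1\,dw_2 .$$ -/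

import Mathlib

noncomputable section

namespace DoubleMordell

/-- The general term of `θ₃(α; w)`, with summation vector `α + n`, `n ∈ ℤ²`. -/
def theta3Term (α : ℝ × ℝ) (w₁ w₂ : ℂ) (n : ℤ × ℤ) : ℂ :=
  let n₁ : ℂ := ((α.1 + n.1 : ℝ) : ℂ)
  let n₂ : ℂ := ((α.2 + n.2 : ℝ) : ℂ)
  (2 * n₁ + n₂) * Complex.exp
    (3 * Real.pi * Complex.I / 2 * (2 * n₁ + n₂) ^ 2 * w₁ + Real.pi * Complex.I * n₂ ^ 2 * w₂ / 2)

/-- The general term of `θ₄(α; w)`. -/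
def theta4Term (α : ℝ × ℝ) (w₁ w₂ : ℂ) (n : ℤ × ℤ) : ℂ :=
  let n₁ : ℂ := ((α.1 + n.1 : ℝ) : ℂ)
  let n₂ : ℂ := ((α.2 + n.2 : ℝ) : ℂ)
  (3 * n₁ + 2 * n₂) * Complex.exp
    (Real.pi * Complex.I / 2 * (3 * n₁ + 2 * n₂) ^ 2 * w₁
      + 3 * Real.pi * Complex.I * n₁ ^ 2 * w₂ / 2)

/-- The general term of `θ₅(α; w)`. -/
def theta5Term (α : ℝ × ℝ) (w₁ w₂ : ℂ) (n : ℤ × ℤ) : ℂ :=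
  let n₁ : ℂ := ((α.1 + n.1 : ℝ) : ℂ)
  let n₂ : ℂ := ((α.2 + n.2 : ℝ) : ℂ)
  n₁ * Complex.exp
    (Real.pi * Complex.I / 2 * (3 * n₁ + 2 * n₂) ^ 2 * w₁
      + 3 * Real.pi * Complex.I * n₁ ^ 2 * w₂ / 2)

/-- The theta function `θ₃(α; w)`. -/
def theta3 (α : ℝ × ℝ) (w₁ w₂ : ℂ) : ℂ := ∑' n : ℤ × ℤ, theta3Term α w₁ w₂ n

/-- The theta function `θ₄(α; w)`. -/
def theta4 (α : ℝ × ℝ) (w₁ w₂ : ℂ) : ℂ := ∑' n : ℤ × ℤ, theta4Term α w₁ w₂ n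

/-- The theta function `θ₅(α; w)`. -/
def theta5 (α : ℝ × ℝ) (w₁ w₂ : ℂ) : ℂ := ∑' n : ℤ × ℤ, theta5Term α w₁ w₂ n

/-- The contour integral `∫_z^{i∞} f(w) dw` along the vertical ray `w = z + i t`, `t > 0`. -/
def rayIntegral (f : ℂ → ℂ) (z : ℂ) : ℂ :=
  ∫ t in Set.Ioi (0 : ℝ), f (z + t * Complex.I) * Complex.I

/-- Absolute convergence of `∫_z^{i∞} f(w) dw`. -/
def RayIntegrable (f : ℂ → ℂ) (z : ℂ) : Prop :=
  MeasureTheory.IntegrableOn (fun t : ℝ => f (z + t * Complex.I)) (Set.Ioi (0 : ℝ))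

/-- The iterated integral `∫_0^{i∞} ∫_{w₁}^{i∞} f(w₁, w₂) dw₂ dw₁`. -/
def iteratedIntegral (f : ℂ → ℂ → ℂ) : ℂ :=
  rayIntegral (fun w₁ => rayIntegral (fun w₂ => f w₁ w₂) w₁) 0

/-- Convergence of `∫_0^{i∞} ∫_{w₁}^{i∞} f(w₁, w₂) dw₂ dw₁`: the inner integral converges absolutely
for every `w₁` on the path of integration, and so does the outer one. -/
def IteratedIntegrable (f : ℂ → ℂ → ℂ) : Prop :=
  (∀ t : ℝ, 0 < t → RayIntegrable (fun w₂ => f (t * Complex.I) w₂) (t * Complex.I)) ∧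
    RayIntegrable (fun w₁ => rayIntegral (fun w₂ => f w₁ w₂) w₁) 0

/-- The integrand of the first double integral in `H_{2,α}(τ)`. For `τ`, `w₁`, `w₂` in the upper
half-plane the bases of the powers have positive real part, and the powers are principal. -/
def integrand34 (α : ℝ × ℝ) (τ w₁ w₂ : ℂ) : ℂ :=
  (2 * theta3 α w₁ w₂ - theta4 α w₁ w₂) /
    ((-Complex.I * (w₁ + τ)) ^ (1 / 2 : ℂ) * (-Complex.I * (w₂ + τ)) ^ (3 / 2 : ℂ))

/-- The integrand of the second double integral in `H_{2,α}(τ)`. -/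
def integrand5 (α : ℝ × ℝ) (τ w₁ w₂ : ℂ) : ℂ :=
  theta5 α w₁ w₂ /
    ((-Complex.I * (w₁ + τ)) ^ (3 / 2 : ℂ) * (-Complex.I * (w₂ + τ)) ^ (1 / 2 : ℂ))

/-- The double theta integral `H_{2,α}(τ)`. -/
def H2 (α : ℝ × ℝ) (τ : ℂ) : ℂ :=
  (Real.sqrt 3 * Complex.I) / (2 * Real.pi) * iteratedIntegral (integrand34 α τ) +
    (Real.sqrt 3 * Complex.I) / (2 * Real.pi) * iteratedIntegral (integrand5 α τ)

/-- The function `ℱ_a(x)`. -/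
def calF (a x : ℝ) : ℝ :=
  Real.sinh (2 * Real.pi * x) / (Real.cosh (2 * Real.pi * x) - Real.cos (2 * Real.pi * a))

/-- The function `𝒢_a(x)`. -/
def calG (a x : ℝ) : ℝ :=
  Real.sin (2 * Real.pi * a) / (Real.cosh (2 * Real.pi * x) - Real.cos (2 * Real.pi * a))

/-- The function `𝒢*_a(x) = x 𝒢_a(x)`. -/
def calGStar (a x : ℝ) : ℝ := x * calG a x

/-- The quadratic form `Q(w) = 3w₁² + w₂² + 3w₁w₂`. -/
def Q (w : ℝ × ℝ) : ℝ := 3 * w.1 ^ 2 + w.2 ^ 2 + 3 * w.1 * w.2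

open Classical in
/-- The function `g_{2,α}(w)`. A value with a vanishing denominator is immaterial: this happens on
the lines `w₁ = 0`, `w₂ = 0`, `w₂ + 3w₁/2 = 0` only, and these are null sets. -/
def g2 (α : ℝ × ℝ) (w : ℝ × ℝ) : ℂ :=
  if ∃ k : ℤ, α.1 = k then
    -2 * Complex.I *
      ((calF 0 w.1 * calGStar α.2 w.2
        - 1 / (Real.pi * w.1) * calGStar α.2 (w.2 + 3 * w.1 / 2) : ℝ) : ℂ)
  else
    -2 * Complex.I *
      ((w.2 * (calG α.1 w.1 * calF α.2 w.2 + calF α.1 w.1 * calG α.2 w.2) : ℝ) : ℂ)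

/-- The integrand `g_{2,α}(w) e^{2πiτQ(w)}` of the double Mordell integral. -/
def mordellIntegrand (α : ℝ × ℝ) (τ : ℂ) (w : ℝ × ℝ) : ℂ :=
  g2 α w * Complex.exp (2 * Real.pi * Complex.I * τ * (Q w : ℂ))

end DoubleMordell

end

noncomputable section

namespace DoubleMordell

open Real Set Filter Topology MeasureTheory

/-! ### One-dimensional Gaussian lattice sums -/

theorem summable_exp_neg_mul_sq_int (a : ℝ) {c : ℝ} (hc : 0 < c) :
    Summable (fun k : ℤ => exp (-(c * (a + k) ^ 2))) := by
  have h := (HurwitzZeta.hasSum_int_evenKernel a (div_pos hc pi_pos)).summable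
  refine h.congr fun k => ?_
  congr 1
  field_simp
  ring

theorem tsum_exp_neg_mul_sq_int (a : ℝ) {c : ℝ} (hc : 0 < c) :
    ∑' k : ℤ, exp (-(c * (a + k) ^ 2)) = HurwitzZeta.evenKernel a (c / π) := by
  rw [← (HurwitzZeta.hasSum_int_evenKernel a (div_pos hc pi_pos)).tsum_eq]
  refine tsum_congr fun k => ?_
  congr 1
  field_simp
  ring

theorem abs_cosKernel_le (a : ℝ) {t : ℝ} (ht : 1 ≤ t) :
    |HurwitzZeta.cosKernel a t| ≤ ∑' k : ℤ, exp (-(π * (0 + k) ^ 2)) := by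
  have h := HurwitzZeta.hasSum_int_cosKernel a (zero_lt_one.trans_le ht)
  rw [← Real.norm_eq_abs, ← Complex.norm_real, ← h.tsum_eq]
  refine tsum_of_norm_bounded (summable_exp_neg_mul_sq_int 0 pi_pos).hasSum fun k => ?_
  have e : 2 * (π : ℂ) * Complex.I * a * k = ((2 * π * a * k : ℝ) : ℂ) * Complex.I := by
    push_cast; ring
  rw [norm_mul, e, Complex.norm_exp_ofReal_mul_I, one_mul, Complex.norm_real, Real.norm_eq_abs,
    abs_of_pos (exp_pos _)]
  refine exp_le_exp.2 ?_
  have : 0 ≤ π * (k : ℝ) ^ 2 := by positivity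
  nlinarith

/-- A bound for Gaussian sums over a shifted lattice that is uniform in the shift. -/
theorem exists_tsum_exp_neg_mul_sq_int_le :
    ∃ C : ℝ, 0 < C ∧ ∀ a c : ℝ, 0 < c →
      ∑' k : ℤ, exp (-(c * (a + k) ^ 2)) ≤ C * (1 + (√c)⁻¹) := by
  set S := ∑' k : ℤ, exp (-(π * (0 + k) ^ 2)) with hS
  have hS0 : 0 ≤ S := tsum_nonneg fun k => (exp_pos _).le
  refine ⟨S * √π + S + 1, by positivity, fun a c hc => ?_⟩
  have hsp : 0 < √π := sqrt_pos.2 pi_pos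
  have hsc : 0 < √c := sqrt_pos.2 hc
  rcases le_total c π with h | h
  · rw [tsum_exp_neg_mul_sq_int a hc, HurwitzZeta.evenKernel_functional_equation]
    have h1 := abs_cosKernel_le a (t := 1 / (c / π)) (by rw [one_div_div]; exact (one_le_div hc).2 h)
    have h2 : 1 / (c / π) ^ (1 / 2 : ℝ) = √π * (√c)⁻¹ := by
      rw [← sqrt_eq_rpow, sqrt_div hc.le]
      field_simp
    rw [h2]
    have h3 : √π * (√c)⁻¹ * HurwitzZeta.cosKernel a (1 / (c / π)) ≤ √π * (√c)⁻¹ * S := by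
      gcongr
      exact (le_abs_self _).trans h1
    refine h3.trans ?_
    have : 0 ≤ (√c)⁻¹ := by positivity
    nlinarith [mul_nonneg hS0 this, mul_nonneg hS0 hsp.le]
  · have h1 : ∑' k : ℤ, exp (-(c * (a + k) ^ 2)) ≤ ∑' k : ℤ, exp (-(π * (a + k) ^ 2)) := by
      refine (summable_exp_neg_mul_sq_int a hc).tsum_le_tsum (fun k => ?_)
        (summable_exp_neg_mul_sq_int a pi_pos)
      gcongr
    refine h1.trans ?_
    rw [tsum_exp_neg_mul_sq_int a pi_pos, HurwitzZeta.evenKernel_functional_equation,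
      div_self pi_pos.ne']
    simp only [one_rpow, div_one, one_mul]
    have h2 := (le_abs_self _).trans (abs_cosKernel_le a le_rfl)
    refine h2.trans ?_
    have : 0 ≤ (√c)⁻¹ := by positivity
    nlinarith [mul_nonneg hS0 this, mul_nonneg hS0 hsp.le, mul_nonneg (mul_nonneg hS0 hsp.le) this]

theorem exists_abs_oddKernel_le (a : UnitAddCircle) :
    ∃ C p : ℝ, 0 < C ∧ 0 < p ∧ ∀ x : ℝ, 0 < x →
      |HurwitzZeta.oddKernel a x| ≤ C * exp (-(p * x)) := by
  obtain ⟨p, hp, h1⟩ := HurwitzZeta.isBigO_atTop_oddKernel a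
  obtain ⟨q, hq, h2⟩ := HurwitzZeta.isBigO_atTop_sinKernel a
  have h2' : HurwitzZeta.sinKernel a =O[atTop] (fun x : ℝ => x ^ (-(3 / 2) : ℝ)) :=
    h2.trans (isLittleO_exp_neg_mul_rpow_atTop hq _).isBigO
  obtain ⟨C1, hC1, h1⟩ := h1.exists_pos
  obtain ⟨C2, hC2, h2⟩ := h2'.exists_pos
  obtain ⟨X1, h1⟩ := eventually_atTop.1 h1.bound
  obtain ⟨X2, h2⟩ := eventually_atTop.1 h2.bound
  set B := max X1 1
  set A := max X2 1
  have hA : 0 < A := lt_max_of_lt_right one_pos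
  have hB : 0 < B := lt_max_of_lt_right one_pos
  have hcont : ContinuousOn (HurwitzZeta.oddKernel a) (Icc A⁻¹ B) :=
    (HurwitzZeta.continuousOn_oddKernel a).mono fun x hx => lt_of_lt_of_le (inv_pos.2 hA) hx.1
  obtain ⟨C3, h3⟩ := isCompact_Icc.exists_bound_of_continuousOn hcont
  refine ⟨C1 + (C2 + |C3|) * exp (p * B), p, by positivity, hp, fun x hx => ?_⟩
  have hxe := exp_pos (-(p * x))
  rcases le_total B x with h | h
  · have := h1 x ((le_max_left _ _).trans h)
    rw [Real.norm_eq_abs, Real.norm_eq_abs, abs_of_pos (exp_pos _), neg_mul] at this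
    refine this.trans ?_
    gcongr
    have : 0 ≤ (C2 + |C3|) * exp (p * B) := by positivity
    linarith
  · have he : 1 ≤ exp (p * B) * exp (-(p * x)) := by
      rw [← exp_add]; exact one_le_exp (by nlinarith)
    have key : |HurwitzZeta.oddKernel a x| ≤ C2 + |C3| := by
      rcases le_total A⁻¹ x with h' | h'
      · have := h3 x ⟨h', h⟩
        rw [Real.norm_eq_abs] at this
        linarith [le_abs_self C3]
      · have hx' : A ≤ 1 / x := by rw [one_div]; exact (le_inv_comm₀ hA hx).2 h'
        have := h2 (1 / x) ((le_max_left _ _).trans hx')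
        have hx1 : 0 < 1 / x := by positivity
        rw [HurwitzZeta.oddKernel_functional_equation, abs_mul,
          abs_of_nonneg (a := 1 / x ^ (3 / 2 : ℝ)) (by positivity)]
        rw [Real.norm_eq_abs, Real.norm_eq_abs,
          abs_of_nonneg (a := (1 / x) ^ (-(3 / 2) : ℝ)) (rpow_nonneg hx1.le _)] at this
        have e : (1 / x) ^ (-(3 / 2) : ℝ) = x ^ (3 / 2 : ℝ) := by
          rw [one_div, inv_rpow hx.le, rpow_neg hx.le, inv_inv]
        rw [e] at this
        have hxp : 0 < x ^ (3 / 2 : ℝ) := rpow_pos_of_pos hx _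
        have h5 : 1 / x ^ (3 / 2 : ℝ) * |HurwitzZeta.sinKernel a (1 / x)| ≤ C2 := by
          rw [one_div, inv_mul_le_iff₀ hxp]
          linarith
        linarith [abs_nonneg C3]
    calc _ ≤ (C2 + |C3|) * 1 := by linarith
      _ ≤ (C2 + |C3|) * (exp (p * B) * exp (-(p * x))) := by gcongr
      _ ≤ _ := by
        have : 0 ≤ C1 * exp (-(p * x)) := by positivity
        linarith

theorem tsum_mul_exp_neg_mul_sq_int (a : ℝ) {c : ℝ} (hc : 0 < c) :
    ∑' k : ℤ, (a + k) * exp (-(c * (a + k) ^ 2)) = HurwitzZeta.oddKernel a (c / π) := by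
  rw [← (HurwitzZeta.hasSum_int_oddKernel a (div_pos hc pi_pos)).tsum_eq]
  refine tsum_congr fun k => ?_
  rw [add_comm a]
  congr 2
  field_simp

/-- The theta series of weight `3/2` attached to the cosets `a + j κ / 2 + ℤ` decay at `0` and at
`∞`, uniformly in `j`. -/
theorem exists_abs_tsum_mul_exp_neg_mul_sq_int_le (a : ℝ) (κ : ℤ) :
    ∃ C p : ℝ, 0 < C ∧ 0 < p ∧ ∀ (j : ℤ) (c : ℝ), 0 < c →
      |∑' k : ℤ, (a + κ * j / 2 + k) * exp (-(c * (a + κ * j / 2 + k) ^ 2))| ≤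
        C * exp (-(p * c)) := by
  obtain ⟨C1, p1, hC1, hp1, h1⟩ := exists_abs_oddKernel_le (a : ℝ)
  obtain ⟨C2, p2, hC2, hp2, h2⟩ := exists_abs_oddKernel_le ((a + κ / 2 : ℝ) : UnitAddCircle)
  refine ⟨C1 + C2, min p1 p2 / π, by positivity, div_pos (lt_min hp1 hp2) pi_pos,
    fun j c hc => ?_⟩
  rw [tsum_mul_exp_neg_mul_sq_int _ hc]
  have hcp : 0 < c / π := div_pos hc pi_pos
  have e1 : exp (-(p1 * (c / π))) ≤ exp (-(min p1 p2 / π * c)) := by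
    refine exp_le_exp.2 (neg_le_neg ?_)
    rw [div_mul_eq_mul_div, ← mul_div_assoc]
    gcongr
    exact min_le_left _ _
  have e2 : exp (-(p2 * (c / π))) ≤ exp (-(min p1 p2 / π * c)) := by
    refine exp_le_exp.2 (neg_le_neg ?_)
    rw [div_mul_eq_mul_div, ← mul_div_assoc]
    gcongr
    exact min_le_right _ _
  have hpos := exp_pos (-(min p1 p2 / π * c))
  rcases Int.even_or_odd' j with ⟨i, rfl | rfl⟩
  · have : ((a + κ * ((2 * i : ℤ) : ℝ) / 2 : ℝ) : UnitAddCircle) = (a : ℝ) := by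
      rw [← sub_eq_zero, ← AddCircle.coe_sub, AddCircle.coe_eq_zero_iff]
      exact ⟨κ * i, by simp; ring⟩
    rw [this]
    refine (h1 _ hcp).trans ?_
    nlinarith
  · have : ((a + κ * ((2 * i + 1 : ℤ) : ℝ) / 2 : ℝ) : UnitAddCircle) = ((a + κ / 2 : ℝ)) := by
      rw [← sub_eq_zero, ← AddCircle.coe_sub, AddCircle.coe_eq_zero_iff]
      exact ⟨κ * i, by simp; ring⟩
    rw [this]
    refine (h2 _ hcp).trans ?_
    nlinarith

/-- Nonzero points of a coset of `ℤ` are bounded away from zero. -/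
theorem exists_pos_le_abs_add_int (a : ℝ) : ∃ δ : ℝ, 0 < δ ∧ ∀ k : ℤ, a + k ≠ 0 → δ ≤ |a + k| := by
  have h0 := Int.fract_nonneg a
  have h1 := Int.fract_lt_one a
  refine ⟨if Int.fract a = 0 then 1 else min (Int.fract a) (1 - Int.fract a), ?_, fun k hk => ?_⟩
  · split_ifs with h
    · exact one_pos
    · exact lt_min (lt_of_le_of_ne h0 (Ne.symm h)) (by linarith)
  · have e : a + k = Int.fract a + ((⌊a⌋ + k : ℤ) : ℝ) := by
      push_cast; linarith [Int.floor_add_fract a]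
    rw [e] at hk ⊢
    generalize ⌊a⌋ + k = m at *
    split_ifs with h
    · rw [h, zero_add] at hk ⊢
      have : m ≠ 0 := by rintro rfl; simp at hk
      exact_mod_cast Int.one_le_abs this
    · rcases le_or_gt 0 m with hm | hm
      · have : (0 : ℝ) ≤ m := by exact_mod_cast hm
        rw [abs_of_nonneg (by linarith)]
        linarith [min_le_left (Int.fract a) (1 - Int.fract a)]
      · have : (m : ℝ) ≤ -1 := by exact_mod_cast Int.le_sub_one_of_lt hm
        rw [abs_of_nonpos (by linarith)]
        linarith [min_le_right (Int.fract a) (1 - Int.fract a)]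

theorem abs_mul_exp_neg_le (x : ℝ) {c : ℝ} (hc : 0 < c) :
    |x| * exp (-(c * x ^ 2)) ≤ (√c)⁻¹ * exp (-(c / 2 * x ^ 2)) := by
  have hsc : 0 < √c := sqrt_pos.2 hc
  have hs : √c ^ 2 = c := sq_sqrt hc.le
  have h1 : √c * |x| ≤ exp (c / 2 * x ^ 2) := by
    have := add_one_le_exp (c / 2 * x ^ 2)
    have h2 : (√c * |x|) ^ 2 = c * x ^ 2 := by rw [mul_pow, hs, sq_abs]
    nlinarith [sq_nonneg (√c * |x| - 1)]
  have h3 : |x| ≤ (√c)⁻¹ * exp (c / 2 * x ^ 2) := by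
    rw [inv_mul_eq_div, le_div_iff₀ hsc]; linarith
  calc _ ≤ (√c)⁻¹ * exp (c / 2 * x ^ 2) * exp (-(c * x ^ 2)) := by gcongr
    _ = _ := by rw [mul_assoc, ← exp_add]; congr 2; ring

theorem abs_mul_exp_neg_le_of_le {x δ : ℝ} {c : ℝ} (hc : 0 < c) (hδ : 0 < δ) (hx : δ ≤ |x|) :
    |x| * exp (-(c * x ^ 2)) ≤
      (√c)⁻¹ * exp (-(δ ^ 2 / 4 * c)) * exp (-(c / 4 * x ^ 2)) := by
  refine (abs_mul_exp_neg_le x hc).trans ?_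
  rw [mul_assoc, ← exp_add]
  gcongr
  have : δ ^ 2 ≤ x ^ 2 := by rw [← sq_abs x]; gcongr
  nlinarith

/-! ### Two-dimensional theta series -/

/-- The first coordinate of a point of the shifted lattice `β + ℤ²`. -/
def latV (β : ℝ × ℝ) (k : ℤ × ℤ) : ℝ := β.1 + k.1

/-- The linear form `2 u + κ v` at a point `(v, u)` of the shifted lattice `β + ℤ²`. -/
def latL (κ : ℤ) (β : ℝ × ℝ) (k : ℤ × ℤ) : ℝ := 2 * (β.2 + k.2) + κ * (β.1 + k.1)

/-- The Gaussian weight on the shifted lattice `β + ℤ²`. -/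
def latGauss (κ : ℤ) (β : ℝ × ℝ) (c d : ℝ) (k : ℤ × ℤ) : ℝ :=
  exp (-(c * latL κ β k ^ 2 + d * latV β k ^ 2))

theorem latGauss_pos (κ : ℤ) (β : ℝ × ℝ) (c d : ℝ) (k : ℤ × ℤ) : 0 < latGauss κ β c d k :=
  exp_pos _

theorem latL_eq (κ : ℤ) (β : ℝ × ℝ) (i j : ℤ) :
    latL κ β (i, j) = 2 * ((β.2 + κ * β.1 / 2) + κ * i / 2 + j) := by
  simp only [latL]; ring

theorem latGauss_eq (κ : ℤ) (β : ℝ × ℝ) (c d : ℝ) (i j : ℤ) :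
    latGauss κ β c d (i, j) = exp (-(d * (β.1 + i) ^ 2)) *
      exp (-(4 * c * (((β.2 + κ * β.1 / 2) + κ * i / 2) + j) ^ 2)) := by
  rw [latGauss, latL_eq, ← exp_add, latV]
  congr 1
  ring

theorem exists_tsum_latGauss_le : ∃ C : ℝ, 0 < C ∧ ∀ (κ : ℤ) (β : ℝ × ℝ) (c d : ℝ), 0 < c → 0 < d →
    Summable (latGauss κ β c d) ∧
      ∑' k, latGauss κ β c d k ≤ C * ((1 + (√c)⁻¹) * (1 + (√d)⁻¹)) := by
  obtain ⟨C, hC, h⟩ := exists_tsum_exp_neg_mul_sq_int_le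
  refine ⟨C * C, by positivity, fun κ β c d hc hd => ?_⟩
  have hc4 : 0 < 4 * c := by positivity
  have hs4 : (√(4 * c))⁻¹ ≤ (√c)⁻¹ := by
    gcongr
    linarith
  have hin : ∀ i : ℤ, Summable fun j : ℤ => latGauss κ β c d (i, j) := fun i => by
    simp only [latGauss_eq]
    exact (summable_exp_neg_mul_sq_int _ hc4).mul_left _
  have hle : ∀ i : ℤ, ∑' j : ℤ, latGauss κ β c d (i, j) ≤
      exp (-(d * (β.1 + i) ^ 2)) * (C * (1 + (√c)⁻¹)) := fun i => by
    simp only [latGauss_eq, tsum_mul_left]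
    gcongr
    exact (h _ _ hc4).trans (by gcongr)
  have hout : Summable fun i : ℤ => exp (-(d * (β.1 + i) ^ 2)) * (C * (1 + (√c)⁻¹)) :=
    (summable_exp_neg_mul_sq_int _ hd).mul_right _
  have hS1 : Summable fun i : ℤ => ∑' j : ℤ, latGauss κ β c d (i, j) :=
    hout.of_nonneg_of_le (fun i => tsum_nonneg fun j => (latGauss_pos _ _ _ _ _).le) hle
  have hS : Summable (latGauss κ β c d) :=
    (summable_prod_of_nonneg fun k => (latGauss_pos _ _ _ _ _).le).2 ⟨hin, hS1⟩
  refine ⟨hS, ?_⟩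
  rw [hS.tsum_prod]
  refine (hS1.tsum_le_tsum hle hout).trans ?_
  rw [tsum_mul_right]
  have := h β.1 d hd
  calc _ ≤ (C * (1 + (√d)⁻¹)) * (C * (1 + (√c)⁻¹)) := by gcongr
    _ = _ := by ring

theorem summable_latGauss (κ : ℤ) (β : ℝ × ℝ) {c d : ℝ} (hc : 0 < c) (hd : 0 < d) :
    Summable (latGauss κ β c d) := by
  obtain ⟨C, -, h⟩ := exists_tsum_latGauss_le
  exact (h κ β c d hc hd).1

theorem abs_latL_mul_latGauss_le (κ : ℤ) (β : ℝ × ℝ) {c d : ℝ} (hc : 0 < c) (k : ℤ × ℤ) :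
    |latL κ β k * latGauss κ β c d k| ≤ (√c)⁻¹ * latGauss κ β (c / 2) d k := by
  have h := abs_mul_exp_neg_le (latL κ β k) hc
  rw [abs_mul, abs_of_pos (latGauss_pos _ _ _ _ _), latGauss, latGauss, neg_add, neg_add, exp_add,
    exp_add, ← mul_assoc, ← mul_assoc]
  gcongr

theorem summable_latL_mul_latGauss (κ : ℤ) (β : ℝ × ℝ) {c d : ℝ} (hc : 0 < c) (hd : 0 < d) :
    Summable fun k => latL κ β k * latGauss κ β c d k :=
  Summable.of_norm_bounded ((summable_latGauss κ β (half_pos hc) hd).mul_left _)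
    fun k => abs_latL_mul_latGauss_le κ β hc k

theorem abs_latV_mul_latGauss_le (κ : ℤ) (β : ℝ × ℝ) {c d : ℝ} (hd : 0 < d) (k : ℤ × ℤ) :
    |latV β k * latGauss κ β c d k| ≤ (√d)⁻¹ * latGauss κ β c (d / 2) k := by
  have h := abs_mul_exp_neg_le (latV β k) hd
  rw [abs_mul, abs_of_pos (latGauss_pos _ _ _ _ _), latGauss, latGauss, neg_add_rev, neg_add_rev,
    exp_add, exp_add, ← mul_assoc, ← mul_assoc]
  gcongr

theorem summable_latV_mul_latGauss (κ : ℤ) (β : ℝ × ℝ) {c d : ℝ} (hc : 0 < c) (hd : 0 < d) :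
    Summable fun k => latV β k * latGauss κ β c d k :=
  Summable.of_norm_bounded ((summable_latGauss κ β hc (half_pos hd)).mul_left _)
    fun k => abs_latV_mul_latGauss_le κ β hd k

theorem exists_abs_tsum_latL_mul_latGauss_le (κ : ℤ) (β : ℝ × ℝ) :
    ∃ C p : ℝ, 0 < C ∧ 0 < p ∧ ∀ c d : ℝ, 0 < c → 0 < d →
      |∑' k, latL κ β k * latGauss κ β c d k| ≤ C * exp (-(p * c)) * (1 + (√d)⁻¹) := by
  obtain ⟨C, hC, h⟩ := exists_tsum_exp_neg_mul_sq_int_le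
  obtain ⟨C', p, hC', hp, h'⟩ :=
    exists_abs_tsum_mul_exp_neg_mul_sq_int_le (β.2 + κ * β.1 / 2) κ
  refine ⟨2 * C' * C, 4 * p, by positivity, by positivity, fun c d hc hd => ?_⟩
  rw [(summable_latL_mul_latGauss κ β hc hd).tsum_prod]
  have e : ∀ i : ℤ, ∑' j : ℤ, latL κ β (i, j) * latGauss κ β c d (i, j) =
      2 * exp (-(d * (β.1 + i) ^ 2)) * ∑' j : ℤ, ((β.2 + κ * β.1 / 2) + κ * i / 2 + j) *
        exp (-(4 * c * (((β.2 + κ * β.1 / 2) + κ * i / 2) + j) ^ 2)) := fun i => by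
    rw [← tsum_mul_left]
    refine tsum_congr fun j => ?_
    rw [latL_eq, latGauss_eq]
    ring
  simp_rw [e]
  rw [← Real.norm_eq_abs]
  have hsum := (summable_exp_neg_mul_sq_int β.1 hd).mul_left (2 * (C' * exp (-(p * (4 * c)))))
  refine (tsum_of_norm_bounded hsum.hasSum fun i => ?_).trans ?_
  · rw [norm_mul, norm_mul, Real.norm_eq_abs, Real.norm_eq_abs, Real.norm_eq_abs,
      abs_of_pos (exp_pos _), abs_two]
    have := h' i (4 * c) (by positivity)
    calc _ ≤ 2 * exp (-(d * (β.1 + i) ^ 2)) * (C' * exp (-(p * (4 * c)))) := by gcongr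
      _ = _ := by ring
  · rw [tsum_mul_left]
    calc _ ≤ 2 * (C' * exp (-(p * (4 * c)))) * (C * (1 + (√d)⁻¹)) := by
          gcongr; exact h _ _ hd
      _ = _ := by rw [show 4 * p * c = p * (4 * c) by ring]; ring

theorem exists_abs_latV_mul_latGauss_le (κ : ℤ) (β : ℝ × ℝ) :
    ∃ p : ℝ, 0 < p ∧ ∀ c d : ℝ, 0 < d → ∀ k,
      |latV β k * latGauss κ β c d k| ≤
        (√d)⁻¹ * exp (-(p * d)) * latGauss κ β c (d / 4) k := by
  obtain ⟨δ, hδ, h⟩ := exists_pos_le_abs_add_int β.1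
  refine ⟨δ ^ 2 / 4, by positivity, fun c d hd k => ?_⟩
  by_cases h0 : β.1 + k.1 = 0
  · rw [latV, h0, zero_mul, abs_zero]
    have := latGauss_pos κ β c (d / 4) k
    positivity
  · have := abs_mul_exp_neg_le_of_le (x := latV β k) hd hδ (h k.1 h0)
    rw [abs_mul, abs_of_pos (latGauss_pos _ _ _ _ _), latGauss, latGauss, neg_add_rev, neg_add_rev,
      exp_add, exp_add, ← mul_assoc, ← mul_assoc]
    gcongr

theorem exists_abs_latL_mul_latGauss_le (κ : ℤ) (β : ℝ × ℝ) :
    ∃ p : ℝ, 0 < p ∧ ∀ c d : ℝ, 0 < c → ∀ k,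
      |latL κ β k * latGauss κ β c d k| ≤
        (√c)⁻¹ * exp (-(p * c)) * latGauss κ β (c / 4) d k := by
  obtain ⟨δ, hδ, h⟩ := exists_pos_le_abs_add_int (2 * β.2 + κ * β.1)
  refine ⟨δ ^ 2 / 4, by positivity, fun c d hd k => ?_⟩
  have e : latL κ β k = 2 * β.2 + κ * β.1 + ((2 * k.2 + κ * k.1 : ℤ) : ℝ) := by
    rw [latL]; push_cast; ring
  by_cases h0 : latL κ β k = 0
  · rw [h0, zero_mul, abs_zero]
    have := latGauss_pos κ β (c / 4) d k
    positivity
  · have := abs_mul_exp_neg_le_of_le hd hδ (h _ (e ▸ h0))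
    rw [← e] at this
    rw [abs_mul, abs_of_pos (latGauss_pos _ _ _ _ _), latGauss, latGauss, neg_add, neg_add,
      exp_add, exp_add, ← mul_assoc, ← mul_assoc]
    gcongr

theorem exists_abs_tsum_latV_mul_latGauss_le (κ : ℤ) (β : ℝ × ℝ) :
    ∃ C p : ℝ, 0 < C ∧ 0 < p ∧ ∀ c d : ℝ, 0 < c → 0 < d →
      |∑' k, latV β k * latGauss κ β c d k| ≤
        C * ((√d)⁻¹ * exp (-(p * d))) * ((1 + (√c)⁻¹) * (1 + (√d)⁻¹)) := by
  obtain ⟨C, hC, h⟩ := exists_tsum_latGauss_le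
  obtain ⟨p, hp, hk⟩ := exists_abs_latV_mul_latGauss_le κ β
  refine ⟨2 * C, p, by positivity, hp, fun c d hc hd => ?_⟩
  obtain ⟨hs, hle⟩ := h κ β c (d / 4) hc (by positivity)
  rw [← Real.norm_eq_abs]
  refine (tsum_of_norm_bounded (hs.mul_left _).hasSum fun k => hk c d hd k).trans ?_
  rw [tsum_mul_left]
  have e : (√(d / 4))⁻¹ = 2 * (√d)⁻¹ := by
    rw [sqrt_div hd.le, show (4 : ℝ) = 2 ^ 2 by norm_num, sqrt_sq two_pos.le, inv_div]
    rfl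
  have h0 : 0 ≤ (√d)⁻¹ := by positivity
  calc _ ≤ (√d)⁻¹ * exp (-(p * d)) * (C * ((1 + (√c)⁻¹) * (1 + (√(d / 4))⁻¹))) := by gcongr
    _ ≤ (√d)⁻¹ * exp (-(p * d)) * (C * ((1 + (√c)⁻¹) * (2 * (1 + (√d)⁻¹)))) := by
      rw [e]; gcongr; linarith
    _ = _ := by ring

/-! ### The theta functions of the statement -/

theorem norm_theta3Term (α : ℝ × ℝ) (w₁ w₂ : ℂ) (n : ℤ × ℤ) :
    ‖theta3Term α w₁ w₂ n‖ =
      |latL 1 α.swap n.swap * latGauss 1 α.swap (3 * π / 2 * w₁.im) (π / 2 * w₂.im) n.swap| := by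
  have e : 3 * (π : ℂ) * Complex.I / 2 *
      (2 * ((α.1 + n.1 : ℝ) : ℂ) + ((α.2 + n.2 : ℝ) : ℂ)) ^ 2 * w₁ +
      π * Complex.I * ((α.2 + n.2 : ℝ) : ℂ) ^ 2 * w₂ / 2 =
      ((3 * π / 2 * (2 * (α.1 + n.1) + (α.2 + n.2)) ^ 2 : ℝ) : ℂ) * (Complex.I * w₁) +
      ((π / 2 * (α.2 + n.2) ^ 2 : ℝ) : ℂ) * (Complex.I * w₂) := by push_cast; ring
  simp only [theta3Term, norm_mul, abs_mul, Complex.norm_exp, e, Complex.add_re,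
    Complex.re_ofReal_mul, Complex.I_mul_re, abs_of_pos (latGauss_pos _ _ _ _ _)]
  rw [latGauss, latL, latV]
  congr 1
  · rw [← Real.norm_eq_abs, ← Complex.norm_real]; push_cast; simp
  · congr 1; simp; ring

theorem norm_theta4Term (α : ℝ × ℝ) (w₁ w₂ : ℂ) (n : ℤ × ℤ) :
    ‖theta4Term α w₁ w₂ n‖ =
      |latL 3 α n * latGauss 3 α (π / 2 * w₁.im) (3 * π / 2 * w₂.im) n| := by
  have e : (π : ℂ) * Complex.I / 2 *
      (3 * ((α.1 + n.1 : ℝ) : ℂ) + 2 * ((α.2 + n.2 : ℝ) : ℂ)) ^ 2 * w₁ +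
      3 * π * Complex.I * ((α.1 + n.1 : ℝ) : ℂ) ^ 2 * w₂ / 2 =
      ((π / 2 * (3 * (α.1 + n.1) + 2 * (α.2 + n.2)) ^ 2 : ℝ) : ℂ) * (Complex.I * w₁) +
      ((3 * π / 2 * (α.1 + n.1) ^ 2 : ℝ) : ℂ) * (Complex.I * w₂) := by push_cast; ring
  simp only [theta4Term, norm_mul, abs_mul, Complex.norm_exp, e, Complex.add_re,
    Complex.re_ofReal_mul, Complex.I_mul_re, abs_of_pos (latGauss_pos _ _ _ _ _)]
  rw [latGauss, latL, latV]
  congr 1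
  · rw [← Real.norm_eq_abs, ← Complex.norm_real]; push_cast; congr 1; ring
  · congr 1; simp; ring

theorem norm_theta5Term (α : ℝ × ℝ) (w₁ w₂ : ℂ) (n : ℤ × ℤ) :
    ‖theta5Term α w₁ w₂ n‖ =
      |latV α n * latGauss 3 α (π / 2 * w₁.im) (3 * π / 2 * w₂.im) n| := by
  have e : (π : ℂ) * Complex.I / 2 *
      (3 * ((α.1 + n.1 : ℝ) : ℂ) + 2 * ((α.2 + n.2 : ℝ) : ℂ)) ^ 2 * w₁ +
      3 * π * Complex.I * ((α.1 + n.1 : ℝ) : ℂ) ^ 2 * w₂ / 2 =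
      ((π / 2 * (3 * (α.1 + n.1) + 2 * (α.2 + n.2)) ^ 2 : ℝ) : ℂ) * (Complex.I * w₁) +
      ((3 * π / 2 * (α.1 + n.1) ^ 2 : ℝ) : ℂ) * (Complex.I * w₂) := by push_cast; ring
  simp only [theta5Term, norm_mul, abs_mul, Complex.norm_exp, e, Complex.add_re,
    Complex.re_ofReal_mul, Complex.I_mul_re, abs_of_pos (latGauss_pos _ _ _ _ _)]
  rw [latGauss, latL, latV]
  congr 1
  · rw [← Real.norm_eq_abs, ← Complex.norm_real]
  · congr 1; simp; ring

theorem summable_theta3Term (α : ℝ × ℝ) {w₁ w₂ : ℂ} (h₁ : 0 < w₁.im) (h₂ : 0 < w₂.im) :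
    Summable (theta3Term α w₁ w₂) := by
  refine Summable.of_norm ?_
  simp_rw [norm_theta3Term]
  exact (Equiv.prodComm ℤ ℤ).summable_iff.2
    (summable_latL_mul_latGauss 1 α.swap (by positivity) (by positivity)).abs

theorem summable_theta4Term (α : ℝ × ℝ) {w₁ w₂ : ℂ} (h₁ : 0 < w₁.im) (h₂ : 0 < w₂.im) :
    Summable (theta4Term α w₁ w₂) := by
  refine Summable.of_norm ?_
  simp_rw [norm_theta4Term]
  exact (summable_latL_mul_latGauss 3 α (by positivity) (by positivity)).abs

theorem summable_theta5Term (α : ℝ × ℝ) {w₁ w₂ : ℂ} (h₁ : 0 < w₁.im) (h₂ : 0 < w₂.im) :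
    Summable (theta5Term α w₁ w₂) := by
  refine Summable.of_norm ?_
  simp_rw [norm_theta5Term]
  exact (summable_latV_mul_latGauss 3 α (by positivity) (by positivity)).abs

/-- On the imaginary axes, `θ₃` is a real series. -/
theorem theta3_I_mul (α : ℝ × ℝ) (t₁ t₂ : ℝ) :
    theta3 α (t₁ * Complex.I) (t₂ * Complex.I) =
      ((∑' k, latL 1 α.swap k * latGauss 1 α.swap (π * (3 / 2) * t₁) (π * (1 / 2) * t₂) k : ℝ) :
        ℂ) := by
  rw [theta3, Complex.ofReal_tsum, ← (Equiv.prodComm ℤ ℤ).tsum_eq]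
  refine tsum_congr fun k => ?_
  simp only [theta3Term, latL, latGauss, latV, Equiv.prodComm_apply, Prod.fst_swap, Prod.snd_swap]
  push_cast
  congr 1
  · ring
  · congr 1
    linear_combination (3 * π / 2 * (2 * (α.1 + k.2) + (α.2 + k.1)) ^ 2 * t₁ +
      π / 2 * (α.2 + k.1) ^ 2 * t₂ : ℂ) * Complex.I_sq

theorem theta4_I_mul (α : ℝ × ℝ) (t₁ t₂ : ℝ) :
    theta4 α (t₁ * Complex.I) (t₂ * Complex.I) =
      ((∑' k, latL 3 α k * latGauss 3 α (π * (1 / 2) * t₁) (π * (3 / 2) * t₂) k : ℝ) : ℂ) := by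
  rw [theta4, Complex.ofReal_tsum]
  refine tsum_congr fun k => ?_
  simp only [theta4Term, latL, latGauss, latV]
  push_cast
  congr 1
  · ring
  · congr 1
    linear_combination (π / 2 * (3 * (α.1 + k.1) + 2 * (α.2 + k.2)) ^ 2 * t₁ +
      3 * π / 2 * (α.1 + k.1) ^ 2 * t₂ : ℂ) * Complex.I_sq

theorem theta5_I_mul (α : ℝ × ℝ) (t₁ t₂ : ℝ) :
    theta5 α (t₁ * Complex.I) (t₂ * Complex.I) =
      ((∑' k, latV α k * latGauss 3 α (π * (1 / 2) * t₁) (π * (3 / 2) * t₂) k : ℝ) : ℂ) := by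
  rw [theta5, Complex.ofReal_tsum]
  refine tsum_congr fun k => ?_
  simp only [theta5Term, latL, latGauss, latV]
  push_cast
  congr 2
  linear_combination (π / 2 * (3 * (α.1 + k.1) + 2 * (α.2 + k.2)) ^ 2 * t₁ +
      3 * π / 2 * (α.1 + k.1) ^ 2 * t₂ : ℂ) * Complex.I_sq

/-! ### Gaussian integrals -/

theorem integral_cexp_neg_pi_mul_sq {b : ℝ} (hb : 0 < b) {z : ℂ} (hz : 0 < z.re) :
    ∫ x : ℝ, Complex.exp (-(π * b * z) * x ^ 2) = 1 / (√b * z ^ (1 / 2 : ℂ)) := by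
  have hsb : 0 < √b := sqrt_pos.2 hb
  have h1 : ∫ x : ℝ, Complex.exp (-(π * z) * x ^ 2) = 1 / z ^ (1 / 2 : ℂ) := by
    rw [integral_gaussian_complex (by rw [Complex.re_ofReal_mul]; exact mul_pos pi_pos hz),
      div_mul_cancel_left₀ (Complex.ofReal_ne_zero.2 pi_ne_zero), Complex.inv_cpow, one_div ((_ : ℂ) ^ _)]
    intro h
    rw [Complex.arg_eq_pi_iff] at h
    linarith [h.1]
  have h2 := Measure.integral_comp_mul_left
    (fun x : ℝ => Complex.exp (-(π * z) * x ^ 2)) (√b)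
  rw [h1, abs_of_pos (inv_pos.2 hsb), Complex.real_smul] at h2
  rw [one_div, mul_inv, ← one_div (z ^ (1 / 2 : ℂ)), ← Complex.ofReal_inv, ← h2]
  refine integral_congr_ae (.of_forall fun x => ?_)
  have hs : (√b : ℂ) ^ 2 = b := by rw [← Complex.ofReal_pow, sq_sqrt hb.le]
  simp only [Complex.ofReal_mul, mul_pow, hs]
  congr 1
  ring

theorem integrable_sq_mul_cexp_neg_mul_sq {b : ℂ} (hb : 0 < b.re) :
    Integrable fun x : ℝ => (x : ℂ) ^ 2 * Complex.exp (-b * x ^ 2) := by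
  have h := integrable_rpow_mul_exp_neg_mul_sq hb (s := 2) (by norm_num)
  refine h.mono' (by fun_prop) (.of_forall fun x => le_of_eq ?_)
  have e : -b * (x : ℂ) ^ 2 = ((x ^ 2 : ℝ) : ℂ) * -b := by push_cast; ring
  rw [norm_mul, norm_pow, Complex.norm_real, Real.norm_eq_abs, sq_abs, Complex.norm_exp, e,
    Complex.re_ofReal_mul, Complex.neg_re, rpow_two]
  congr 2
  ring

theorem integral_sq_mul_cexp_neg_mul_sq {b : ℂ} (hb : 0 < b.re) :
    ∫ x : ℝ, (x : ℂ) ^ 2 * Complex.exp (-b * x ^ 2) =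
      1 / (2 * b) * ∫ x : ℝ, Complex.exp (-b * x ^ 2) := by
  have hb0 : b ≠ 0 := by rintro rfl; simp at hb
  have hd : ∀ x : ℝ, HasDerivAt (fun x : ℝ => (x : ℂ) * Complex.exp (-b * x ^ 2))
      (Complex.exp (-b * x ^ 2) - 2 * b * ((x : ℂ) ^ 2 * Complex.exp (-b * x ^ 2))) x := by
    intro x
    have h1 : HasDerivAt (fun x : ℝ => (x : ℂ)) 1 x := Complex.ofRealCLM.hasDerivAt
    have h2 := h1.mul (((h1.pow 2).const_mul (-b)).cexp)
    refine (h2.congr_deriv ?_)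
    simp only [Pi.pow_apply]
    push_cast
    ring
  have hi0 := integrable_cexp_neg_mul_sq hb
  have hi2 := integrable_sq_mul_cexp_neg_mul_sq hb
  have h0 := integral_eq_zero_of_hasDerivAt_of_integrable hd (hi0.sub (hi2.const_mul _))
    (integrable_mul_cexp_neg_mul_sq hb)
  rw [integral_sub hi0 (hi2.const_mul _), integral_const_mul, sub_eq_zero] at h0
  rw [h0, ← mul_assoc, one_div_mul_cancel (mul_ne_zero two_ne_zero hb0), one_mul]

theorem integral_sq_mul_cexp_neg_pi_mul_sq {b : ℝ} (hb : 0 < b) {z : ℂ} (hz : 0 < z.re) :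
    ∫ x : ℝ, (x : ℂ) ^ 2 * Complex.exp (-(π * b * z) * x ^ 2) =
      1 / (2 * π * b * √b * z ^ (3 / 2 : ℂ)) := by
  have hz0 : z ≠ 0 := by rintro rfl; simp at hz
  have hpb : (π : ℂ) * b = ((π * b : ℝ) : ℂ) := by push_cast; rfl
  rw [integral_sq_mul_cexp_neg_mul_sq
    (by rw [hpb, Complex.re_ofReal_mul]; positivity), integral_cexp_neg_pi_mul_sq hb hz,
    show (3 / 2 : ℂ) = 1 / 2 + 1 by norm_num, Complex.cpow_add _ _ hz0, Complex.cpow_one,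
    div_mul_div_comm, one_mul]
  congr 1
  ring

/-! ### Shears of the plane -/

/-- The map `(v, u) ↦ (v, σ u + c v)` with `σ = ±1`. -/
theorem measurePreserving_shear {σ : ℝ} (hσ : σ = 1 ∨ σ = -1) (c : ℝ) :
    MeasurePreserving (fun w : ℝ × ℝ => (w.1, σ * w.2 + c * w.1)) := by
  refine (MeasurePreserving.id (volume : Measure ℝ)).skew_product
    (g := fun v u => σ * u + c * v) (by simp only [Function.uncurry_def]; fun_prop)
    (.of_forall fun v => ?_)
  rcases hσ with rfl | rfl
  · simpa using (measurePreserving_add_right (volume : Measure ℝ) (c * v)).map_eq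
  · have := ((measurePreserving_add_right (volume : Measure ℝ) (c * v)).comp
      (Measure.measurePreserving_neg (volume : Measure ℝ))).map_eq
    simpa [Function.comp_def] using this

theorem measurableEmbedding_shear {σ : ℝ} (hσ : σ = 1 ∨ σ = -1) (c : ℝ) :
    MeasurableEmbedding (fun w : ℝ × ℝ => (w.1, σ * w.2 + c * w.1)) := by
  have h2 : σ * σ = 1 := by rcases hσ with rfl | rfl <;> norm_num
  let e : (ℝ × ℝ) ≃ᵐ (ℝ × ℝ) :=
    { toFun := fun w => (w.1, σ * w.2 + c * w.1)
      invFun := fun w => (w.1, σ * w.2 - σ * c * w.1)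
      left_inv := fun w => by
        ext
        · rfl
        · simp only; linear_combination w.2 * h2
      right_inv := fun w => by
        ext
        · rfl
        · simp only; linear_combination (w.2 - c * w.1) * h2
      measurable_toFun := by simp only [Equiv.coe_fn_mk]; fun_prop
      measurable_invFun := by simp only [Equiv.coe_fn_symm_mk]; fun_prop }
  exact e.measurableEmbedding

/-- A function that changes sign under the reflection `(v, u) ↦ (v, -u - κ v)` has integral `0`. -/
theorem integral_eq_zero_of_reflect (κ : ℝ) (f : ℝ × ℝ → ℂ)
    (hf : ∀ v u, f (v, -u - κ * v) = -f (v, u)) : ∫ w, f w = 0 := by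
  have h := (measurePreserving_shear (σ := -1) (Or.inr rfl) (-κ)).integral_comp
    (measurableEmbedding_shear (Or.inr rfl) (-κ)) f
  have h2 : ∫ w : ℝ × ℝ, f (w.1, -1 * w.2 + -κ * w.1) = -∫ w, f w := by
    rw [← integral_neg]
    refine integral_congr_ae (.of_forall fun w => ?_)
    simp only
    rw [← hf w.1 w.2]
    congr 2
    ring
  rw [h2, neg_eq_iff_add_eq_zero, ← two_mul] at h
  simpa using h

theorem integrable_shear_mul {κ : ℝ} {X Y : ℝ → ℂ} (hX : Integrable X) (hY : Integrable Y) :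
    Integrable fun w : ℝ × ℝ => Y w.1 * X (2 * w.2 + κ * w.1) := by
  have h := hY.mul_prod (hX.comp_mul_left' (two_ne_zero' ℝ))
  rw [← Measure.volume_eq_prod, ← (measurePreserving_shear (σ := 1) (Or.inl rfl) (κ / 2)).integrable_comp_emb
    (measurableEmbedding_shear (Or.inl rfl) _)] at h
  refine h.congr (.of_forall fun w => ?_)
  simp only [Function.comp_apply]
  congr 2
  ring

theorem integral_shear_mul (κ : ℝ) (X Y : ℝ → ℂ) :
    ∫ w : ℝ × ℝ, Y w.1 * X (2 * w.2 + κ * w.1) = 1 / 2 * (∫ x, X x) * ∫ x, Y x := by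
  have h := integral_prod_mul (μ := (volume : Measure ℝ)) (ν := (volume : Measure ℝ)) Y
    (fun u => X (2 * u))
  rw [← Measure.volume_eq_prod,
    ← (measurePreserving_shear (σ := 1) (Or.inl rfl) (κ / 2)).integral_comp
    (measurableEmbedding_shear (Or.inl rfl) _), Measure.integral_comp_mul_left X 2] at h
  rw [show (1 / 2 : ℂ) * (∫ x, X x) * ∫ x, Y x = (∫ x, Y x) * (|(2 : ℝ)⁻¹| • ∫ x, X x) by
    rw [abs_of_pos (by norm_num), Complex.real_smul]; push_cast; ring, ← h]
  refine integral_congr_ae (.of_forall fun w => ?_)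
  simp only
  congr 2
  ring

/-! ### Gaussian representation of the powers -/

/-- The Gaussian integral representing `z₁ ^ (-1/2) z₂ ^ (-3/2)`. -/
theorem integral_fst_sq_mul_gauss (κ : ℝ) {a b : ℝ} (ha : 0 < a) (hb : 0 < b) {z₁ z₂ : ℂ}
    (h₁ : 0 < z₁.re) (h₂ : 0 < z₂.re) :
    ∫ w : ℝ × ℝ, ((w.1 ^ 2 : ℝ) : ℂ) * Complex.exp (-(π * a * z₁) *
        ((2 * w.2 + κ * w.1 : ℝ) : ℂ) ^ 2 + -(π * b * z₂) * (w.1 : ℂ) ^ 2) =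
      1 / (4 * π * √a * √b * b) * (1 / (z₁ ^ (1 / 2 : ℂ) * z₂ ^ (3 / 2 : ℂ))) := by
  have h := integral_shear_mul κ (fun x : ℝ => Complex.exp (-(π * a * z₁) * x ^ 2))
    (fun x : ℝ => (x : ℂ) ^ 2 * Complex.exp (-(π * b * z₂) * x ^ 2))
  rw [integral_cexp_neg_pi_mul_sq ha h₁, integral_sq_mul_cexp_neg_pi_mul_sq hb h₂] at h
  rw [show 1 / (4 * (π : ℂ) * √a * √b * b) * (1 / (z₁ ^ (1 / 2 : ℂ) * z₂ ^ (3 / 2 : ℂ))) =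
    1 / 2 * (1 / (√a * z₁ ^ (1 / 2 : ℂ))) * (1 / (2 * π * b * √b * z₂ ^ (3 / 2 : ℂ))) by
      rw [div_mul_div_comm, div_mul_div_comm, div_mul_div_comm]
      congr 1
      · ring
      · generalize z₁ ^ (1 / 2 : ℂ) = A
        generalize z₂ ^ (3 / 2 : ℂ) = B
        ring, ← h]
  refine integral_congr_ae (.of_forall fun w => ?_)
  simp only
  rw [Complex.exp_add]
  push_cast
  ring

/-- The Gaussian integral representing `z₁ ^ (-3/2) z₂ ^ (-1/2)`. -/
theorem integral_shear_sq_mul_gauss (κ : ℝ) {a b : ℝ} (ha : 0 < a) (hb : 0 < b) {z₁ z₂ : ℂ}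
    (h₁ : 0 < z₁.re) (h₂ : 0 < z₂.re) :
    ∫ w : ℝ × ℝ, (((2 * w.2 + κ * w.1) ^ 2 : ℝ) : ℂ) * Complex.exp (-(π * a * z₁) *
        ((2 * w.2 + κ * w.1 : ℝ) : ℂ) ^ 2 + -(π * b * z₂) * (w.1 : ℂ) ^ 2) =
      1 / (4 * π * √a * √b * a) * (1 / (z₁ ^ (3 / 2 : ℂ) * z₂ ^ (1 / 2 : ℂ))) := by
  have h := integral_shear_mul κ
    (fun x : ℝ => (x : ℂ) ^ 2 * Complex.exp (-(π * a * z₁) * x ^ 2))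
    (fun x : ℝ => Complex.exp (-(π * b * z₂) * x ^ 2))
  rw [integral_cexp_neg_pi_mul_sq hb h₂, integral_sq_mul_cexp_neg_pi_mul_sq ha h₁] at h
  rw [show 1 / (4 * (π : ℂ) * √a * √b * a) * (1 / (z₁ ^ (3 / 2 : ℂ) * z₂ ^ (1 / 2 : ℂ))) =
    1 / 2 * (1 / (2 * π * a * √a * z₁ ^ (3 / 2 : ℂ))) * (1 / (√b * z₂ ^ (1 / 2 : ℂ))) by
      rw [div_mul_div_comm, div_mul_div_comm, div_mul_div_comm]
      congr 1
      · ring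
      · generalize z₁ ^ (3 / 2 : ℂ) = A
        generalize z₂ ^ (1 / 2 : ℂ) = B
        ring, ← h]
  refine integral_congr_ae (.of_forall fun w => ?_)
  simp only
  rw [Complex.exp_add]
  push_cast
  ring

theorem integrable_exp_neg_quadratic (κ : ℝ) {c d : ℝ} (hc : 0 < c) (hd : 0 < d) :
    Integrable fun w : ℝ × ℝ => exp (-(c * (2 * w.2 + κ * w.1) ^ 2 + d * w.1 ^ 2)) := by
  have h := (integrable_shear_mul (κ := κ) (integrable_exp_neg_mul_sq hc).ofReal
    (integrable_exp_neg_mul_sq hd).ofReal).re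
  refine h.congr (.of_forall fun w => ?_)
  simp only [RCLike.ofReal_eq_complex_ofReal, ← Complex.ofReal_mul, RCLike.re_eq_complex_re,
    Complex.ofReal_re, ← exp_add]
  congr 1
  ring

/-! ### Powers along the rays -/

theorem norm_one_div_cpow_le {z : ℂ} {x r : ℝ} (hx : 0 < x) (hz : x ≤ z.re) (hr : 0 ≤ r) :
    ‖1 / z ^ (r : ℂ)‖ ≤ x ^ (-r) := by
  have h : x ≤ ‖z‖ := hz.trans ((le_abs_self _).trans (Complex.abs_re_le_norm z))
  rw [norm_div, norm_one, Complex.norm_cpow_real, rpow_neg hx.le, one_div]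
  gcongr

/-- The product of powers in the denominators, at `w₁ = i t`, `w₂ = i (t + s)`. -/
def rayPow (τ ρ₁ ρ₂ : ℂ) (p : ℝ × ℝ) : ℂ :=
  ((p.1 : ℂ) - Complex.I * τ) ^ ρ₁ * (((p.1 + p.2 : ℝ) : ℂ) - Complex.I * τ) ^ ρ₂

theorem re_sub_I_mul (τ : ℂ) (t : ℝ) : ((t : ℂ) - Complex.I * τ).re = t + τ.im := by
  simp

theorem norm_one_div_rayPow_le {τ : ℂ} (hτ : 0 < τ.im) {r₁ r₂ : ℝ} (h₁ : 0 ≤ r₁) (h₂ : 0 ≤ r₂)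
    {t s : ℝ} (ht : 0 < t) (hs : 0 < s) :
    ‖1 / rayPow τ (r₁ : ℂ) (r₂ : ℂ) (t, s)‖ ≤ τ.im ^ (-r₁) * (τ.im + s) ^ (-r₂) := by
  rw [rayPow, ← one_div_mul_one_div, norm_mul]
  gcongr
  · exact norm_one_div_cpow_le hτ (by rw [re_sub_I_mul]; linarith) h₁
  · exact norm_one_div_cpow_le (by linarith) (by rw [re_sub_I_mul]; linarith) h₂

theorem measurable_rayPow (τ ρ₁ ρ₂ : ℂ) : Measurable (rayPow τ ρ₁ ρ₂) := by
  unfold rayPow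
  fun_prop

theorem integrableOn_rpow_mul_add_rpow {u v y : ℝ} (hu : -1 < u) (hv : 0 ≤ v) (huv : u - v < -1)
    (hy : 0 < y) : IntegrableOn (fun s : ℝ => s ^ u * (y + s) ^ (-v)) (Ioi 0) := by
  rw [← Ioc_union_Ioi_eq_Ioi zero_le_one]
  have hm : Measurable fun s : ℝ => s ^ u * (y + s) ^ (-v) := by fun_prop
  refine IntegrableOn.union ?_ ?_
  · have h := (intervalIntegral.intervalIntegrable_rpow' (a := 0) (b := 1) hu).1
    refine (h.mul_const (y ^ (-v))).mono' hm.aestronglyMeasurable ?_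
    refine (ae_restrict_iff' measurableSet_Ioc).2 (.of_forall fun s hs => ?_)
    have hs0 : 0 < s := hs.1
    rw [Real.norm_eq_abs, abs_of_nonneg (by positivity), rpow_neg hy.le, rpow_neg (by positivity)]
    gcongr
    linarith
  · have h := integrableOn_Ioi_rpow_of_lt huv one_pos
    refine Integrable.mono' h hm.aestronglyMeasurable ?_
    refine (ae_restrict_iff' measurableSet_Ioi).2 (.of_forall fun s hs => ?_)
    have hs0 : 0 < s := one_pos.trans hs
    rw [Real.norm_eq_abs, abs_of_nonneg (by positivity), sub_eq_add_neg, rpow_add hs0,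
      rpow_neg hs0.le, rpow_neg (by positivity)]
    gcongr
    linarith

/-! ### Integrals over the quadrant `t > ε`, `s > 0` -/

/-- Lebesgue measure on the quadrant `t > ε`, `s > 0`. -/
def rayMeasure (ε : ℝ) : Measure (ℝ × ℝ) :=
  (volume.restrict (Ioi ε)).prod (volume.restrict (Ioi 0))

instance (ε : ℝ) : SFinite (rayMeasure ε) := by unfold rayMeasure; infer_instance

theorem ae_rayMeasure {ε : ℝ} {P : ℝ × ℝ → Prop} (h : ∀ t s, ε < t → 0 < s → P (t, s)) :
    ∀ᵐ p ∂rayMeasure ε, P p := by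
  rw [rayMeasure, Measure.prod_restrict]
  exact (ae_restrict_iff' (measurableSet_Ioi.prod measurableSet_Ioi)).2
    (.of_forall fun p hp => h p.1 p.2 hp.1 hp.2)

/-- A measurable function on the quadrant dominated by an integrable product. -/
def RayBounded (ε : ℝ) (F : ℝ × ℝ → ℂ) : Prop :=
  Measurable F ∧ ∃ g₁ g₂ : ℝ → ℝ, IntegrableOn g₁ (Ioi ε) ∧ IntegrableOn g₂ (Ioi 0) ∧
    ∀ t s, ε < t → 0 < s → ‖F (t, s)‖ ≤ g₁ t * g₂ s

theorem RayBounded.integrable {ε : ℝ} {F : ℝ × ℝ → ℂ} (h : RayBounded ε F) :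
    Integrable F (rayMeasure ε) := by
  obtain ⟨hF, g₁, g₂, h₁, h₂, hb⟩ := h
  exact (Integrable.mul_prod h₁ h₂).mono' hF.aestronglyMeasurable (ae_rayMeasure hb)

theorem RayBounded.integrableOn {ε : ℝ} {F : ℝ × ℝ → ℂ} (h : RayBounded ε F) {t : ℝ} (ht : ε < t) :
    IntegrableOn (fun s => F (t, s)) (Ioi 0) := by
  obtain ⟨hF, g₁, g₂, h₁, h₂, hb⟩ := h
  refine Integrable.mono' (h₂.const_mul (g₁ t)) (hF.comp (by fun_prop)).aestronglyMeasurable ?_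
  exact (ae_restrict_iff' measurableSet_Ioi).2 (.of_forall fun s hs => hb t s ht hs)

/-- A theta series over `β + ℤ²` with coefficients `ℓ`, divided by powers, at `w₁ = i t`,
`w₂ = i (t + s)`. -/
def thetaRay (ℓ : ℤ × ℤ → ℝ) (κ : ℤ) (β : ℝ × ℝ) (a b : ℝ) (τ ρ₁ ρ₂ : ℂ) (p : ℝ × ℝ) : ℂ :=
  ((∑' k, ℓ k * latGauss κ β (π * a * p.1) (π * b * (p.1 + p.2)) k : ℝ) : ℂ) / rayPow τ ρ₁ ρ₂ p

/-- One term of `thetaRay`. -/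
def thetaRayTerm (ℓ : ℤ × ℤ → ℝ) (κ : ℤ) (β : ℝ × ℝ) (a b : ℝ) (τ ρ₁ ρ₂ : ℂ) (k : ℤ × ℤ)
    (p : ℝ × ℝ) : ℂ :=
  ((ℓ k * latGauss κ β (π * a * p.1) (π * b * (p.1 + p.2)) k : ℝ) : ℂ) / rayPow τ ρ₁ ρ₂ p

section

variable (ℓ : ℤ × ℤ → ℝ) (κ : ℤ) (β : ℝ × ℝ) (a b : ℝ) (τ ρ₁ ρ₂ : ℂ)

theorem measurable_thetaRay : Measurable (thetaRay ℓ κ β a b τ ρ₁ ρ₂) := by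
  unfold thetaRay
  refine (Complex.measurable_ofReal.comp (Measurable.tsum fun k => ?_)).div
    (measurable_rayPow τ ρ₁ ρ₂)
  unfold latGauss
  fun_prop

theorem measurable_thetaRayTerm (k : ℤ × ℤ) :
    Measurable (thetaRayTerm ℓ κ β a b τ ρ₁ ρ₂ k) := by
  unfold thetaRayTerm
  refine (Complex.measurable_ofReal.comp ?_).div (measurable_rayPow τ ρ₁ ρ₂)
  unfold latGauss
  fun_prop

theorem tsum_thetaRayTerm (p : ℝ × ℝ) :
    ∑' k, thetaRayTerm ℓ κ β a b τ ρ₁ ρ₂ k p = thetaRay ℓ κ β a b τ ρ₁ ρ₂ p := by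
  simp only [thetaRayTerm, thetaRay, tsum_div_const, Complex.ofReal_tsum]

variable {ℓ κ β a b τ ρ₁ ρ₂} in
theorem hasSum_integral_thetaRayTerm {ε : ℝ} {B : ℤ × ℤ → ℝ} (hB : Summable B)
    {g₁ g₂ : ℝ → ℝ}
    (h₁ : IntegrableOn g₁ (Ioi ε)) (h₂ : IntegrableOn g₂ (Ioi 0))
    (h : ∀ k t s, ε < t → 0 < s →
      ‖thetaRayTerm ℓ κ β a b τ ρ₁ ρ₂ k (t, s)‖ ≤ B k * (g₁ t * g₂ s)) :
    HasSum (fun k => ∫ p, thetaRayTerm ℓ κ β a b τ ρ₁ ρ₂ k p ∂rayMeasure ε)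
      (∫ p, thetaRay ℓ κ β a b τ ρ₁ ρ₂ p ∂rayMeasure ε) := by
  have hg : Integrable (fun p : ℝ × ℝ => g₁ p.1 * g₂ p.2) (rayMeasure ε) :=
    Integrable.mul_prod h₁ h₂
  have hi : ∀ k, Integrable (thetaRayTerm ℓ κ β a b τ ρ₁ ρ₂ k) (rayMeasure ε) := fun k =>
    (hg.const_mul (B k)).mono' (measurable_thetaRayTerm ..).aestronglyMeasurable
      (ae_rayMeasure (h k))
  have hs : Summable fun k => ∫ p, ‖thetaRayTerm ℓ κ β a b τ ρ₁ ρ₂ k p‖ ∂rayMeasure ε := by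
    refine (hB.mul_right (∫ p, g₁ p.1 * g₂ p.2 ∂rayMeasure ε)).of_nonneg_of_le
      (fun k => integral_nonneg fun p => norm_nonneg _) fun k => ?_
    rw [← integral_const_mul]
    exact integral_mono_ae (hi k).norm (hg.const_mul _) (ae_rayMeasure (h k))
  have := hasSum_integral_of_summable_integral_norm hi hs
  simpa only [tsum_thetaRayTerm] using this

end

theorem integrableOn_rpow_mul_exp {u q : ℝ} (hu : -1 < u) (hq : 0 < q) :
    IntegrableOn (fun x : ℝ => x ^ u * exp (-(q * x))) (Ioi 0) := by
  have := integrableOn_rpow_mul_exp_neg_mul_rpow hu one_pos hq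
  simpa only [rpow_one, neg_mul] using this

theorem integrableOn_exp_neg_mul {q : ℝ} (hq : 0 < q) (ε : ℝ) :
    IntegrableOn (fun x : ℝ => exp (-(q * x))) (Ioi ε) := by
  simpa only [neg_mul] using exp_neg_integrableOn_Ioi ε hq

theorem inv_sqrt_mul_add_le {B t s : ℝ} (hB : 0 < B) (ht : 0 < t) (hs : 0 < s) :
    (√(B * (t + s)))⁻¹ ≤ (√B)⁻¹ * s ^ (-(1 / 2) : ℝ) := by
  rw [rpow_neg hs.le, ← sqrt_eq_rpow, ← mul_inv, ← sqrt_mul hB.le]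
  gcongr
  linarith

theorem norm_one_div_rayPow_half_le {τ : ℂ} (hτ : 0 < τ.im) {t s : ℝ} (ht : 0 < t) (hs : 0 < s) :
    ‖1 / rayPow τ (1 / 2) (3 / 2) (t, s)‖ ≤
      τ.im ^ (-(1 / 2) : ℝ) * (τ.im + s) ^ (-(3 / 2) : ℝ) := by
  have := norm_one_div_rayPow_le hτ (r₁ := 1 / 2) (r₂ := 3 / 2) (by norm_num) (by norm_num) ht hs
  push_cast at this
  exact this

theorem norm_one_div_rayPow_half_le' {τ : ℂ} (hτ : 0 < τ.im) {t s : ℝ} (ht : 0 < t) (hs : 0 < s) :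
    ‖1 / rayPow τ (3 / 2) (1 / 2) (t, s)‖ ≤
      τ.im ^ (-(3 / 2) : ℝ) * τ.im ^ (-(1 / 2) : ℝ) := by
  have := norm_one_div_rayPow_le hτ (r₁ := 3 / 2) (r₂ := 1 / 2) (by norm_num) (by norm_num) ht hs
  push_cast at this
  refine this.trans ?_
  gcongr _ * ?_
  rw [rpow_neg hτ.le, rpow_neg (by positivity)]
  gcongr
  linarith

theorem rayBounded_thetaRay_latL (κ : ℤ) (β : ℝ × ℝ) {a b : ℝ} (ha : 0 < a) (hb : 0 < b) {τ : ℂ}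
    (hτ : 0 < τ.im) : RayBounded 0 (thetaRay (latL κ β) κ β a b τ (1 / 2) (3 / 2)) := by
  refine ⟨measurable_thetaRay .., ?_⟩
  obtain ⟨C, p, hC, hp, h⟩ := exists_abs_tsum_latL_mul_latGauss_le κ β
  refine ⟨fun t => C * τ.im ^ (-(1 / 2) : ℝ) * exp (-(p * (π * a) * t)),
    fun s => s ^ (0 : ℝ) * (τ.im + s) ^ (-(3 / 2) : ℝ) +
      (√(π * b))⁻¹ * (s ^ (-(1 / 2) : ℝ) * (τ.im + s) ^ (-(3 / 2) : ℝ)),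
    (integrableOn_exp_neg_mul (by positivity) 0).const_mul _,
    (integrableOn_rpow_mul_add_rpow (by norm_num) (by norm_num) (by norm_num) hτ).add
      ((integrableOn_rpow_mul_add_rpow (by norm_num) (by norm_num) (by norm_num) hτ).const_mul _),
    fun t s ht hs => ?_⟩
  have h1 := h (π * a * t) (π * b * (t + s)) (by positivity) (by positivity)
  have h2 := norm_one_div_rayPow_half_le hτ ht hs
  have h3 := inv_sqrt_mul_add_le (mul_pos pi_pos hb) ht hs
  rw [thetaRay, div_eq_mul_one_div, norm_mul, Complex.norm_real, Real.norm_eq_abs]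
  have h0 : 0 < τ.im + s := by positivity
  calc _ ≤ C * exp (-(p * (π * a * t))) * (1 + (√(π * b))⁻¹ * s ^ (-(1 / 2) : ℝ)) *
        (τ.im ^ (-(1 / 2) : ℝ) * (τ.im + s) ^ (-(3 / 2) : ℝ)) := by
        refine mul_le_mul (h1.trans ?_) h2 (norm_nonneg _) (by positivity)
        gcongr
    _ = _ := by
      simp only [rpow_zero, show p * (π * a) * t = p * (π * a * t) by ring]
      ring

theorem rayBounded_thetaRay_latV (κ : ℤ) (β : ℝ × ℝ) {a b : ℝ} (ha : 0 < a) (hb : 0 < b) {τ : ℂ}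
    (hτ : 0 < τ.im) : RayBounded 0 (thetaRay (latV β) κ β a b τ (3 / 2) (1 / 2)) := by
  refine ⟨measurable_thetaRay .., ?_⟩
  obtain ⟨C, p, hC, hp, h⟩ := exists_abs_tsum_latV_mul_latGauss_le κ β
  have hq : 0 < p * (π * b) := by positivity
  refine ⟨fun t => C * (τ.im ^ (-(3 / 2) : ℝ) * τ.im ^ (-(1 / 2) : ℝ)) *
      (t ^ (0 : ℝ) * exp (-(p * (π * b) * t)) + t ^ (-(1 / 4) : ℝ) * exp (-(p * (π * b) * t)) +
      (√(π * a))⁻¹ * (t ^ (-(1 / 2) : ℝ) * exp (-(p * (π * b) * t)) +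
        t ^ (-(3 / 4) : ℝ) * exp (-(p * (π * b) * t)))),
    fun s => (√(π * b))⁻¹ * (s ^ (-(1 / 2) : ℝ) * exp (-(p * (π * b) * s))) +
      (π * b)⁻¹ * (s ^ (-(3 / 4) : ℝ) * exp (-(p * (π * b) * s))),
    ?_, ?_, fun t s ht hs => ?_⟩
  · exact (((integrableOn_rpow_mul_exp (by norm_num) hq).add
      (integrableOn_rpow_mul_exp (by norm_num) hq)).add
      (((integrableOn_rpow_mul_exp (by norm_num) hq).add
      (integrableOn_rpow_mul_exp (by norm_num) hq)).const_mul _)).const_mul _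
  · exact ((integrableOn_rpow_mul_exp (by norm_num) hq).const_mul _).add
      ((integrableOn_rpow_mul_exp (by norm_num) hq).const_mul _)
  have hB : 0 < π * b := by positivity
  have h1 := h (π * a * t) (π * b * (t + s)) (by positivity) (by positivity)
  have h2 := norm_one_div_rayPow_half_le' hτ ht hs
  have h3 := inv_sqrt_mul_add_le hB ht hs
  have h4 : (√(π * b * (t + s)))⁻¹ * (√(π * b * (t + s)))⁻¹ ≤
      (π * b)⁻¹ * (t ^ (-(1 / 4) : ℝ) * s ^ (-(3 / 4) : ℝ)) := by
    have h5 : t ^ (1 / 4 : ℝ) * s ^ (3 / 4 : ℝ) ≤ t + s := by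
      calc _ ≤ (t + s) ^ (1 / 4 : ℝ) * (t + s) ^ (3 / 4 : ℝ) := by gcongr <;> linarith
        _ = _ := by rw [← rpow_add (by positivity)]; norm_num
    rw [← mul_inv, mul_self_sqrt (by positivity), rpow_neg ht.le, rpow_neg hs.le, ← mul_inv,
      ← mul_inv]
    gcongr
  have h6 : (√(π * a * t))⁻¹ = (√(π * a))⁻¹ * t ^ (-(1 / 2) : ℝ) := by
    rw [rpow_neg ht.le, ← sqrt_eq_rpow, ← mul_inv, ← sqrt_mul (by positivity)]
  have h7 : t ^ (-(3 / 4) : ℝ) = t ^ (-(1 / 2) : ℝ) * t ^ (-(1 / 4) : ℝ) := by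
    rw [← rpow_add ht]; norm_num
  have hexp : exp (-(p * (π * b * (t + s)))) =
      exp (-(p * (π * b) * t)) * exp (-(p * (π * b) * s)) := by
    rw [← exp_add]; ring_nf
  rw [thetaRay, div_eq_mul_one_div, norm_mul, Complex.norm_real, Real.norm_eq_abs]
  simp only [h7]
  rw [h6, hexp] at h1
  set A := (√(π * a))⁻¹ * t ^ (-(1 / 2) : ℝ)
  set E := exp (-(p * (π * b) * t)) * exp (-(p * (π * b) * s))
  set x := (√(π * b * (t + s)))⁻¹
  set Y := τ.im ^ (-(3 / 2) : ℝ) * τ.im ^ (-(1 / 2) : ℝ)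
  have hx0 : 0 ≤ x := by positivity
  have hA0 : 0 ≤ A := by positivity
  have hY0 : 0 ≤ Y := by positivity
  have hE0 : 0 ≤ E := by positivity
  have hs1 : 0 ≤ s ^ (-(1 / 2) : ℝ) := by positivity
  have ht4 : 0 ≤ t ^ (-(1 / 4) : ℝ) := by positivity
  have hs3 : 0 ≤ s ^ (-(3 / 4) : ℝ) := by positivity
  calc _ ≤ C * (x * E) * ((1 + A) * (1 + x)) * Y :=
        mul_le_mul h1 h2 (norm_nonneg _) (by positivity)
    _ = C * E * (1 + A) * Y * (x + x * x) := by ring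
    _ ≤ C * E * (1 + A) * Y * ((√(π * b))⁻¹ * s ^ (-(1 / 2) : ℝ) +
          (π * b)⁻¹ * (t ^ (-(1 / 4) : ℝ) * s ^ (-(3 / 4) : ℝ))) := by gcongr
    _ ≤ C * E * (1 + A) * Y * ((1 + t ^ (-(1 / 4) : ℝ)) * ((√(π * b))⁻¹ * s ^ (-(1 / 2) : ℝ) +
          (π * b)⁻¹ * s ^ (-(3 / 4) : ℝ))) := by
        have h8 : 0 ≤ t ^ (-(1 / 4) : ℝ) * ((√(π * b))⁻¹ * s ^ (-(1 / 2) : ℝ)) := by positivity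
        have h9 : 0 ≤ (π * b)⁻¹ * s ^ (-(3 / 4) : ℝ) := by positivity
        gcongr
        linarith
    _ = _ := by simp only [rpow_zero, A, E]; ring

theorem latGauss_le_latGauss (κ : ℤ) (β : ℝ × ℝ) {c d c' d' : ℝ} (hc : c' ≤ c) (hd : d' ≤ d)
    (k : ℤ × ℤ) : latGauss κ β c d k ≤ latGauss κ β c' d' k := by
  unfold latGauss
  gcongr

theorem hasSum_integral_thetaRay_latL (κ : ℤ) (β : ℝ × ℝ) {a b : ℝ} (ha : 0 < a) (hb : 0 < b)
    {τ : ℂ} (hτ : 0 < τ.im) {ε : ℝ} (hε : 0 < ε) :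
    HasSum (fun k => ∫ p, thetaRayTerm (latL κ β) κ β a b τ (1 / 2) (3 / 2) k p ∂rayMeasure ε)
      (∫ p, thetaRay (latL κ β) κ β a b τ (1 / 2) (3 / 2) p ∂rayMeasure ε) := by
  obtain ⟨p, hp, h⟩ := exists_abs_latL_mul_latGauss_le κ β
  refine hasSum_integral_thetaRayTerm
    (summable_latGauss κ β (c := π * a * ε / 4) (d := π * b * ε) (by positivity) (by positivity))
    ((integrableOn_exp_neg_mul (q := p * (π * a)) (by positivity) ε).const_mul
      ((√(π * a * ε))⁻¹ * τ.im ^ (-(1 / 2) : ℝ)))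
    (integrableOn_rpow_mul_add_rpow (u := 0) (v := 3 / 2) (by norm_num) (by norm_num)
      (by norm_num) hτ) fun k t s ht hs => ?_
  have ht0 : 0 < t := hε.trans ht
  have h1 := h (π * a * t) (π * b * (t + s)) (by positivity) k
  have h2 := norm_one_div_rayPow_half_le hτ ht0 hs
  rw [thetaRayTerm, div_eq_mul_one_div, norm_mul, Complex.norm_real, Real.norm_eq_abs]
  have h0 : 0 < τ.im + s := by positivity
  have h3 : latGauss κ β (π * a * t / 4) (π * b * (t + s)) k ≤
      latGauss κ β (π * a * ε / 4) (π * b * ε) k :=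
    latGauss_le_latGauss κ β (by gcongr) (by gcongr; linarith) k
  calc _ ≤ (√(π * a * ε))⁻¹ * exp (-(p * (π * a * t))) *
          latGauss κ β (π * a * ε / 4) (π * b * ε) k *
        (τ.im ^ (-(1 / 2) : ℝ) * (τ.im + s) ^ (-(3 / 2) : ℝ)) := by
        have := latGauss_pos κ β (π * a * ε / 4) (π * b * ε) k
        refine mul_le_mul (h1.trans ?_) h2 (norm_nonneg _) (by positivity)
        gcongr
        exact (latGauss_pos ..).le
    _ = _ := by
      rw [rpow_zero, show p * (π * a) * t = p * (π * a * t) by ring]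
      ring

theorem hasSum_integral_thetaRay_latV (κ : ℤ) (β : ℝ × ℝ) {a b : ℝ} (ha : 0 < a) (hb : 0 < b)
    {τ : ℂ} (hτ : 0 < τ.im) {ε : ℝ} (hε : 0 < ε) :
    HasSum (fun k => ∫ p, thetaRayTerm (latV β) κ β a b τ (3 / 2) (1 / 2) k p ∂rayMeasure ε)
      (∫ p, thetaRay (latV β) κ β a b τ (3 / 2) (1 / 2) p ∂rayMeasure ε) := by
  obtain ⟨p, hp, h⟩ := exists_abs_latV_mul_latGauss_le κ β
  refine hasSum_integral_thetaRayTerm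
    (summable_latGauss κ β (c := π * a * ε) (d := π * b * ε / 4) (by positivity) (by positivity))
    ((integrableOn_exp_neg_mul (q := p * (π * b)) (by positivity) ε).const_mul
      ((√(π * b * ε))⁻¹ * (τ.im ^ (-(3 / 2) : ℝ) * τ.im ^ (-(1 / 2) : ℝ))))
    (integrableOn_exp_neg_mul (q := p * (π * b)) (by positivity) 0) fun k t s ht hs => ?_
  have ht0 : 0 < t := hε.trans ht
  have h1 := h (π * a * t) (π * b * (t + s)) (by positivity) k
  have h2 := norm_one_div_rayPow_half_le' hτ ht0 hs
  rw [thetaRayTerm, div_eq_mul_one_div, norm_mul, Complex.norm_real, Real.norm_eq_abs]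
  have h3 : latGauss κ β (π * a * t) (π * b * (t + s) / 4) k ≤
      latGauss κ β (π * a * ε) (π * b * ε / 4) k :=
    latGauss_le_latGauss κ β (by gcongr) (by gcongr; linarith) k
  calc _ ≤ (√(π * b * ε))⁻¹ * exp (-(p * (π * b * (t + s)))) *
          latGauss κ β (π * a * ε) (π * b * ε / 4) k *
        (τ.im ^ (-(3 / 2) : ℝ) * τ.im ^ (-(1 / 2) : ℝ)) := by
        have := latGauss_pos κ β (π * a * ε) (π * b * ε / 4) k
        refine mul_le_mul (h1.trans ?_) h2 (norm_nonneg _) (by positivity)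
        gcongr
        · exact (latGauss_pos ..).le
        · linarith
    _ = _ := by
      rw [show -(p * (π * b * (t + s))) = -(p * (π * b) * t) + -(p * (π * b) * s) by ring, exp_add]
      ring

/-! ### Integrating a single term of the theta series -/

/-- The quadratic form `a (2 u + κ v)² + b v²` at `w = (v, u)`. -/
def ellip (κ a b : ℝ) (w : ℝ × ℝ) : ℝ := a * (2 * w.2 + κ * w.1) ^ 2 + b * w.1 ^ 2

theorem ellip_nonneg (κ : ℝ) {a b : ℝ} (ha : 0 ≤ a) (hb : 0 ≤ b) (w : ℝ × ℝ) :
    0 ≤ ellip κ a b w := by unfold ellip; positivity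

theorem ellip_pos (κ : ℝ) {a b : ℝ} (ha : 0 ≤ a) (hb : 0 < b) {w : ℝ × ℝ} (hw : w.1 ≠ 0) :
    0 < ellip κ a b w := by unfold ellip; positivity

theorem continuous_ellip (κ a b : ℝ) : Continuous (ellip κ a b) := by unfold ellip; fun_prop

theorem integrable_exp_neg_mul_ellip (κ : ℝ) {a b c : ℝ} (ha : 0 < a) (hb : 0 < b) (hc : 0 < c) :
    Integrable fun w : ℝ × ℝ => exp (-(c * ellip κ a b w)) := by
  refine (integrable_exp_neg_quadratic κ (mul_pos hc ha) (mul_pos hc hb)).congr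
    (.of_forall fun w => ?_)
  simp only [ellip]
  congr 1
  ring

theorem ae_fst_ne_zero : ∀ᵐ w : ℝ × ℝ, w.1 ≠ 0 := by
  have h : ∀ᵐ x : ℝ, x ≠ 0 := by simp [ae_iff]
  rw [Measure.volume_eq_prod]
  exact Measure.quasiMeasurePreserving_fst.ae h

theorem ae_snd_ne_zero : ∀ᵐ w : ℝ × ℝ, w.2 ≠ 0 := by
  have h : ∀ᵐ x : ℝ, x ≠ 0 := by simp [ae_iff]
  rw [Measure.volume_eq_prod]
  exact Measure.quasiMeasurePreserving_snd.ae h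

theorem integral_exp_neg_mul_Ioi {q : ℝ} (hq : 0 < q) (ε : ℝ) :
    ∫ x in Ioi ε, exp (-(q * x)) = exp (-(q * ε)) / q := by
  have := integral_exp_mul_Ioi (neg_lt_zero.2 hq) ε
  simpa only [neg_mul, neg_div_neg_eq] using this

theorem integral_rayMeasure_exp {q r : ℝ} (hq : 0 < q) (hr : 0 < r) (ε : ℝ) :
    ∫ p, exp (-(q * p.1)) * exp (-(r * p.2)) ∂rayMeasure ε = exp (-(q * ε)) / (q * r) := by
  rw [rayMeasure, integral_prod_mul (fun x => exp (-(q * x))) (fun x => exp (-(r * x))),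
    integral_exp_neg_mul_Ioi hq, integral_exp_neg_mul_Ioi hr]
  rw [mul_zero, neg_zero, exp_zero, div_mul_div_comm, mul_one]

theorem norm_cexp_I_mul (τ : ℂ) (q : ℝ) :
    ‖Complex.exp (Complex.I * π * τ * q)‖ = exp (-(π * τ.im * q)) := by
  rw [Complex.norm_exp]
  congr 1
  have : Complex.I * π * τ * q = ((π * q : ℝ) : ℂ) * (Complex.I * τ) := by push_cast; ring
  rw [this, Complex.re_ofReal_mul, Complex.I_mul_re]
  ring

theorem integral_rayMeasure_gauss (κ : ℝ) {a b : ℝ} (ha : 0 < a) (hb : 0 < b) {τ : ℂ}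
    (hτ : 0 < τ.im) {ε : ℝ} (hε : 0 < ε) {q V l C : ℝ} (hq : 0 ≤ q) {m : ℝ × ℝ → ℝ}
    (hm : Continuous m) (hm0 : ∀ w, 0 ≤ m w)
    (hC : ∀ w, |l| * m w ≤ C * ((q + ellip κ a b w) * (V ^ 2 + w.1 ^ 2))) :
    ∫ p, (∫ w, ((l * m w * (exp (-(π * (q + ellip κ a b w) * p.1)) *
        exp (-(π * b * (V ^ 2 + w.1 ^ 2) * p.2))) : ℝ) : ℂ) *
        Complex.exp (Complex.I * π * τ * ellip κ a b w)) ∂rayMeasure ε =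
      ∫ w, ((l * m w / (π * (q + ellip κ a b w) * (π * b * (V ^ 2 + w.1 ^ 2))) *
        exp (-(π * (q + ellip κ a b w) * ε)) : ℝ) : ℂ) *
        Complex.exp (Complex.I * π * τ * ellip κ a b w) := by
  have hE := continuous_ellip κ a b
  have hint : ∀ w : ℝ × ℝ, w.1 ≠ 0 → Integrable (fun p : ℝ × ℝ =>
      exp (-(π * (q + ellip κ a b w) * p.1)) * exp (-(π * b * (V ^ 2 + w.1 ^ 2) * p.2)))
      (rayMeasure ε) := fun w hw => by
    have h1 := ellip_pos κ ha.le hb hw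
    exact Integrable.mul_prod (integrableOn_exp_neg_mul (by positivity) ε)
      (integrableOn_exp_neg_mul (by positivity) 0)
  have hval : ∀ w : ℝ × ℝ, w.1 ≠ 0 → ∫ p, exp (-(π * (q + ellip κ a b w) * p.1)) *
      exp (-(π * b * (V ^ 2 + w.1 ^ 2) * p.2)) ∂rayMeasure ε =
      exp (-(π * (q + ellip κ a b w) * ε)) /
        (π * (q + ellip κ a b w) * (π * b * (V ^ 2 + w.1 ^ 2))) := fun w hw => by
    have h1 := ellip_pos κ ha.le hb hw
    exact integral_rayMeasure_exp (by positivity) (by positivity) ε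
  rw [integral_integral_swap (μ := rayMeasure ε) (ν := (volume : Measure (ℝ × ℝ)))
    (f := fun p w => ((l * m w * (exp (-(π * (q + ellip κ a b w) * p.1)) *
        exp (-(π * b * (V ^ 2 + w.1 ^ 2) * p.2))) : ℝ) : ℂ) *
        Complex.exp (Complex.I * π * τ * ellip κ a b w))]
  · refine integral_congr_ae ?_
    filter_upwards [ae_fst_ne_zero] with w hw
    rw [integral_mul_const, integral_complex_ofReal, integral_const_mul, hval w hw]
    congr 2
    ring
  · rw [integrable_prod_iff' (by
      refine Continuous.aestronglyMeasurable ?_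
      simp only [Function.uncurry_def]
      fun_prop)]
    constructor
    · filter_upwards [ae_fst_ne_zero] with w hw
      have := ((hint w hw).const_mul (l * m w)).ofReal (𝕜 := ℂ)
      exact this.mul_const (Complex.exp (Complex.I * π * τ * ellip κ a b w))
    · have hH : Integrable fun w : ℝ × ℝ => |l| * m w * (exp (-(π * (q + ellip κ a b w) * ε)) /
          (π * (q + ellip κ a b w) * (π * b * (V ^ 2 + w.1 ^ 2)))) *
          exp (-(π * τ.im * ellip κ a b w)) := by
        refine ((integrable_exp_neg_mul_ellip κ ha hb (c := π * τ.im) (by positivity)).const_mul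
          (C / (π * π * b))).mono' ?_ ?_
        · have := hE.measurable
          have := hm.measurable
          exact Measurable.aestronglyMeasurable (by fun_prop)
        · filter_upwards [ae_fst_ne_zero] with w hw
          have h1 := ellip_pos κ ha.le hb hw
          have h2 := hm0 w
          have h3 : 0 < V ^ 2 + w.1 ^ 2 := by positivity
          rw [Real.norm_eq_abs, abs_of_nonneg (by positivity)]
          gcongr ?_ * _
          have h4 : exp (-(π * (q + ellip κ a b w) * ε)) ≤ 1 :=
            exp_le_one_iff.2 (neg_nonpos.2 (by positivity))
          calc _ ≤ |l| * m w * (1 / (π * (q + ellip κ a b w) * (π * b * (V ^ 2 + w.1 ^ 2)))) := by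
                gcongr
            _ = |l| * m w / ((π * π * b) * ((q + ellip κ a b w) * (V ^ 2 + w.1 ^ 2))) := by
                rw [mul_one_div]; congr 1; ring
            _ ≤ C * ((q + ellip κ a b w) * (V ^ 2 + w.1 ^ 2)) /
                ((π * π * b) * ((q + ellip κ a b w) * (V ^ 2 + w.1 ^ 2))) :=
                div_le_div_of_nonneg_right (hC w) (by positivity)
            _ = _ := by field_simp
      refine hH.congr ?_
      filter_upwards [ae_fst_ne_zero] with w hw
      rw [← hval w hw, ← integral_const_mul, ← integral_mul_const]
      refine integral_congr_ae (.of_forall fun p => ?_)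
      simp only [Function.uncurry_apply_pair, norm_mul, Complex.norm_real, norm_cexp_I_mul, Real.norm_eq_abs, 
        abs_exp, abs_of_nonneg (hm0 w)]

section

variable (κ : ℤ) (β : ℝ × ℝ) {a b : ℝ} {τ : ℂ} {ε : ℝ} (k : ℤ × ℤ)

/-- The form `a L² + b V²` on the shifted lattice. -/
def latEllip (κ : ℤ) (β : ℝ × ℝ) (a b : ℝ) (k : ℤ × ℤ) : ℝ :=
  a * latL κ β k ^ 2 + b * latV β k ^ 2

/-- The kernel attached to a term with coefficient `l` of the theta series, and a weight `m`. -/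
def rayKernel (κ : ℤ) (β : ℝ × ℝ) (a b : ℝ) (l : ℝ) (m : ℝ × ℝ → ℝ) (k : ℤ × ℤ) (w : ℝ × ℝ) : ℝ :=
  l * m w / ((latEllip κ β a b k + ellip κ a b w) * (latV β k ^ 2 + w.1 ^ 2))

/-- The factor `exp (-π ε (q(n) + q(w))) exp (π i τ q(w))`. -/
def rayWeight (κ : ℤ) (β : ℝ × ℝ) (a b : ℝ) (τ : ℂ) (ε : ℝ) (k : ℤ × ℤ) (w : ℝ × ℝ) : ℂ :=
  ((exp (-(π * (latEllip κ β a b k + ellip κ a b w) * ε)) : ℝ) : ℂ) *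
    Complex.exp (Complex.I * π * τ * ellip κ a b w)

theorem integral_rayMeasure_gauss_lattice (ha : 0 < a) (hb : 0 < b) (hτ : 0 < τ.im) (hε : 0 < ε)
    {l C : ℝ} {m : ℝ × ℝ → ℝ} (hm : Continuous m) (hm0 : ∀ w, 0 ≤ m w)
    (hC : ∀ w, |l| * m w ≤
      C * ((latEllip κ β a b k + ellip κ a b w) * (latV β k ^ 2 + w.1 ^ 2))) :
    ∫ p : ℝ × ℝ, ((l * latGauss κ β (π * a * p.1) (π * b * (p.1 + p.2)) k : ℝ) : ℂ) *
      (∫ w : ℝ × ℝ, (m w : ℂ) * Complex.exp (-(π * a * (p.1 - Complex.I * τ)) *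
        ((2 * w.2 + κ * w.1 : ℝ) : ℂ) ^ 2 +
        -(π * b * ((p.1 + p.2 : ℝ) - Complex.I * τ)) * (w.1 : ℂ) ^ 2)) ∂rayMeasure ε =
      1 / (π * π * b) * ∫ w, (rayKernel κ β a b l m k w : ℂ) * rayWeight κ β a b τ ε k w := by
  have hq : 0 ≤ latEllip κ β a b k := by unfold latEllip; positivity
  have h := integral_rayMeasure_gauss κ ha hb hτ hε hq hm hm0 hC
  rw [← integral_const_mul]
  convert h using 1
  · refine integral_congr_ae (.of_forall fun p => ?_)
    simp only
    rw [← integral_const_mul]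
    refine integral_congr_ae (.of_forall fun w => ?_)
    simp only [latGauss]
    push_cast
    have e : ∀ x y z : ℂ, x * Complex.exp y * Complex.exp z = x * Complex.exp (y + z) :=
      fun x y z => by rw [Complex.exp_add, mul_assoc]
    rw [← Complex.exp_add, e, mul_mul_mul_comm, ← Complex.exp_add]
    congr 2
    simp only [ellip, latEllip]
    push_cast
    ring
  · refine integral_congr_ae (.of_forall fun w => ?_)
    simp only [rayKernel, rayWeight]
    rw [← mul_assoc, ← mul_assoc]
    congr 1
    push_cast
    congr 1
    rw [div_mul_div_comm, one_mul]
    congr 1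
    ring

theorem integral_thetaRayTerm_latL (ha : 0 < a) (hb : 0 < b) (hτ : 0 < τ.im) (hε : 0 < ε) :
    ∫ p, thetaRayTerm (latL κ β) κ β a b τ (1 / 2) (3 / 2) k p ∂rayMeasure ε =
      4 * √a * √b / π * ∫ w, (rayKernel κ β a b (latL κ β k) (fun w => w.1 ^ 2) k w : ℂ) *
        rayWeight κ β a b τ ε k w := by
  have h := integral_rayMeasure_gauss_lattice κ β k ha hb hτ hε (l := latL κ β k)
    (m := fun w => w.1 ^ 2) (C := |latL κ β k| / (a * latL κ β k ^ 2)) (by fun_prop)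
    (fun w => sq_nonneg _) (fun w => by
      rcases eq_or_ne (latL κ β k) 0 with h0 | h0
      · simp [h0]
      · have h1 := ellip_nonneg κ ha.le hb.le w
        rw [div_mul_eq_mul_div, le_div_iff₀ (by positivity), mul_assoc]
        refine mul_le_mul_of_nonneg_left ?_ (abs_nonneg _)
        have h2 : 0 ≤ latEllip κ β a b k := by unfold latEllip; positivity
        rw [mul_comm]
        refine mul_le_mul ?_ ?_ (sq_nonneg _) (by positivity)
        · rw [latEllip]; nlinarith [mul_nonneg hb.le (sq_nonneg (latV β k))]
        · nlinarith [sq_nonneg (latV β k)])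
  have hsa := sqrt_pos.2 ha
  have hsb := sqrt_pos.2 hb
  have e : (4 * √a * √b / π : ℂ) = (4 * π * √a * √b * b) * (1 / (π * π * b)) := by
    have : (π : ℂ) ≠ 0 := Complex.ofReal_ne_zero.2 pi_ne_zero
    have : (b : ℂ) ≠ 0 := Complex.ofReal_ne_zero.2 hb.ne'
    field_simp
  rw [e, mul_assoc, ← h, ← integral_const_mul]
  refine integral_congr_ae (ae_rayMeasure fun t s ht hs => ?_)
  have h1 := integral_fst_sq_mul_gauss (κ : ℝ) ha hb (z₁ := (t : ℂ) - Complex.I * τ)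
    (z₂ := ((t + s : ℝ) : ℂ) - Complex.I * τ) (by rw [re_sub_I_mul]; linarith)
    (by rw [re_sub_I_mul]; linarith)
  simp only [thetaRayTerm, rayPow]
  rw [h1]
  have n1 : (π : ℂ) ≠ 0 := Complex.ofReal_ne_zero.2 pi_ne_zero
  have n2 : (b : ℂ) ≠ 0 := Complex.ofReal_ne_zero.2 hb.ne'
  have n3 : (√a : ℂ) ≠ 0 := Complex.ofReal_ne_zero.2 hsa.ne'
  have n4 : (√b : ℂ) ≠ 0 := Complex.ofReal_ne_zero.2 hsb.ne'
  have h2 : (4 * (π : ℂ) * √a * √b * b) * (1 / (4 * (π : ℂ) * √a * √b * b)) = 1 :=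
    mul_one_div_cancel
      (mul_ne_zero (mul_ne_zero (mul_ne_zero (mul_ne_zero (by norm_num) n1) n3) n4) n2)
  rw [div_eq_mul_one_div]
  linear_combination (-(((latL κ β k * latGauss κ β (π * a * t) (π * b * (t + s)) k : ℝ) : ℂ) *
    (1 / (((t : ℂ) - Complex.I * τ) ^ (1 / 2 : ℂ) *
      (((t + s : ℝ) : ℂ) - Complex.I * τ) ^ (3 / 2 : ℂ))))) * h2

theorem integral_thetaRayTerm_latV (ha : 0 < a) (hb : 0 < b) (hτ : 0 < τ.im) (hε : 0 < ε) :
    ∫ p, thetaRayTerm (latV β) κ β a b τ (3 / 2) (1 / 2) k p ∂rayMeasure ε =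
      4 * √a * √b * a / (π * b) * ∫ w, (rayKernel κ β a b (latV β k)
        (fun w => (2 * w.2 + κ * w.1) ^ 2) k w : ℂ) * rayWeight κ β a b τ ε k w := by
  have h := integral_rayMeasure_gauss_lattice κ β k ha hb hτ hε (l := latV β k)
    (m := fun w => (2 * w.2 + κ * w.1) ^ 2) (C := |latV β k| / (a * latV β k ^ 2)) (by fun_prop)
    (fun w => sq_nonneg _) (fun w => by
      rcases eq_or_ne (latV β k) 0 with h0 | h0
      · simp [h0]
      · have h1 := ellip_nonneg κ ha.le hb.le w
        rw [div_mul_eq_mul_div, le_div_iff₀ (by positivity), mul_assoc]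
        refine mul_le_mul_of_nonneg_left ?_ (abs_nonneg _)
        have h2 : 0 ≤ latEllip κ β a b k := by unfold latEllip; positivity
        rw [← mul_assoc, mul_comm _ a]
        refine mul_le_mul ?_ ?_ (sq_nonneg _) (by positivity)
        · rw [latEllip, ellip]
          nlinarith [mul_nonneg hb.le (sq_nonneg (latV β k)), mul_nonneg hb.le (sq_nonneg w.1),
            mul_nonneg ha.le (sq_nonneg (latL κ β k))]
        · nlinarith [sq_nonneg w.1])
  have hsa := sqrt_pos.2 ha
  have hsb := sqrt_pos.2 hb
  have e : (4 * √a * √b * a / (π * b) : ℂ) = (4 * π * √a * √b * a) * (1 / (π * π * b)) := by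
    have : (π : ℂ) ≠ 0 := Complex.ofReal_ne_zero.2 pi_ne_zero
    have : (b : ℂ) ≠ 0 := Complex.ofReal_ne_zero.2 hb.ne'
    field_simp
  rw [e, mul_assoc, ← h, ← integral_const_mul]
  refine integral_congr_ae (ae_rayMeasure fun t s ht hs => ?_)
  have h1 := integral_shear_sq_mul_gauss (κ : ℝ) ha hb (z₁ := (t : ℂ) - Complex.I * τ)
    (z₂ := ((t + s : ℝ) : ℂ) - Complex.I * τ) (by rw [re_sub_I_mul]; linarith)
    (by rw [re_sub_I_mul]; linarith)
  simp only [thetaRayTerm, rayPow]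
  rw [h1]
  have n1 : (π : ℂ) ≠ 0 := Complex.ofReal_ne_zero.2 pi_ne_zero
  have n2 : (a : ℂ) ≠ 0 := Complex.ofReal_ne_zero.2 ha.ne'
  have n3 : (√a : ℂ) ≠ 0 := Complex.ofReal_ne_zero.2 hsa.ne'
  have n4 : (√b : ℂ) ≠ 0 := Complex.ofReal_ne_zero.2 hsb.ne'
  have h2 : (4 * (π : ℂ) * √a * √b * a) * (1 / (4 * (π : ℂ) * √a * √b * a)) = 1 :=
    mul_one_div_cancel
      (mul_ne_zero (mul_ne_zero (mul_ne_zero (mul_ne_zero (by norm_num) n1) n3) n4) n2)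
  rw [div_eq_mul_one_div]
  linear_combination (-(((latV β k * latGauss κ β (π * a * t) (π * b * (t + s)) k : ℝ) : ℂ) *
    (1 / (((t : ℂ) - Complex.I * τ) ^ (3 / 2 : ℂ) *
      (((t + s : ℝ) : ℂ) - Complex.I * τ) ^ (1 / 2 : ℂ))))) * h2

end

/-! ### Gaussian summation of conditionally convergent lattice sums -/

theorem summable_one_div_sq_add_one : Summable fun k : ℤ => 1 / ((k : ℝ) ^ 2 + 1) := by
  have h1 : Summable fun k : ℤ => 1 / (k : ℝ) ^ 2 :=
    Real.summable_one_div_int_pow.2 (by norm_num)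
  have h2 : Summable fun k : ℤ => if k = 0 then (1 : ℝ) else 0 :=
    (hasSum_ite_eq (0 : ℤ) (1 : ℝ)).summable
  refine (h1.add h2).of_nonneg_of_le (fun k => by positivity) fun k => ?_
  split_ifs with h
  · simp [h]
  · have : (k : ℝ) ≠ 0 := by exact_mod_cast h
    rw [add_zero]
    gcongr
    linarith

/-- The odd model sequence `k / (k² + 1)`. -/
def oddSeq (k : ℤ) : ℝ := k / ((k : ℝ) ^ 2 + 1)

theorem oddSeq_neg (k : ℤ) : oddSeq (-k) = -oddSeq k := by
  simp [oddSeq, neg_div]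

theorem abs_oddSeq_mul_le (k : ℤ) : |oddSeq k| * |(k : ℝ)| ≤ 1 := by
  rw [oddSeq, abs_div, abs_of_pos (a := (k : ℝ) ^ 2 + 1) (by positivity), div_mul_eq_mul_div,
    div_le_one (by positivity), abs_mul_abs_self]
  nlinarith

theorem abs_oddSeq_le (k : ℤ) : |oddSeq k| ≤ 1 := by
  rw [oddSeq, abs_div, abs_of_pos (a := (k : ℝ) ^ 2 + 1) (by positivity), div_le_one (by positivity)]
  nlinarith [sq_nonneg (|(k : ℝ)| - 1), sq_abs (k : ℝ)]

theorem abs_exp_neg_sub_exp_neg_le (x y : ℝ) :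
    |exp (-x) - exp (-y)| ≤ |x - y| * (exp (-x) + exp (-y)) := by
  have key : ∀ x y : ℝ, x ≤ y → |exp (-x) - exp (-y)| ≤ |x - y| * (exp (-x) + exp (-y)) := by
    intro x y h
    have h1 : exp (-y) ≤ exp (-x) := exp_le_exp.2 (by linarith)
    rw [abs_of_nonneg (by linarith), abs_of_nonpos (by linarith)]
    have h2 : exp (-y) = exp (-x) * exp (x - y) := by rw [← exp_add]; ring_nf
    have h3 := add_one_le_exp (x - y)
    have h4 := exp_pos (-x)
    have h5 := exp_pos (-y)
    nlinarith
  rcases le_total x y with h | h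
  · exact key x y h
  · rw [abs_sub_comm, abs_sub_comm x, add_comm]
    exact key y x h

theorem exists_abs_tsum_oddSeq_mul_exp_le : ∃ C : ℝ, 0 < C ∧ ∀ a c : ℝ, 0 < c →
    |∑' k : ℤ, oddSeq k * exp (-(c * (a + k) ^ 2))| ≤ C * |a| * (c + √c) := by
  obtain ⟨C, hC, h⟩ := exists_tsum_exp_neg_mul_sq_int_le
  refine ⟨4 * C, by positivity, fun a c hc => ?_⟩
  have hs := summable_exp_neg_mul_sq_int a hc
  have hs' : Summable fun k : ℤ => exp (-(c * (a + (-k : ℤ)) ^ 2)) :=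
    (Equiv.neg ℤ).summable_iff.2 hs
  have hs1 : Summable fun k : ℤ => oddSeq k * exp (-(c * (a + k) ^ 2)) :=
    hs.of_norm_bounded fun k => by
      rw [norm_mul, Real.norm_eq_abs, Real.norm_eq_abs, abs_exp]
      exact mul_le_of_le_one_left (exp_pos _).le (abs_oddSeq_le k)
  have hs2 : Summable fun k : ℤ => oddSeq (-k) * exp (-(c * (a + (-k : ℤ)) ^ 2)) :=
    (Equiv.neg ℤ).summable_iff.2 hs1
  have e1 : ∑' k : ℤ, oddSeq k * exp (-(c * (a + k) ^ 2)) =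
      ∑' k : ℤ, oddSeq (-k) * exp (-(c * (a + (-k : ℤ)) ^ 2)) :=
    ((Equiv.neg ℤ).tsum_eq fun k : ℤ => oddSeq k * exp (-(c * (a + k) ^ 2))).symm
  have e2 : ∑' k : ℤ, exp (-(c * (a + (-k : ℤ)) ^ 2)) = ∑' k : ℤ, exp (-(c * (a + k) ^ 2)) :=
    (Equiv.neg ℤ).tsum_eq fun k : ℤ => exp (-(c * (a + k) ^ 2))
  have e3 : 2 * ∑' k : ℤ, oddSeq k * exp (-(c * (a + k) ^ 2)) =
      ∑' k : ℤ, oddSeq k * (exp (-(c * (a + k) ^ 2)) - exp (-(c * (a + (-k : ℤ)) ^ 2))) := by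
    rw [two_mul]
    nth_rewrite 2 [e1]
    rw [← hs1.tsum_add hs2]
    refine tsum_congr fun k => ?_
    rw [oddSeq_neg]
    ring
  have e4 : |2 * ∑' k : ℤ, oddSeq k * exp (-(c * (a + k) ^ 2))| ≤
      4 * c * |a| * (2 * (C * (1 + (√c)⁻¹))) := by
    rw [e3, ← Real.norm_eq_abs]
    refine (tsum_of_norm_bounded ((hs.add hs').mul_left (4 * c * |a|)).hasSum fun k => ?_).trans ?_
    · rw [norm_mul, Real.norm_eq_abs, Real.norm_eq_abs]
      have h1 := abs_exp_neg_sub_exp_neg_le (c * (a + k) ^ 2) (c * (a + (-k : ℤ)) ^ 2)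
      have h2 : |c * (a + k) ^ 2 - c * (a + (-k : ℤ)) ^ 2| = 4 * c * |a| * |(k : ℝ)| := by
        rw [show c * (a + k) ^ 2 - c * (a + (-k : ℤ)) ^ 2 = 4 * c * a * k by push_cast; ring,
          abs_mul, abs_mul, abs_of_pos (by positivity : 0 < 4 * c)]
      rw [h2] at h1
      set E := exp (-(c * (a + k) ^ 2)) + exp (-(c * (a + (-k : ℤ)) ^ 2))
      have hE : 0 < E := by positivity
      calc _ ≤ |oddSeq k| * (4 * c * |a| * |(k : ℝ)| * E) := by gcongr
        _ = (|oddSeq k| * |(k : ℝ)|) * (4 * c * |a| * E) := by ring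
        _ ≤ 1 * (4 * c * |a| * E) := by gcongr; exact abs_oddSeq_mul_le k
        _ = _ := one_mul _
    · rw [tsum_mul_left, hs.tsum_add hs', e2, ← two_mul]
      gcongr
      exact h a c hc
  rw [abs_mul, abs_two] at e4
  have hsc : 0 < √c := sqrt_pos.2 hc
  have e5 : c * (√c)⁻¹ = √c := by
    rw [mul_inv_eq_iff_eq_mul₀ hsc.ne', mul_self_sqrt hc.le]
  have e6 : 4 * c * |a| * (2 * (C * (1 + (√c)⁻¹))) = 2 * (4 * C * |a| * (c + c * (√c)⁻¹)) := by ring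
  rw [e6, e5] at e4
  linarith

theorem exists_abs_tsum_oddSeq_mul_latGauss_le (κ : ℤ) (β : ℝ × ℝ) {c d : ℝ} (hc : 0 < c)
    (hd : 0 < d) : ∃ C : ℝ, 0 < C ∧ ∀ ε : ℝ, 0 < ε → ε ≤ 1 → ∀ j : ℤ,
      |∑' k : ℤ, oddSeq k * latGauss κ β (ε * c) (ε * d) (j, k)| ≤ C ∧
      |∑' k : ℤ, oddSeq k * latGauss κ β (ε * c) (ε * d) (j, k)| ≤
        C * (1 + |β.1 + j|) * √ε := by
  obtain ⟨C, hC, h⟩ := exists_abs_tsum_oddSeq_mul_exp_le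
  set B := C * (4 * c + √(4 * c)) * (|β.2| + |(κ : ℝ)|) with hB
  have hB0 : 0 ≤ B := by positivity
  have main : ∀ ε : ℝ, 0 < ε → ε ≤ 1 → ∀ j : ℤ,
      |∑' k : ℤ, oddSeq k * latGauss κ β (ε * c) (ε * d) (j, k)| ≤
        B * ((1 + |β.1 + j|) * √ε * exp (-(ε * d * (β.1 + j) ^ 2))) := by
    intro ε hε hε1 j
    have e : ∑' k : ℤ, oddSeq k * latGauss κ β (ε * c) (ε * d) (j, k) =
        exp (-(ε * d * (β.1 + j) ^ 2)) * ∑' k : ℤ, oddSeq k *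
          exp (-(4 * (ε * c) * ((β.2 + κ * β.1 / 2 + κ * j / 2) + k) ^ 2)) := by
      rw [← tsum_mul_left]
      refine tsum_congr fun k => ?_
      rw [latGauss_eq]
      ring
    have h1 := h (β.2 + κ * β.1 / 2 + κ * j / 2) (4 * (ε * c)) (by positivity)
    rw [e, abs_mul, abs_exp]
    have h2 : |β.2 + κ * β.1 / 2 + κ * j / 2| ≤ (|β.2| + |(κ : ℝ)|) * (1 + |β.1 + j|) := by
      have : β.2 + κ * β.1 / 2 + κ * j / 2 = β.2 + κ * (β.1 + j) / 2 := by ring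
      rw [this]
      refine (abs_add_le _ _).trans ?_
      rw [abs_div, abs_mul, abs_two]
      nlinarith [abs_nonneg β.2, abs_nonneg (κ : ℝ), abs_nonneg (β.1 + j),
        mul_nonneg (abs_nonneg β.2) (abs_nonneg (β.1 + j)),
        mul_nonneg (abs_nonneg (κ : ℝ)) (abs_nonneg (β.1 + j))]
    have h3 : 4 * (ε * c) + √(4 * (ε * c)) ≤ (4 * c + √(4 * c)) * √ε := by
      have h4 : √(4 * (ε * c)) = √(4 * c) * √ε := by
        rw [← sqrt_mul (by positivity)]; ring_nf
      have h5 : ε ≤ √ε := le_sqrt_of_sq_le (by nlinarith)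
      rw [h4]
      nlinarith
    calc _ ≤ exp (-(ε * d * (β.1 + j) ^ 2)) * (C * ((|β.2| + |(κ : ℝ)|) * (1 + |β.1 + j|)) *
          ((4 * c + √(4 * c)) * √ε)) := by
          gcongr
          exact h1.trans (by gcongr)
      _ = _ := by rw [hB]; ring
  refine ⟨B * (1 + (√d)⁻¹) + 1, by positivity, fun ε hε hε1 j => ⟨?_, ?_⟩⟩
  · refine (main ε hε hε1 j).trans ?_
    have h1 := abs_mul_exp_neg_le (β.1 + j) (mul_pos hε hd)
    have h2 : exp (-(ε * d / 2 * (β.1 + j) ^ 2)) ≤ 1 :=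
      exp_le_one_iff.2 (neg_nonpos.2 (by positivity))
    have h3 : exp (-(ε * d * (β.1 + j) ^ 2)) ≤ 1 :=
      exp_le_one_iff.2 (neg_nonpos.2 (by positivity))
    have hsε : 0 < √ε := sqrt_pos.2 hε
    have h4 : √ε ≤ 1 := sqrt_le_one.2 hε1
    have h5 : √ε * (√(ε * d))⁻¹ = (√d)⁻¹ := by
      rw [sqrt_mul hε.le, mul_inv, ← mul_assoc, mul_inv_cancel₀ hsε.ne', one_mul]
    have h6 : (1 + |β.1 + j|) * √ε * exp (-(ε * d * (β.1 + j) ^ 2)) ≤ 1 + (√d)⁻¹ := by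
      calc _ = √ε * exp (-(ε * d * (β.1 + j) ^ 2)) +
            √ε * (|β.1 + j| * exp (-(ε * d * (β.1 + j) ^ 2))) := by ring
        _ ≤ 1 * 1 + √ε * ((√(ε * d))⁻¹ * 1) :=
          add_le_add (mul_le_mul h4 h3 (exp_pos _).le one_pos.le)
            (mul_le_mul_of_nonneg_left (h1.trans (by gcongr)) hsε.le)
        _ = _ := by rw [mul_one, mul_one, h5]
    have := mul_le_mul_of_nonneg_left h6 hB0
    linarith
  · refine (main ε hε hε1 j).trans ?_
    have h3 : exp (-(ε * d * (β.1 + j) ^ 2)) ≤ 1 :=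
      exp_le_one_iff.2 (neg_nonpos.2 (by positivity))
    have h4 : 0 ≤ (1 + |β.1 + j|) * √ε := by positivity
    have h5 : B ≤ B * (1 + (√d)⁻¹) + 1 := by
      have : 0 ≤ B * (√d)⁻¹ := by positivity
      linarith
    calc _ ≤ B * ((1 + |β.1 + j|) * √ε * 1) := by gcongr
      _ ≤ (B * (1 + (√d)⁻¹) + 1) * ((1 + |β.1 + j|) * √ε * 1) := by gcongr
      _ = _ := by ring

theorem latGauss_le_one (κ : ℤ) (β : ℝ × ℝ) {c d : ℝ} (hc : 0 ≤ c) (hd : 0 ≤ d) (k : ℤ × ℤ) :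
    latGauss κ β c d k ≤ 1 := exp_le_one_iff.2 (neg_nonpos.2 (by positivity))

theorem tendsto_latGauss (κ : ℤ) (β : ℝ × ℝ) (c d : ℝ) (k : ℤ × ℤ) :
    Tendsto (fun ε : ℝ => latGauss κ β (ε * c) (ε * d) k) (𝓝[>] 0) (𝓝 1) := by
  have : Continuous fun ε : ℝ => latGauss κ β (ε * c) (ε * d) k := by unfold latGauss; fun_prop
  have h := this.tendsto 0
  have h0 : latGauss κ β (0 * c) (0 * d) k = 1 := by simp [latGauss]
  rw [h0] at h
  exact h.mono_left nhdsWithin_le_nhds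

/-- A sequence `P` is dominated by `1 / (k² + 1)`. -/
def QuadDecay (M : ℝ) (P : ℤ → ℝ) : Prop := ∀ k : ℤ, |P k| ≤ M * (1 / ((k : ℝ) ^ 2 + 1))

theorem QuadDecay.summable {M : ℝ} {P : ℤ → ℝ} (h : QuadDecay M P) : Summable P :=
  (summable_one_div_sq_add_one.mul_left M).of_norm_bounded h

theorem QuadDecay.nonneg {M : ℝ} {P : ℤ → ℝ} (h : QuadDecay M P) : 0 ≤ M := by
  have := (abs_nonneg _).trans (h 0)
  simpa using this

theorem QuadDecay.abs_le {M : ℝ} {P : ℤ → ℝ} (h : QuadDecay M P) (k : ℤ) : |P k| ≤ M := by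
  refine (h k).trans (mul_le_of_le_one_right h.nonneg ?_)
  rw [div_le_one (by positivity)]
  nlinarith [sq_nonneg (k : ℝ)]

/-- The tail `R - oddSeq` has quadratic decay; then `R` is bounded. -/
theorem QuadDecay.abs_le_of_sub {M : ℝ} {R : ℤ → ℝ} (h : QuadDecay M fun k => R k - oddSeq k)
    (k : ℤ) : |R k| ≤ M + 1 := by
  have h1 := h.abs_le k
  have h2 := abs_oddSeq_le k
  have h3 := abs_add_le (R k - oddSeq k) (oddSeq k)
  rw [sub_add_cancel] at h3
  linarith

section

variable (κ : ℤ) (β : ℝ × ℝ) {c d : ℝ}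

theorem summable_mul_latGauss (hc : 0 < c) (hd : 0 < d) {f : ℤ × ℤ → ℝ} {M : ℝ}
    (hf : ∀ k, |f k| ≤ M) : Summable fun k => f k * latGauss κ β c d k :=
  ((summable_latGauss κ β hc hd).mul_left M).of_norm_bounded fun k => by
    rw [norm_mul, Real.norm_eq_abs, Real.norm_eq_abs, abs_of_pos (latGauss_pos ..)]
    have := (latGauss_pos κ β c d k).le
    gcongr
    exact hf k

variable {M M' : ℝ} {P R : ℤ → ℝ}

theorem tsum_mul_latGauss_eq (hc : 0 < c) (hd : 0 < d) (hP : QuadDecay M P)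
    (hR : QuadDecay M' fun k => R k - oddSeq k) :
    ∑' k : ℤ × ℤ, P k.1 * R k.2 * latGauss κ β c d k =
      ∑' k : ℤ × ℤ, P k.1 * (R k.2 - oddSeq k.2) * latGauss κ β c d k +
        ∑' j : ℤ, P j * ∑' k : ℤ, oddSeq k * latGauss κ β c d (j, k) := by
  have h1 : Summable fun k : ℤ × ℤ => P k.1 * (R k.2 - oddSeq k.2) * latGauss κ β c d k :=
    summable_mul_latGauss κ β hc hd (M := M * M') fun k => by
      rw [abs_mul]
      exact mul_le_mul (hP.abs_le _) (hR.abs_le k.2) (abs_nonneg _) hP.nonneg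
  have h2 : Summable fun k : ℤ × ℤ => P k.1 * oddSeq k.2 * latGauss κ β c d k :=
    summable_mul_latGauss κ β hc hd (M := M * 1) fun k => by
      rw [abs_mul]
      exact mul_le_mul (hP.abs_le _) (abs_oddSeq_le k.2) (abs_nonneg _) hP.nonneg
  have h3 : ∑' j : ℤ, P j * ∑' k : ℤ, oddSeq k * latGauss κ β c d (j, k) =
      ∑' k : ℤ × ℤ, P k.1 * oddSeq k.2 * latGauss κ β c d k := by
    rw [h2.tsum_prod]
    refine tsum_congr fun j => ?_
    rw [← tsum_mul_left]
    exact tsum_congr fun k => (mul_assoc _ _ _).symm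
  rw [h3, ← h1.tsum_add h2]
  exact tsum_congr fun k => by ring

theorem abs_mul_sub_mul_latGauss_le (hc : 0 < c) (hd : 0 < d) (hP : QuadDecay M P)
    (hR : QuadDecay M' fun k => R k - oddSeq k) (k : ℤ × ℤ) :
    |P k.1 * (R k.2 - oddSeq k.2) * latGauss κ β c d k| ≤
      M * M' * (1 / ((k.1 : ℝ) ^ 2 + 1) * (1 / ((k.2 : ℝ) ^ 2 + 1))) := by
  have h0 := hP.nonneg
  have h1 := latGauss_pos κ β c d k
  rw [abs_mul, abs_mul, abs_of_pos h1]
  calc _ ≤ (M * (1 / ((k.1 : ℝ) ^ 2 + 1))) * (M' * (1 / ((k.2 : ℝ) ^ 2 + 1))) * 1 :=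
        mul_le_mul (mul_le_mul (hP _) (hR _) (abs_nonneg _) (by positivity))
          (latGauss_le_one κ β hc.le hd.le k) h1.le
          (mul_nonneg (by positivity) ((abs_nonneg _).trans (hR _)))
    _ = _ := by ring

theorem summable_one_div_sq_add_one_prod :
    Summable fun k : ℤ × ℤ => 1 / ((k.1 : ℝ) ^ 2 + 1) * (1 / ((k.2 : ℝ) ^ 2 + 1)) :=
  summable_one_div_sq_add_one.mul_of_nonneg summable_one_div_sq_add_one
    (fun k => by positivity) (fun k => by positivity)

/-- Gaussian means of `P k₁ R k₂` are bounded. -/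
theorem exists_abs_tsum_mul_latGauss_le (hc : 0 < c) (hd : 0 < d) : ∃ C : ℝ, 0 < C ∧
    ∀ (M M' : ℝ) (P R : ℤ → ℝ), QuadDecay M P → QuadDecay M' (fun k => R k - oddSeq k) →
      ∀ ε : ℝ, 0 < ε → ε ≤ 1 →
      |∑' k : ℤ × ℤ, P k.1 * R k.2 * latGauss κ β (ε * c) (ε * d) k| ≤ C * (M * (M' + 1)) := by
  obtain ⟨C, hC, h⟩ := exists_abs_tsum_oddSeq_mul_latGauss_le κ β hc hd
  set S₁ := ∑' k : ℤ, 1 / ((k : ℝ) ^ 2 + 1)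
  set S₂ := ∑' k : ℤ × ℤ, 1 / ((k.1 : ℝ) ^ 2 + 1) * (1 / ((k.2 : ℝ) ^ 2 + 1))
  have hS₁ : 0 ≤ S₁ := tsum_nonneg fun k => by positivity
  have hS₂ : 0 ≤ S₂ := tsum_nonneg fun k => by positivity
  refine ⟨S₂ + S₁ * C + 1, by positivity, fun M M' P R hP hR ε hε hε1 => ?_⟩
  have hM := hP.nonneg
  have hM' := hR.nonneg
  rw [tsum_mul_latGauss_eq κ β (mul_pos hε hc) (mul_pos hε hd) hP hR]
  refine (abs_add_le _ _).trans ?_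
  have h1 : |∑' k : ℤ × ℤ, P k.1 * (R k.2 - oddSeq k.2) * latGauss κ β (ε * c) (ε * d) k| ≤
      M * M' * S₂ := by
    rw [← Real.norm_eq_abs, ← tsum_mul_left]
    exact tsum_of_norm_bounded (summable_one_div_sq_add_one_prod.mul_left _).hasSum fun k =>
      abs_mul_sub_mul_latGauss_le κ β (mul_pos hε hc) (mul_pos hε hd) hP hR k
  have h2 : |∑' j : ℤ, P j * ∑' k : ℤ, oddSeq k * latGauss κ β (ε * c) (ε * d) (j, k)| ≤
      M * C * S₁ := by
    rw [← Real.norm_eq_abs, ← tsum_mul_left]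
    refine tsum_of_norm_bounded (summable_one_div_sq_add_one.mul_left _).hasSum fun j => ?_
    rw [norm_mul, mul_right_comm]
    exact mul_le_mul (hP j) (h ε hε hε1 j).1 (norm_nonneg _) (by positivity)
  have h3 : 0 ≤ M * (S₂ + 1) := by positivity
  have h4 : 0 ≤ M * M' * (S₁ * C + 1) := by positivity
  nlinarith

/-- Gaussian means of `P k₁ R k₂` converge to the sum with the odd part of `R` removed. -/
theorem tendsto_tsum_mul_latGauss (hc : 0 < c) (hd : 0 < d) (hP : QuadDecay M P)
    (hR : QuadDecay M' fun k => R k - oddSeq k) :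
    Tendsto (fun ε : ℝ => ∑' k : ℤ × ℤ, P k.1 * R k.2 * latGauss κ β (ε * c) (ε * d) k) (𝓝[>] 0)
      (𝓝 ((∑' j, P j) * ∑' k, (R k - oddSeq k))) := by
  obtain ⟨C, hC, h⟩ := exists_abs_tsum_oddSeq_mul_latGauss_le κ β hc hd
  have hM := hP.nonneg
  have hev : ∀ᶠ ε : ℝ in 𝓝[>] 0, 0 < ε ∧ ε ≤ 1 := by
    filter_upwards [Ioc_mem_nhdsGT (zero_lt_one' ℝ)] with ε hε using hε
  have h1 : Tendsto (fun ε : ℝ => ∑' k : ℤ × ℤ,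
      P k.1 * (R k.2 - oddSeq k.2) * latGauss κ β (ε * c) (ε * d) k) (𝓝[>] 0)
      (𝓝 (∑' k : ℤ × ℤ, P k.1 * (R k.2 - oddSeq k.2))) := by
    refine tendsto_tsum_of_dominated_convergence
      (summable_one_div_sq_add_one_prod.mul_left (M * M')) (fun k => ?_) ?_
    · have := (tendsto_latGauss κ β c d k).const_mul (P k.1 * (R k.2 - oddSeq k.2))
      rwa [mul_one] at this
    · filter_upwards [hev] with ε hε k
      exact abs_mul_sub_mul_latGauss_le κ β (mul_pos hε.1 hc) (mul_pos hε.1 hd) hP hR k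
  have h2 : Tendsto (fun ε : ℝ => ∑' j : ℤ, P j *
      ∑' k : ℤ, oddSeq k * latGauss κ β (ε * c) (ε * d) (j, k)) (𝓝[>] 0)
      (𝓝 (∑' _ : ℤ, (0 : ℝ))) := by
    refine tendsto_tsum_of_dominated_convergence
      (summable_one_div_sq_add_one.mul_left (M * C)) (fun j => ?_) ?_
    · have h3 : Tendsto (fun ε : ℝ => |P j| * (C * (1 + |β.1 + j|) * √ε)) (𝓝[>] 0) (𝓝 0) := by
        have : Continuous fun ε : ℝ => |P j| * (C * (1 + |β.1 + j|) * √ε) := by fun_prop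
        have := this.tendsto 0
        simp only [sqrt_zero, mul_zero] at this
        exact this.mono_left nhdsWithin_le_nhds
      refine squeeze_zero_norm' ?_ h3
      filter_upwards [hev] with ε hε
      rw [norm_mul, Real.norm_eq_abs, Real.norm_eq_abs]
      gcongr
      exact (h ε hε.1 hε.2 j).2
    · filter_upwards [hev] with ε hε j
      rw [norm_mul, mul_right_comm]
      exact mul_le_mul (hP j) (h ε hε.1 hε.2 j).1 (norm_nonneg _) (by positivity)
  have h3 := h1.add h2
  rw [tsum_zero, add_zero, ← (hP.summable).tsum_mul_tsum hR.summable
    (summable_one_div_sq_add_one_prod.mul_left (M * M') |>.of_norm_bounded fun k => ?_)] at h3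
  · refine h3.congr' ?_
    filter_upwards [hev] with ε hε
    exact (tsum_mul_latGauss_eq κ β (mul_pos hε.1 hc) (mul_pos hε.1 hd) hP hR).symm
  · rw [norm_mul]
    calc _ ≤ (M * (1 / ((k.1 : ℝ) ^ 2 + 1))) * (M' * (1 / ((k.2 : ℝ) ^ 2 + 1))) :=
          mul_le_mul (hP _) (hR _) (abs_nonneg _) (by positivity)
      _ = _ := by ring

end

/-! ### Partial fractions -/

/-- The kernel `x / (x² + w²)`. -/
def hKer (w x : ℝ) : ℝ := x / (x ^ 2 + w ^ 2)

/-- The kernel `w / (x² + w²)`. -/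
def pKer (w x : ℝ) : ℝ := w / (x ^ 2 + w ^ 2)

/-- The kernel `w / (x² + w²)` with the term `x = 0` left out. -/
def pKer₀ (w x : ℝ) : ℝ := if x = 0 then 0 else pKer w x

/-- The kernel `x (x² - w v) / ((x² + w²) (x² + v²))`. -/
def dKer (w v x : ℝ) : ℝ := x * (x ^ 2 - w * v) / ((x ^ 2 + w ^ 2) * (x ^ 2 + v ^ 2))

/-- The indicator of `{0}`. -/
def zeroInd (x : ℝ) : ℝ := if x = 0 then 1 else 0

theorem exists_lattice_comparison (a : ℝ) : ∃ C : ℝ, 0 < C ∧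
    (∀ k : ℤ, a + k = 0 → 1 ≤ C * (1 / ((k : ℝ) ^ 2 + 1))) ∧
    (∀ k : ℤ, a + k ≠ 0 → 1 / (a + k) ^ 2 ≤ C * (1 / ((k : ℝ) ^ 2 + 1))) ∧
    (∀ k : ℤ, a + k ≠ 0 → 1 / |a + k| ^ 3 ≤ C * (1 / ((k : ℝ) ^ 2 + 1))) ∧
    (∀ k : ℤ, a + k ≠ 0 → |1 / (a + k) - oddSeq k| ≤ C * (1 / ((k : ℝ) ^ 2 + 1))) := by
  obtain ⟨δ, hδ, h⟩ := exists_pos_le_abs_add_int a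
  set C₁ := (2 * a ^ 2 + 2) * (1 + 1 / δ ^ 2) with hC₁
  have hC₁0 : 0 ≤ C₁ := by positivity
  have h2 : ∀ k : ℤ, a + k ≠ 0 → 1 / (a + k) ^ 2 ≤ C₁ * (1 / ((k : ℝ) ^ 2 + 1)) := by
    intro k hk
    have h1 := h k hk
    have h3 : δ ^ 2 ≤ (a + k) ^ 2 := by rw [← sq_abs (a + k)]; gcongr
    have h4 : 0 < (a + k) ^ 2 := by positivity
    rw [mul_one_div, div_le_div_iff₀ h4 (by positivity), one_mul]
    have h5 : (k : ℝ) ^ 2 + 1 ≤ (2 * a ^ 2 + 2) * ((a + k) ^ 2 + 1) := by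
      nlinarith [sq_nonneg (k + 2 * a), mul_nonneg (sq_nonneg a) h4.le]
    have h6 : (a + k) ^ 2 + 1 ≤ (1 + 1 / δ ^ 2) * (a + k) ^ 2 := by
      have : 1 ≤ 1 / δ ^ 2 * (a + k) ^ 2 := by
        rw [one_div_mul_eq_div, one_le_div (by positivity)]; exact h3
      linarith
    calc _ ≤ _ := h5
      _ ≤ (2 * a ^ 2 + 2) * ((1 + 1 / δ ^ 2) * (a + k) ^ 2) := by gcongr
      _ = _ := by rw [hC₁]; ring
  refine ⟨C₁ + C₁ * (1 / δ) + ((1 + a ^ 2) / δ + |a|) + (a ^ 2 + 1), by positivity,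
    fun k hk => ?_, fun k hk => ?_, fun k hk => ?_, fun k hk => ?_⟩
  · have : (k : ℝ) = -a := by linarith
    rw [this, mul_one_div, le_div_iff₀ (by positivity)]
    have : 0 ≤ C₁ + C₁ * (1 / δ) + ((1 + a ^ 2) / δ + |a|) := by positivity
    linarith
  · refine (h2 k hk).trans ?_
    gcongr
    have : 0 ≤ C₁ * (1 / δ) + ((1 + a ^ 2) / δ + |a|) + (a ^ 2 + 1) := by positivity
    linarith
  · have h1 := h k hk
    have h3 : 1 / |a + k| ≤ 1 / δ := by gcongr
    have h4 := h2 k hk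
    calc 1 / |a + k| ^ 3 = 1 / (a + k) ^ 2 * (1 / |a + k|) := by
          rw [← sq_abs (a + k)]; field_simp
      _ ≤ C₁ * (1 / ((k : ℝ) ^ 2 + 1)) * (1 / δ) := by gcongr
      _ = C₁ * (1 / δ) * (1 / ((k : ℝ) ^ 2 + 1)) := by ring
      _ ≤ _ := by
        gcongr
        have : 0 ≤ ((1 + a ^ 2) / δ + |a|) + (a ^ 2 + 1) := by positivity
        linarith
  · have h1 := h k hk
    have hx : 0 < |a + k| := abs_pos.2 hk
    have e : 1 / (a + k) - oddSeq k = (1 + a ^ 2 - a * (a + k)) / (a + k) *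
        (1 / ((k : ℝ) ^ 2 + 1)) := by
      rw [oddSeq]
      have : (k : ℝ) ^ 2 + 1 ≠ 0 := by positivity
      field_simp
      ring
    rw [e, abs_mul, abs_of_pos (a := 1 / ((k : ℝ) ^ 2 + 1)) (by positivity)]
    gcongr
    have h3 : |(1 + a ^ 2 - a * (a + k)) / (a + k)| ≤ (1 + a ^ 2) / δ + |a| := by
      rw [sub_div, mul_div_assoc, div_self hk, mul_one]
      refine (abs_sub _ _).trans ?_
      rw [abs_div, abs_of_pos (by positivity : 0 < 1 + a ^ 2)]
      gcongr
    refine h3.trans ?_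
    have : 0 ≤ C₁ + C₁ * (1 / δ) + (a ^ 2 + 1) := by positivity
    linarith

theorem abs_hKer_sub_le {x : ℝ} (hx : x ≠ 0) (w : ℝ) :
    |hKer w x - 1 / x| ≤ w ^ 2 * (1 / |x| ^ 3) := by
  have hx2 : 0 < x ^ 2 := by positivity
  have e : hKer w x - 1 / x = -(w ^ 2 / (x * (x ^ 2 + w ^ 2))) := by
    rw [hKer]
    have : x ^ 2 + w ^ 2 ≠ 0 := by positivity
    field_simp
    ring
  rw [e, abs_neg, abs_div, abs_mul, abs_of_nonneg (sq_nonneg w),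
    abs_of_pos (by positivity : 0 < x ^ 2 + w ^ 2), mul_one_div]
  have : 0 < |x| := abs_pos.2 hx
  gcongr
  rw [pow_succ, sq_abs, mul_comm]
  gcongr
  nlinarith [sq_nonneg w]

theorem abs_dKer_sub_le {x : ℝ} (hx : x ≠ 0) (w v : ℝ) :
    |dKer w v x - 1 / x| ≤ (w ^ 2 + 2 * v ^ 2 + |w * v|) * (1 / |x| ^ 3) := by
  have hx2 : 0 < x ^ 2 := by positivity
  have hxa : 0 < |x| := abs_pos.2 hx
  have hw : 0 < x ^ 2 + w ^ 2 := by positivity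
  have hv : 0 < x ^ 2 + v ^ 2 := by positivity
  have e : dKer w v x - 1 / x = -((x ^ 2 * (w ^ 2 + v ^ 2 + w * v) + w ^ 2 * v ^ 2) /
      (x * ((x ^ 2 + w ^ 2) * (x ^ 2 + v ^ 2)))) := by
    rw [dKer]
    field_simp
    ring
  rw [e, abs_neg, abs_div, abs_mul, abs_of_pos (mul_pos hw hv), mul_one_div,
    div_le_div_iff₀ (by positivity) (by positivity)]
  have h1 : |x ^ 2 * (w ^ 2 + v ^ 2 + w * v) + w ^ 2 * v ^ 2| ≤
      x ^ 2 * (w ^ 2 + v ^ 2 + |w * v|) + w ^ 2 * v ^ 2 := by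
    refine (abs_add_le _ _).trans ?_
    rw [abs_mul, abs_of_pos hx2, abs_of_nonneg (by positivity : 0 ≤ w ^ 2 * v ^ 2)]
    gcongr
    refine (abs_add_le _ _).trans ?_
    rw [abs_of_nonneg (by positivity : 0 ≤ w ^ 2 + v ^ 2)]
  have h2 : (x ^ 2 * (w ^ 2 + v ^ 2 + |w * v|) + w ^ 2 * v ^ 2) * x ^ 2 ≤
      (w ^ 2 + 2 * v ^ 2 + |w * v|) * ((x ^ 2 + w ^ 2) * (x ^ 2 + v ^ 2)) := by
    have h3 : x ^ 2 * x ^ 2 ≤ (x ^ 2 + w ^ 2) * (x ^ 2 + v ^ 2) := by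
      gcongr <;> nlinarith [sq_nonneg w, sq_nonneg v]
    have h4 : w ^ 2 * x ^ 2 ≤ (x ^ 2 + w ^ 2) * (x ^ 2 + v ^ 2) := by
      gcongr <;> nlinarith [sq_nonneg w, sq_nonneg v]
    have h5 : 0 ≤ w ^ 2 + v ^ 2 + |w * v| := by positivity
    calc _ = (w ^ 2 + v ^ 2 + |w * v|) * (x ^ 2 * x ^ 2) + v ^ 2 * (w ^ 2 * x ^ 2) := by ring
      _ ≤ (w ^ 2 + v ^ 2 + |w * v|) * ((x ^ 2 + w ^ 2) * (x ^ 2 + v ^ 2)) +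
          v ^ 2 * ((x ^ 2 + w ^ 2) * (x ^ 2 + v ^ 2)) := by gcongr
      _ = _ := by ring
  have h6 : |x| ^ 3 = x ^ 2 * |x| := by rw [pow_succ, sq_abs]
  calc _ ≤ (x ^ 2 * (w ^ 2 + v ^ 2 + |w * v|) + w ^ 2 * v ^ 2) * |x| ^ 3 := by gcongr
    _ = (x ^ 2 * (w ^ 2 + v ^ 2 + |w * v|) + w ^ 2 * v ^ 2) * x ^ 2 * |x| := by rw [h6]; ring
    _ ≤ (w ^ 2 + 2 * v ^ 2 + |w * v|) * ((x ^ 2 + w ^ 2) * (x ^ 2 + v ^ 2)) * |x| := by gcongr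
    _ = _ := by ring

theorem exists_quadDecay (a : ℝ) : ∃ C : ℝ, 0 < C ∧
    (∀ w, QuadDecay (C * (1 + w ^ 2)) fun k => hKer w (a + k) - oddSeq k) ∧
    (∀ w, QuadDecay (C * (1 + w ^ 2)) fun k => w * pKer w (a + k)) ∧
    (∀ w, QuadDecay (C * (1 + w ^ 2)) fun k => pKer₀ w (a + k)) ∧
    (∀ w v, QuadDecay (C * ((1 + w ^ 2) * (1 + v ^ 2))) fun k => dKer w v (a + k) - oddSeq k) ∧
    QuadDecay C fun k => zeroInd (a + k) := by
  obtain ⟨C, hC, h0, h2, h3, h4⟩ := exists_lattice_comparison a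
  have key : ∀ (f : ℝ → ℝ) (K M : ℝ), 0 ≤ K → 1 + K ≤ M → f 0 = 0 →
      (∀ x : ℝ, x ≠ 0 → |f x - 1 / x| ≤ K * (1 / |x| ^ 3)) →
      QuadDecay (C * M) fun k => f (a + k) - oddSeq k := by
    intro f K M hK hM hf hfx k
    have hq : 0 < 1 / ((k : ℝ) ^ 2 + 1) := by positivity
    by_cases hk : a + k = 0
    · simp only [hk, hf, zero_sub, abs_neg]
      refine (abs_oddSeq_le k).trans ((h0 k hk).trans ?_)
      gcongr
      exact le_mul_of_one_le_right hC.le (by linarith)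
    · have e : f (a + k) - oddSeq k = (f (a + k) - 1 / (a + k)) + (1 / (a + k) - oddSeq k) := by
        ring
      simp only [e]
      refine (abs_add_le _ _).trans ?_
      calc _ ≤ K * (1 / |a + k| ^ 3) + C * (1 / ((k : ℝ) ^ 2 + 1)) := add_le_add (hfx _ hk) (h4 k hk)
        _ ≤ K * (C * (1 / ((k : ℝ) ^ 2 + 1))) + C * (1 / ((k : ℝ) ^ 2 + 1)) := by
          gcongr; exact h3 k hk
        _ = C * (1 + K) * (1 / ((k : ℝ) ^ 2 + 1)) := by ring
        _ ≤ _ := by gcongr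
  have hC2 : ∀ {M : ℝ}, 0 ≤ M → QuadDecay (C * M) 0 := fun hM k => by
    simp only [Pi.zero_apply, abs_zero]; positivity
  refine ⟨8 * C, by positivity, fun w => ?_, fun w k => ?_, fun w k => ?_, fun w v => ?_,
    fun k => ?_⟩
  · rw [mul_comm 8 C, mul_assoc]
    exact key (hKer w) (w ^ 2) _ (sq_nonneg w) (by nlinarith [sq_nonneg w]) (by simp [hKer])
      fun x hx => abs_hKer_sub_le hx w
  · have hq : 0 < 1 / ((k : ℝ) ^ 2 + 1) := by positivity
    have e : w * pKer w (a + k) = w ^ 2 / ((a + k) ^ 2 + w ^ 2) := by rw [pKer]; ring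
    simp only [e]
    rw [abs_of_nonneg (by positivity)]
    by_cases hk : a + k = 0
    · have h5 : w ^ 2 / ((a + k) ^ 2 + w ^ 2) ≤ 1 := by
        rw [hk]
        exact div_le_one_of_le₀ (by nlinarith) (by positivity)
      refine h5.trans ((h0 k hk).trans ?_)
      gcongr
      nlinarith [mul_nonneg hC.le (sq_nonneg w)]
    · have h5 : w ^ 2 / ((a + k) ^ 2 + w ^ 2) ≤ w ^ 2 * (1 / (a + k) ^ 2) := by
        rw [mul_one_div]
        gcongr
        nlinarith [sq_nonneg w]
      calc _ ≤ _ := h5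
        _ ≤ w ^ 2 * (C * (1 / ((k : ℝ) ^ 2 + 1))) := by gcongr; exact h2 k hk
        _ = C * w ^ 2 * (1 / ((k : ℝ) ^ 2 + 1)) := by ring
        _ ≤ _ := by
          gcongr <;> linarith
  · have hq : 0 < 1 / ((k : ℝ) ^ 2 + 1) := by positivity
    by_cases hk : a + k = 0
    · simp only [pKer₀, hk, if_true, abs_zero]
      positivity
    · simp only [pKer₀, hk, if_false, pKer]
      rw [abs_div, abs_of_nonneg (by positivity : 0 ≤ (a + k) ^ 2 + w ^ 2)]
      have hw : |w| ≤ 1 + w ^ 2 := by nlinarith [sq_abs w, sq_nonneg (|w| - 1)]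
      have h5 : |w| / ((a + k) ^ 2 + w ^ 2) ≤ (1 + w ^ 2) * (1 / (a + k) ^ 2) := by
        rw [mul_one_div]
        gcongr
        nlinarith [sq_nonneg w]
      calc _ ≤ _ := h5
        _ ≤ (1 + w ^ 2) * (C * (1 / ((k : ℝ) ^ 2 + 1))) := by gcongr; exact h2 k hk
        _ = C * (1 + w ^ 2) * (1 / ((k : ℝ) ^ 2 + 1)) := by ring
        _ ≤ _ := by
          gcongr
          nlinarith
  · rw [mul_comm 8 C, mul_assoc]
    have hwv : |w * v| ≤ w ^ 2 + v ^ 2 := by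
      rw [abs_mul]
      nlinarith [sq_nonneg (|w| - |v|), sq_abs w, sq_abs v, abs_nonneg w, abs_nonneg v]
    exact key (dKer w v) (w ^ 2 + 2 * v ^ 2 + |w * v|) _ (by positivity)
      (by nlinarith [sq_nonneg w, sq_nonneg v, mul_nonneg (sq_nonneg w) (sq_nonneg v)])
      (by simp [dKer]) fun x hx => abs_dKer_sub_le hx w v
  · have hq : 0 < 1 / ((k : ℝ) ^ 2 + 1) := by positivity
    by_cases hk : a + k = 0
    · simp only [zeroInd, hk, if_true, abs_one]
      refine (h0 k hk).trans ?_
      gcongr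
      linarith
    · simp only [zeroInd, hk, if_false, abs_zero]
      positivity

/-! ### The cotangent series -/

theorem cosh_sub_cos_pos (a : ℝ) {w : ℝ} (hw : w ≠ 0) :
    0 < cosh (2 * π * w) - cos (2 * π * a) := by
  have h1 : 1 < cosh (2 * π * w) := one_lt_cosh.2 (by positivity)
  linarith [cos_le_one (2 * π * a)]

theorem cot_pi_mul_eq (a : ℝ) {w : ℝ} (hw : w ≠ 0) :
    Complex.cot (π * (a + w * Complex.I)) = calG a w - calF a w * Complex.I := by
  have hD := cosh_sub_cos_pos a hw
  have hDc : ((cosh (2 * π * w) - cos (2 * π * a) : ℝ) : ℂ) ≠ 0 :=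
    Complex.ofReal_ne_zero.2 hD.ne'
  have hs : Complex.sin (π * (a + w * Complex.I)) ≠ 0 := by
    rw [Complex.sin_ne_zero_iff]
    intro k hk
    have := congrArg Complex.im hk
    simp [pi_ne_zero, hw] at this
  have e : (π : ℂ) * (a + w * Complex.I) = ((π * a : ℝ) : ℂ) + ((π * w : ℝ) : ℂ) * Complex.I := by
    push_cast; ring
  have h1 := Complex.sin_sq_add_cos_sq (π * a : ℂ)
  have h2 := Complex.cosh_sq_sub_sinh_sq (π * w : ℂ)
  have hI := Complex.I_sq
  have key : ((cosh (2 * π * w) - cos (2 * π * a) : ℝ) : ℂ) *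
      Complex.cos (π * (a + w * Complex.I)) = ((sin (2 * π * a) : ℝ) -
        (sinh (2 * π * w) : ℝ) * Complex.I) * Complex.sin (π * (a + w * Complex.I)) := by
    rw [e, Complex.cos_add_mul_I, Complex.sin_add_mul_I]
    push_cast
    rw [show (2 : ℂ) * π * w = 2 * (π * w) by ring, show (2 : ℂ) * π * a = 2 * (π * a) by ring,
      Complex.cosh_two_mul, Complex.cos_two_mul, Complex.sin_two_mul, Complex.sinh_two_mul]
    set c := Complex.cos (π * a)
    set s := Complex.sin (π * a)
    set C := Complex.cosh (π * w)
    set S := Complex.sinh (π * w)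
    linear_combination c * C * (h2 - 2 * h1) + s * S * Complex.I * h2 + 2 * S ^ 2 * C * c * hI
  rw [Complex.cot_eq_cos_div_sin, div_eq_iff hs, calF, calG, Complex.ofReal_div, Complex.ofReal_div,
    div_mul_eq_mul_div, ← sub_div, div_mul_eq_mul_div, eq_div_iff hDc, ← key]
  ring

theorem one_div_add_mul_I (x w : ℝ) :
    1 / ((x : ℂ) + w * Complex.I) = hKer w x - pKer w x * Complex.I := by
  rcases eq_or_ne w 0 with rfl | hw
  · rcases eq_or_ne x 0 with rfl | hx
    · simp [hKer, pKer]
    · have : (x : ℂ) ≠ 0 := Complex.ofReal_ne_zero.2 hx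
      simp only [hKer, pKer]
      push_cast
      simp only [zero_mul, add_zero, ne_eq, OfNat.ofNat_ne_zero, not_false_eq_true, zero_pow,
        zero_div, sub_zero]
      field_simp
  · have h1 : ((x ^ 2 + w ^ 2 : ℝ) : ℂ) ≠ 0 := Complex.ofReal_ne_zero.2 (by positivity)
    have h2 : (x : ℂ) + w * Complex.I ≠ 0 := fun h => hw (by simpa using congrArg Complex.im h)
    rw [hKer, pKer, Complex.ofReal_div, Complex.ofReal_div, div_mul_eq_mul_div, ← sub_div,
      div_eq_div_iff h2 h1]
    push_cast
    linear_combination (w : ℂ) ^ 2 * Complex.I_sq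

theorem summable_pKer (a : ℝ) {w : ℝ} (hw : w ≠ 0) : Summable fun k : ℤ => pKer w (a + k) := by
  obtain ⟨C, -, -, h, -⟩ := exists_quadDecay a
  exact (summable_mul_left_iff hw).1 (h w).summable

theorem summable_hKer_sub (a w : ℝ) : Summable fun k : ℤ => hKer w (a + k) - oddSeq k := by
  obtain ⟨C, -, h, -⟩ := exists_quadDecay a
  exact (h w).summable

theorem tsum_kernels (a : ℝ) {w : ℝ} (hw : w ≠ 0) :
    ∑' k : ℤ, (hKer w (a + k) - oddSeq k) = π * calG a w ∧
      ∑' k : ℤ, pKer w (a + k) = π * calF a w := by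
  set z : ℂ := a + w * Complex.I with hz
  have hzc : z ∈ Complex.integerComplement := by
    rw [Complex.mem_integerComplement_iff]
    rintro ⟨n, hn⟩
    have := congrArg Complex.im hn
    simp [hz] at this
    exact hw this.symm
  set f : ℤ → ℂ := fun k => ((hKer w (a + k) - oddSeq k : ℝ) : ℂ) -
    ((pKer w (a + k) : ℝ) : ℂ) * Complex.I with hf
  have hs1 := summable_hKer_sub a w
  have hs2 := summable_pKer a hw
  have hfs : Summable f := (Complex.summable_ofReal.2 hs1).sub
    ((Complex.summable_ofReal.2 hs2).mul_right _)
  have hfe : ∀ k : ℤ, f k = 1 / (z + k) - oddSeq k := fun k => by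
    have := one_div_add_mul_I (a + k) w
    rw [show z + (k : ℂ) = ((a + k : ℝ) : ℂ) + w * Complex.I by rw [hz]; push_cast; ring, this, hf]
    push_cast
    ring
  have hfN : Summable fun n : ℕ => f n := (summable_int_iff_summable_nat_and_neg.1 hfs).1
  have hfN' : Summable fun n : ℕ => f (-n) := (summable_int_iff_summable_nat_and_neg.1 hfs).2
  have hp1 : Summable fun n : ℕ+ => f n := hfN.comp_injective PNat.coe_injective
  have hp2 : Summable fun n : ℕ+ => f (-n) := hfN'.comp_injective PNat.coe_injective
  have h1 : ∑' k, f k = π * Complex.cot (π * z) := by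
    rw [cot_series_rep hzc, tsum_int_eq_zero_add_tsum_pnat hfs, add_assoc, ← hp1.tsum_add hp2]
    congr 1
    · rw [hfe]; simp [oddSeq]
    · refine tsum_congr fun n => ?_
      rw [hfe, hfe, oddSeq_neg]
      push_cast
      ring
  have h2 : ∑' k, f k = ((∑' k : ℤ, (hKer w (a + k) - oddSeq k) : ℝ) : ℂ) -
      ((∑' k : ℤ, pKer w (a + k) : ℝ) : ℂ) * Complex.I := by
    rw [Complex.ofReal_tsum, Complex.ofReal_tsum, ← tsum_mul_right]
    exact (Complex.summable_ofReal.2 hs1).tsum_sub ((Complex.summable_ofReal.2 hs2).mul_right _)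
  rw [h2, hz, cot_pi_mul_eq a hw] at h1
  have hre := congrArg Complex.re h1
  have him := congrArg Complex.im h1
  simp only [Complex.sub_re, Complex.ofReal_re, Complex.mul_re, Complex.I_re, mul_zero,
    Complex.ofReal_im, Complex.I_im, mul_one, sub_self, sub_zero, Complex.sub_im, Complex.mul_im,
    zero_mul, add_zero, zero_sub, mul_neg, neg_inj] at hre him
  exact ⟨by simpa using hre, by simpa using him⟩

/-! ### The lattice expansion of the double Mordell integrand -/

/-- A point of the shifted lattice `α + ℤ²`. -/
def latPt (α : ℝ × ℝ) (k : ℤ × ℤ) : ℝ × ℝ := (α.1 + k.1, α.2 + k.2)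

/-- The contribution of a lattice point `n` to the double Mordell integrand at `w`. -/
def mordellKernel (n w : ℝ × ℝ) : ℝ :=
  (w.2 * pKer w.2 n.2) * hKer w.1 n.1 + w.2 * (pKer₀ w.1 n.1 * hKer w.2 n.2) +
    -(3 / 2) * (zeroInd n.1 * dKer w.2 (w.2 + 3 / 2 * w.1) n.2)

/-- The Gaussian weight `exp (-2 π ε Q(n))`. -/
def gaussQ (ε : ℝ) (n : ℝ × ℝ) : ℝ := exp (-(2 * π * ε * Q n))

theorem gaussQ_eq_swap (α : ℝ × ℝ) (ε : ℝ) (k : ℤ × ℤ) :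
    gaussQ ε (latPt α k) = latGauss 1 α.swap (ε * (3 * π / 2)) (ε * (π / 2)) k.swap := by
  rw [gaussQ, latGauss, Q, latL, latV, latPt]
  simp
  ring

theorem gaussQ_eq (α : ℝ × ℝ) (ε : ℝ) (k : ℤ × ℤ) :
    gaussQ ε (latPt α k) = latGauss 3 α (ε * (π / 2)) (ε * (3 * π / 2)) k := by
  rw [gaussQ, latGauss, Q, latL, latV, latPt]
  simp
  ring

/-- The weighted sum of the contributions of all lattice points. -/
def gaussMean (α : ℝ × ℝ) (ε : ℝ) (w : ℝ × ℝ) : ℝ :=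
  ∑' k, mordellKernel (latPt α k) w * gaussQ ε (latPt α k)

theorem gaussMean_eq (α : ℝ × ℝ) {ε : ℝ} (hε : 0 < ε) (w : ℝ × ℝ) : gaussMean α ε w =
    ∑' k : ℤ × ℤ, (w.2 * pKer w.2 (α.2 + k.1)) * hKer w.1 (α.1 + k.2) *
        latGauss 1 α.swap (ε * (3 * π / 2)) (ε * (π / 2)) k +
    w.2 * ∑' k : ℤ × ℤ, pKer₀ w.1 (α.1 + k.1) * hKer w.2 (α.2 + k.2) *
        latGauss 3 α (ε * (π / 2)) (ε * (3 * π / 2)) k +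
    -(3 / 2) * ∑' k : ℤ × ℤ, zeroInd (α.1 + k.1) * dKer w.2 (w.2 + 3 / 2 * w.1) (α.2 + k.2) *
        latGauss 3 α (ε * (π / 2)) (ε * (3 * π / 2)) k := by
  obtain ⟨C, hC, h1, h2, h3, h4, h5⟩ := exists_quadDecay α.1
  obtain ⟨C', hC', h1', h2', h3', h4', h5'⟩ := exists_quadDecay α.2
  have hp : 0 < ε * (π / 2) := by positivity
  have hp3 : 0 < ε * (3 * π / 2) := by positivity
  have b : ∀ {M M' : ℝ} {P R : ℤ → ℝ}, QuadDecay M P → QuadDecay M' (fun k => R k - oddSeq k) →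
      ∀ i j, |P i * R j| ≤ M * (M' + 1) := fun hP hR i j => by
    rw [abs_mul]
    exact mul_le_mul (hP.abs_le i) (hR.abs_le_of_sub j) (abs_nonneg _) hP.nonneg
  have s1 : Summable fun k : ℤ × ℤ => (w.2 * pKer w.2 (α.2 + k.2)) * hKer w.1 (α.1 + k.1) *
      gaussQ ε (latPt α k) := by
    simp_rw [gaussQ_eq_swap]
    exact (Equiv.prodComm ℤ ℤ).summable_iff.2
      (summable_mul_latGauss 1 α.swap hp3 hp
        (f := fun k => (w.2 * pKer w.2 (α.2 + k.1)) * hKer w.1 (α.1 + k.2))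
        fun k => b (h2' w.2) (h1 w.1) k.1 k.2)
  have s2 : Summable fun k : ℤ × ℤ => pKer₀ w.1 (α.1 + k.1) * hKer w.2 (α.2 + k.2) *
      gaussQ ε (latPt α k) := by
    simp_rw [gaussQ_eq]
    exact summable_mul_latGauss 3 α hp hp3 fun k => b (h3 w.1) (h1' w.2) k.1 k.2
  have s3 : Summable fun k : ℤ × ℤ => zeroInd (α.1 + k.1) *
      dKer w.2 (w.2 + 3 / 2 * w.1) (α.2 + k.2) * gaussQ ε (latPt α k) := by
    simp_rw [gaussQ_eq]
    exact summable_mul_latGauss 3 α hp hp3 fun k => b h5 (h4' w.2 (w.2 + 3 / 2 * w.1)) k.1 k.2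
  have e1 : ∑' k : ℤ × ℤ, (w.2 * pKer w.2 (α.2 + k.1)) * hKer w.1 (α.1 + k.2) *
        latGauss 1 α.swap (ε * (3 * π / 2)) (ε * (π / 2)) k =
      ∑' k : ℤ × ℤ, (w.2 * pKer w.2 (α.2 + k.2)) * hKer w.1 (α.1 + k.1) *
        gaussQ ε (latPt α k) := by
    simp_rw [gaussQ_eq_swap]
    exact ((Equiv.prodComm ℤ ℤ).tsum_eq fun k : ℤ × ℤ =>
      (w.2 * pKer w.2 (α.2 + k.1)) * hKer w.1 (α.1 + k.2) *
        latGauss 1 α.swap (ε * (3 * π / 2)) (ε * (π / 2)) k).symm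
  rw [e1]
  simp_rw [← gaussQ_eq]
  rw [← tsum_mul_left, ← tsum_mul_left, ← s1.tsum_add (s2.mul_left _),
    ← (s1.add (s2.mul_left _)).tsum_add (s3.mul_left _), gaussMean]
  refine tsum_congr fun k => ?_
  simp only [mordellKernel, latPt]
  ring

theorem exists_abs_gaussMean_le (α : ℝ × ℝ) : ∃ C : ℝ, 0 < C ∧
    (∀ k w, |mordellKernel (latPt α k) w| ≤ C * (1 + w.1 ^ 2 + w.2 ^ 2) ^ 3) ∧
    ∀ ε, 0 < ε → ε ≤ 1 → ∀ w, |gaussMean α ε w| ≤ C * (1 + w.1 ^ 2 + w.2 ^ 2) ^ 3 := by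
  obtain ⟨A, hA, h1, h2, h3, h4, h5⟩ := exists_quadDecay α.1
  obtain ⟨B, hB, h1', h2', h3', h4', h5'⟩ := exists_quadDecay α.2
  obtain ⟨D, hD, h6⟩ := exists_abs_tsum_mul_latGauss_le 1 α.swap (c := 3 * π / 2) (d := π / 2)
    (by positivity) (by positivity)
  obtain ⟨E, hE, h7⟩ := exists_abs_tsum_mul_latGauss_le 3 α (c := π / 2) (d := 3 * π / 2)
    (by positivity) (by positivity)
  have b : ∀ {M M' : ℝ} {P R : ℤ → ℝ}, QuadDecay M P → QuadDecay M' (fun k => R k - oddSeq k) →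
      ∀ i j, |P i * R j| ≤ M * (M' + 1) := fun hP hR i j => by
    rw [abs_mul]
    exact mul_le_mul (hP.abs_le i) (hR.abs_le_of_sub j) (abs_nonneg _) hP.nonneg
  have tri : ∀ {x y z r X Y Z W : ℝ}, 0 ≤ W → |x| ≤ X → |r| ≤ W → |y| ≤ Y → |z| ≤ Z → 0 ≤ Y →
      |x + r * y + -(3 / 2) * z| ≤ X + W * Y + 3 / 2 * Z := by
    intro x y z r X Y Z W hW hx hr hy hz hY
    refine (abs_add_le _ _).trans (add_le_add ((abs_add_le _ _).trans (add_le_add hx ?_)) ?_)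
    · rw [abs_mul]
      exact mul_le_mul hr hy (abs_nonneg _) hW
    · rw [abs_mul, abs_neg, abs_of_pos (by norm_num : (0 : ℝ) < 3 / 2)]
      gcongr
  set F := B * (A + 1) + A * (B + 1) + 3 / 2 * (A * (5 * B + 1)) with hF
  have poly : ∀ w : ℝ × ℝ, 0 ≤ 1 + w.1 ^ 2 + w.2 ^ 2 ∧ |w.2| ≤ 1 + w.1 ^ 2 + w.2 ^ 2 ∧
      B * (1 + w.2 ^ 2) * (A * (1 + w.1 ^ 2) + 1) +
        (1 + w.1 ^ 2 + w.2 ^ 2) * (A * (1 + w.1 ^ 2) * (B * (1 + w.2 ^ 2) + 1)) +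
        3 / 2 * (A * (B * ((1 + w.2 ^ 2) * (1 + (w.2 + 3 / 2 * w.1) ^ 2)) + 1)) ≤
      F * (1 + w.1 ^ 2 + w.2 ^ 2) ^ 3 := by
    intro w
    set W := 1 + w.1 ^ 2 + w.2 ^ 2 with hW
    have hx : 1 + w.1 ^ 2 ≤ W := by nlinarith [sq_nonneg w.2]
    have hy : 1 + w.2 ^ 2 ≤ W := by nlinarith [sq_nonneg w.1]
    have hv : 1 + (w.2 + 3 / 2 * w.1) ^ 2 ≤ 5 * W := by
      nlinarith [sq_nonneg (w.2 - 3 / 2 * w.1), sq_nonneg w.1, sq_nonneg w.2]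
    have h1W : 1 ≤ W := by nlinarith [sq_nonneg w.1, sq_nonneg w.2]
    have hW0 : 0 ≤ W := by linarith
    refine ⟨hW0, by nlinarith [sq_abs w.2, sq_nonneg (|w.2| - 1), sq_nonneg w.1], ?_⟩
    have hW2 : W ≤ W ^ 2 := by nlinarith
    have hW3 : W ^ 2 ≤ W ^ 3 := by nlinarith [mul_nonneg hW0 hW0]
    have t1 : B * (1 + w.2 ^ 2) * (A * (1 + w.1 ^ 2) + 1) ≤ B * (A + 1) * W ^ 3 := by
      calc _ ≤ B * W * (A * W + 1 * W) := by gcongr; linarith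
        _ = B * (A + 1) * W ^ 2 := by ring
        _ ≤ _ := by gcongr
    have t2 : W * (A * (1 + w.1 ^ 2) * (B * (1 + w.2 ^ 2) + 1)) ≤ A * (B + 1) * W ^ 3 := by
      calc _ ≤ W * (A * W * (B * W + 1 * W)) := by gcongr; linarith
        _ = _ := by ring
    have t3 : A * (B * ((1 + w.2 ^ 2) * (1 + (w.2 + 3 / 2 * w.1) ^ 2)) + 1) ≤
        A * (5 * B + 1) * W ^ 3 := by
      calc _ ≤ A * (B * (W * (5 * W)) + 1 * W ^ 2) := by gcongr; linarith
        _ = A * (5 * B + 1) * W ^ 2 := by ring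
        _ ≤ _ := by gcongr
    rw [hF]
    linarith
  have hF0 : 0 < F := by positivity
  refine ⟨F * (1 + D + E), by positivity, fun k w => ?_, fun ε hε hε1 w => ?_⟩
  · obtain ⟨p0, p1, p2⟩ := poly w
    have := tri p0 (b (h2' w.2) (h1 w.1) k.2 k.1) p1 (b (h3 w.1) (h1' w.2) k.1 k.2)
      (b h5 (h4' w.2 (w.2 + 3 / 2 * w.1)) k.1 k.2) (by positivity)
    refine this.trans (p2.trans ?_)
    gcongr
    nlinarith
  · obtain ⟨p0, p1, p2⟩ := poly w
    rw [gaussMean_eq α hε w]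
    have := tri p0 (h6 _ _ _ _ (h2' w.2) (h1 w.1) ε hε hε1) p1
      (h7 _ _ _ _ (h3 w.1) (h1' w.2) ε hε hε1)
      (h7 _ _ _ _ h5 (h4' w.2 (w.2 + 3 / 2 * w.1)) ε hε hε1) (by positivity)
    refine this.trans ?_
    set X := B * (1 + w.2 ^ 2) * (A * (1 + w.1 ^ 2) + 1)
    set Y := (1 + w.1 ^ 2 + w.2 ^ 2) * (A * (1 + w.1 ^ 2) * (B * (1 + w.2 ^ 2) + 1))
    set Z := A * (B * ((1 + w.2 ^ 2) * (1 + (w.2 + 3 / 2 * w.1) ^ 2)) + 1)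
    have hX : 0 ≤ X := by positivity
    have hY : 0 ≤ Y := by positivity
    have hZ : 0 ≤ Z := by positivity
    have hDE : D * X + E * (Y + 3 / 2 * Z) ≤ (1 + D + E) * (X + Y + 3 / 2 * Z) := by
      linarith [mul_nonneg hD.le hY, mul_nonneg hD.le hZ, mul_nonneg hE.le hX]
    calc _ = D * X + E * (Y + 3 / 2 * Z) := by simp only [X, Y, Z]; ring
      _ ≤ (1 + D + E) * (X + Y + 3 / 2 * Z) := hDE
      _ ≤ (1 + D + E) * (F * (1 + w.1 ^ 2 + w.2 ^ 2) ^ 3) := by gcongr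
      _ = _ := by ring

theorem sum_dKer (a : ℝ) {w : ℝ × ℝ} (h₁ : w.1 ≠ 0) (h₂ : w.2 ≠ 0)
    (hv : w.2 + 3 / 2 * w.1 ≠ 0) :
    -(3 / 2) * ∑' k : ℤ, (dKer w.2 (w.2 + 3 / 2 * w.1) (a + k) - oddSeq k) =
      π / w.1 * (calGStar a w.2 - calGStar a (w.2 + 3 / 2 * w.1)) := by
  have e : ∀ k : ℤ, -(3 / 2) * (dKer w.2 (w.2 + 3 / 2 * w.1) (a + k) - oddSeq k) =
      w.2 / w.1 * (hKer w.2 (a + k) - oddSeq k) -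
        (w.2 + 3 / 2 * w.1) / w.1 * (hKer (w.2 + 3 / 2 * w.1) (a + k) - oddSeq k) := by
    intro k
    set x := a + k
    set v := w.2 + 3 / 2 * w.1 with hvdef
    have hw1 : w.1 = 2 / 3 * (v - w.2) := by rw [hvdef]; ring
    rw [hw1] at h₁ ⊢
    have h3 : v - w.2 ≠ 0 := fun h => h₁ (by rw [h, mul_zero])
    have h4 : x ^ 2 + w.2 ^ 2 ≠ 0 := by positivity
    have h5 : x ^ 2 + v ^ 2 ≠ 0 := by positivity
    simp only [dKer, hKer]
    field_simp
    ring
  rw [← tsum_mul_left]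
  simp_rw [e]
  rw [((summable_hKer_sub a w.2).mul_left _).tsum_sub ((summable_hKer_sub a _).mul_left _),
    tsum_mul_left, tsum_mul_left, (tsum_kernels a h₂).1, (tsum_kernels a hv).1, calGStar, calGStar]
  field_simp

theorem tsum_pKer₀_of_forall_ne {a : ℝ} (ha : ∀ k : ℤ, a + k ≠ 0) {w : ℝ} (hw : w ≠ 0) :
    ∑' k : ℤ, pKer₀ w (a + k) = π * calF a w := by
  rw [← (tsum_kernels a hw).2]
  exact tsum_congr fun k => by simp [pKer₀, ha k]

theorem tsum_pKer₀_int (m : ℤ) {w : ℝ} (hw : w ≠ 0) :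
    ∑' k : ℤ, pKer₀ w (m + k) = π * calF m w - 1 / w := by
  rw [← (tsum_kernels m hw).2]
  have h1 : HasSum (fun k : ℤ => if k = -m then 1 / w else 0) (1 / w) :=
    hasSum_ite_eq (-m) (1 / w)
  rw [← h1.tsum_eq, ← (summable_pKer m hw).tsum_sub h1.summable]
  refine tsum_congr fun k => ?_
  by_cases h : k = -m
  · subst h
    simp only [pKer₀, pKer, Int.cast_neg, add_neg_cancel, if_true]
    field_simp
    simp
  · have : (m : ℝ) + k ≠ 0 := by
      intro h0
      apply h
      have : ((m + k : ℤ) : ℝ) = 0 := by push_cast; exact h0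
      have := Int.cast_eq_zero.1 this
      omega
    simp [pKer₀, h, this]

theorem tsum_zeroInd_int (m : ℤ) : ∑' k : ℤ, zeroInd (m + k) = 1 := by
  rw [← (hasSum_ite_eq (-m) (1 : ℝ)).tsum_eq]
  refine tsum_congr fun k => ?_
  have : (m : ℝ) + k = 0 ↔ k = -m := by
    rw [← Int.cast_add, Int.cast_eq_zero]; omega
  simp [zeroInd, this]

/-- The Gaussian means converge to the double Mordell integrand. -/
theorem tendsto_gaussMean (α : ℝ × ℝ) {w : ℝ × ℝ} (h₁ : w.1 ≠ 0) (h₂ : w.2 ≠ 0)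
    (hv : w.2 + 3 / 2 * w.1 ≠ 0) :
    Tendsto (fun ε => -(2 * Complex.I) / π ^ 2 * ((gaussMean α ε w : ℝ) : ℂ)) (𝓝[>] 0)
      (𝓝 (g2 α w)) := by
  obtain ⟨A, hA, h1, h2, h3, h4, h5⟩ := exists_quadDecay α.1
  obtain ⟨B, hB, h1', h2', h3', h4', h5'⟩ := exists_quadDecay α.2
  have T1 := tendsto_tsum_mul_latGauss 1 α.swap (c := 3 * π / 2) (d := π / 2)
    (by positivity) (by positivity) (h2' w.2) (h1 w.1)
  have T2 := tendsto_tsum_mul_latGauss 3 α (c := π / 2) (d := 3 * π / 2)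
    (by positivity) (by positivity) (h3 w.1) (h1' w.2)
  have T3 := tendsto_tsum_mul_latGauss 3 α (c := π / 2) (d := 3 * π / 2)
    (by positivity) (by positivity) h5 (h4' w.2 (w.2 + 3 / 2 * w.1))
  have T := (T1.add (T2.const_mul w.2)).add (T3.const_mul (-(3 / 2)))
  rw [mul_left_comm (-(3 / 2) : ℝ), sum_dKer α.2 h₁ h₂ hv, tsum_mul_left, (tsum_kernels α.2 h₂).2,
    (tsum_kernels α.1 h₁).1, (tsum_kernels α.2 h₂).1] at T
  have T' : Tendsto (fun ε => gaussMean α ε w) (𝓝[>] 0) _ := T.congr' (by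
    filter_upwards [self_mem_nhdsWithin] with ε hε
    exact (gaussMean_eq α hε w).symm)
  have hpi : (π : ℂ) ≠ 0 := Complex.ofReal_ne_zero.2 pi_ne_zero
  have hw1 : (w.1 : ℂ) ≠ 0 := Complex.ofReal_ne_zero.2 h₁
  have T'' := ((Complex.continuous_ofReal.tendsto _).comp T').const_mul (-(2 * Complex.I) / π ^ 2)
  refine T''.mono_right (le_of_eq (congrArg 𝓝 ?_))
  by_cases hα : ∃ m : ℤ, α.1 = m
  · obtain ⟨m, hm⟩ := hα
    have hF : calF m w.1 = calF 0 w.1 := by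
      have : cos (2 * π * m) = 1 := by rw [mul_comm]; exact cos_int_mul_two_pi m
      simp [calF, this]
    have hG : calG m w.1 = 0 := by
      have : sin (2 * π * m) = 0 := by
        rw [show 2 * π * (m : ℝ) = ((2 * m : ℤ) : ℝ) * π by push_cast; ring]; exact sin_int_mul_pi _
      simp [calG, this]
    rw [g2, if_pos ⟨m, hm⟩, hm, tsum_pKer₀_int m h₁, tsum_zeroInd_int, hF, hG,
      show w.2 + 3 * w.1 / 2 = w.2 + 3 / 2 * w.1 by ring]
    simp only [calGStar]
    push_cast
    field_simp
    ring
  · have hne : ∀ k : ℤ, α.1 + k ≠ 0 := fun k hk => hα ⟨-k, by push_cast; linarith⟩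
    have hz : ∑' k : ℤ, zeroInd (α.1 + k) = 0 := by simp [zeroInd, hne]
    rw [g2, if_neg hα, tsum_pKer₀_of_forall_ne hne h₁, hz]
    push_cast
    field_simp
    ring

/-! ### Gaussian integrals over the plane -/

/-- The factor `exp (2 π i τ Q(w))` of the double Mordell integrand. -/
def qExp (τ : ℂ) (w : ℝ × ℝ) : ℂ := Complex.exp (2 * π * Complex.I * τ * (Q w : ℂ))

theorem norm_qExp (τ : ℂ) (w : ℝ × ℝ) : ‖qExp τ w‖ = exp (-(2 * π * τ.im * Q w)) := by
  have h := norm_cexp_I_mul τ (2 * Q w)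
  rw [qExp, show 2 * π * Complex.I * τ * (Q w : ℂ) = Complex.I * π * τ * ((2 * Q w : ℝ) : ℂ) by
    push_cast; ring, h]
  ring_nf

theorem continuous_Q : Continuous Q := by unfold Q; fun_prop

theorem continuous_qExp (τ : ℂ) : Continuous (qExp τ) := by
  have := continuous_Q
  unfold qExp
  fun_prop

theorem sq_add_sq_le_Q (w : ℝ × ℝ) : w.1 ^ 2 + w.2 ^ 2 ≤ 8 * Q w := by
  rw [Q]; nlinarith [sq_nonneg (12 * w.1 + 7 * w.2), sq_nonneg w.2, sq_nonneg w.1]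

theorem Q_nonneg (w : ℝ × ℝ) : 0 ≤ Q w := by
  have := sq_add_sq_le_Q w
  nlinarith [sq_nonneg w.1, sq_nonneg w.2]

theorem Q_pos {w : ℝ × ℝ} (hw : w.1 ≠ 0 ∨ w.2 ≠ 0) : 0 < Q w := by
  have := sq_add_sq_le_Q w
  have : 0 < w.1 ^ 2 + w.2 ^ 2 := by rcases hw with h | h <;> positivity
  linarith

theorem ellip_three (w : ℝ × ℝ) : ellip 3 (1 / 2) (3 / 2) w = 2 * Q w := by
  rw [ellip, Q]; ring

theorem ellip_one_swap (w : ℝ × ℝ) : ellip 1 (3 / 2) (1 / 2) w.swap = 2 * Q w := by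
  rw [ellip, Q, Prod.fst_swap, Prod.snd_swap]; ring

theorem integrable_exp_neg_mul_Q {c : ℝ} (hc : 0 < c) :
    Integrable fun w : ℝ × ℝ => exp (-(c * Q w)) := by
  refine (integrable_exp_neg_mul_ellip 3 (a := 1 / 2) (b := 3 / 2) (c := c / 2) (by norm_num)
    (by norm_num) (by positivity)).congr (.of_forall fun w => ?_)
  simp only [ellip_three]
  ring_nf

theorem integrable_pow_mul_exp_neg_mul_Q {c : ℝ} (hc : 0 < c) :
    Integrable fun w : ℝ × ℝ => (1 + w.1 ^ 2 + w.2 ^ 2) ^ 3 * exp (-(c * Q w)) := by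
  obtain ⟨δ, hδ, hδ1, hδc⟩ : ∃ δ : ℝ, 0 < δ ∧ δ ≤ 1 ∧ 24 * δ ≤ c / 2 :=
    ⟨min 1 (c / 48), by positivity, min_le_left _ _, by
      have := min_le_right 1 (c / 48); linarith⟩
  refine ((integrable_exp_neg_mul_Q (half_pos hc)).const_mul (δ⁻¹ ^ 3)).mono'
    (by have := continuous_Q; exact Continuous.aestronglyMeasurable (by fun_prop))
    (.of_forall fun w => ?_)
  set x := w.1 ^ 2 + w.2 ^ 2 with hx
  have hx0 : 0 ≤ x := by positivity
  have h1 : 1 + x ≤ δ⁻¹ * exp (δ * x) := by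
    have : δ * (1 + x) ≤ exp (δ * x) := by
      have := add_one_le_exp (δ * x)
      nlinarith
    rwa [inv_mul_eq_div, le_div_iff₀ hδ, mul_comm]
  have h2 : exp (δ * x) ^ 3 * exp (-(c * Q w)) ≤ exp (-(c / 2 * Q w)) := by
    rw [← exp_nat_mul, ← exp_add]
    refine exp_le_exp.2 ?_
    have h3 := sq_add_sq_le_Q w
    have h4 := mul_le_mul_of_nonneg_right hδc (Q_nonneg w)
    have h5 := mul_le_mul_of_nonneg_left h3 hδ.le
    rw [← hx] at h5
    push_cast
    linarith
  rw [norm_of_nonneg (by positivity), add_assoc, ← hx]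
  calc (1 + x) ^ 3 * exp (-(c * Q w)) ≤ (δ⁻¹ * exp (δ * x)) ^ 3 * exp (-(c * Q w)) := by gcongr
    _ = δ⁻¹ ^ 3 * (exp (δ * x) ^ 3 * exp (-(c * Q w))) := by ring
    _ ≤ _ := by gcongr

theorem integrable_mul_qExp {f : ℝ × ℝ → ℂ} (hf : AEStronglyMeasurable f) {C : ℝ}
    (h : ∀ᵐ w, ‖f w‖ ≤ C * (1 + w.1 ^ 2 + w.2 ^ 2) ^ 3) {τ : ℂ} (hτ : 0 < τ.im) :
    Integrable fun w => f w * qExp τ w := by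
  refine ((integrable_pow_mul_exp_neg_mul_Q (c := 2 * π * τ.im) (by positivity)).const_mul C).mono'
    (hf.mul (continuous_qExp τ).aestronglyMeasurable) ?_
  filter_upwards [h] with w hw
  rw [norm_mul, norm_qExp, ← mul_assoc]
  gcongr

theorem integrable_ofReal_mul_qExp {f : ℝ × ℝ → ℝ} (hf : Measurable f) {C : ℝ}
    (h : ∀ w, |f w| ≤ C * (1 + w.1 ^ 2 + w.2 ^ 2) ^ 3) {τ : ℂ} (hτ : 0 < τ.im) :
    Integrable fun w => (f w : ℂ) * qExp τ w :=
  integrable_mul_qExp (Complex.measurable_ofReal.comp hf).aestronglyMeasurable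
    (.of_forall fun w => by rw [Function.comp_apply, Complex.norm_real]; exact h w) hτ

/-! ### The kernels produced by the three theta functions -/

/-- The kernel of a term of `θ₃`. -/
def ker3 (n w : ℝ × ℝ) : ℝ :=
  (2 * n.1 + n.2) * w.2 ^ 2 / (2 * (Q n + Q w) * (n.2 ^ 2 + w.2 ^ 2))

/-- The kernel of a term of `θ₄`. -/
def ker4 (n w : ℝ × ℝ) : ℝ :=
  (3 * n.1 + 2 * n.2) * w.1 ^ 2 / (2 * (Q n + Q w) * (n.1 ^ 2 + w.1 ^ 2))

/-- The kernel of a term of `θ₅`. -/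
def ker5 (n w : ℝ × ℝ) : ℝ :=
  n.1 * (2 * w.2 + 3 * w.1) ^ 2 / (2 * (Q n + Q w) * (n.1 ^ 2 + w.1 ^ 2))

/-- A correction term that is odd under `(w₁, w₂) ↦ (-w₁ - w₂, w₂)`. -/
def oddKer₁ (n w : ℝ × ℝ) : ℝ :=
  w.2 * n.2 * (2 * w.1 + w.2) / ((n.2 ^ 2 + w.2 ^ 2) * (Q n + Q w))

/-- A correction term that is odd under `(w₁, w₂) ↦ (w₁, -w₂ - 3 w₁)`. -/
def oddKer₂ (n w : ℝ × ℝ) : ℝ :=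
  if n.1 = 0 then n.2 * (3 / 2 * w.1 + w.2) * w.1 / ((n.2 ^ 2 + (3 / 2 * w.1 + w.2) ^ 2) *
    (Q n + Q w)) else n.1 * w.1 * (n.2 * (3 * w.1 + 2 * w.2)) / ((n.1 ^ 2 + w.1 ^ 2) * (Q n + Q w))

theorem kernel_decomposition (n : ℝ × ℝ) {w : ℝ × ℝ} (h₁ : w.1 ≠ 0) (h₂ : w.2 ≠ 0) :
    2 * ker3 n w - ker4 n w + 1 / 3 * ker5 n w = 2 / 3 * mordellKernel n w - oddKer₁ n w +
      (if n.1 = 0 then 1 / 2 else -(1 / (3 * n.1))) * oddKer₂ n w := by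
  have hQ : Q n + Q w ≠ 0 := (add_pos_of_nonneg_of_pos (Q_nonneg n) (Q_pos (.inl h₁))).ne'
  have hA : n.1 ^ 2 + w.1 ^ 2 ≠ 0 := by positivity
  have hB : n.2 ^ 2 + w.2 ^ 2 ≠ 0 := by positivity
  simp only [ker3, ker4, ker5, oddKer₁, oddKer₂, mordellKernel, pKer, pKer₀, hKer, zeroInd, dKer]
  obtain ⟨m, n⟩ := n
  obtain ⟨u, v⟩ := w
  dsimp only at *
  by_cases hm : m = 0
  · subst hm
    by_cases hn : n = 0
    · subst hn; simp
    have hV : n ^ 2 + (3 / 2 * u + v) ^ 2 ≠ 0 := by positivity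
    simp only [if_true]
    rw [add_comm v (3 / 2 * u)]
    set V := n ^ 2 + (3 / 2 * u + v) ^ 2 with hVd
    set B := n ^ 2 + v ^ 2 with hBd
    set R := Q (0, n) + Q (u, v) with hRd
    field_simp
    simp only [hVd, hBd, hRd, Q]
    ring
  · simp only [hm, if_false]
    set A := m ^ 2 + u ^ 2 with hAd
    set B := n ^ 2 + v ^ 2 with hBd
    set R := Q (m, n) + Q (u, v) with hRd
    field_simp
    simp only [hAd, hBd, hRd, Q]
    ring

theorem integral_oddKer₁ (n : ℝ × ℝ) (τ : ℂ) : ∫ w, (oddKer₁ n w : ℂ) * qExp τ w = 0 := by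
  have h := integral_eq_zero_of_reflect 1 (fun w => (oddKer₁ n w.swap : ℂ) * qExp τ w.swap)
    fun v u => by
      have : Q (-u - 1 * v, v) = Q (u, v) := by simp only [Q]; ring
      simp only [Prod.swap_prod_mk, qExp, oddKer₁, this]
      push_cast
      ring
  rwa [Measure.volume_eq_prod, integral_prod_swap (fun w => (oddKer₁ n w : ℂ) * qExp τ w)] at h

theorem integral_oddKer₂ (n : ℝ × ℝ) (τ : ℂ) : ∫ w, (oddKer₂ n w : ℂ) * qExp τ w = 0 := by
  refine integral_eq_zero_of_reflect 3 _ fun v u => ?_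
  have h1 : Q (v, -u - 3 * v) = Q (v, u) := by simp only [Q]; ring
  have h2 : (3 / 2 * v + (-u - 3 * v)) = -(3 / 2 * v + u) := by ring
  simp only [qExp, oddKer₂, h1, h2, neg_sq]
  split_ifs <;> push_cast <;> ring

theorem abs_mul_div_mul_le {x y S R q E : ℝ} (hq : 0 < q) (hR : q ≤ R) (hx : |x| ≤ S)
    (hy : |y| ≤ E) : |x * y / (S * R)| ≤ E / q := by
  have hS := (abs_nonneg x).trans hx
  have hE := (abs_nonneg y).trans hy
  rw [abs_div, abs_mul, abs_of_nonneg (mul_nonneg hS (hq.le.trans hR))]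
  refine div_le_of_le_mul₀ (mul_nonneg hS (hq.le.trans hR)) (by positivity) ?_
  calc |x| * |y| ≤ S * E := mul_le_mul hx hy (abs_nonneg y) hS
    _ = E / q * (S * q) := by field_simp
    _ ≤ _ := by gcongr

theorem exists_abs_kernels_le (n : ℝ × ℝ) : ∃ C : ℝ, ∀ w : ℝ × ℝ,
    |ker3 n w| ≤ C * (1 + w.1 ^ 2 + w.2 ^ 2) ^ 3 ∧ |ker4 n w| ≤ C * (1 + w.1 ^ 2 + w.2 ^ 2) ^ 3 ∧
    |ker5 n w| ≤ C * (1 + w.1 ^ 2 + w.2 ^ 2) ^ 3 ∧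
    |oddKer₁ n w| ≤ C * (1 + w.1 ^ 2 + w.2 ^ 2) ^ 3 ∧
    |oddKer₂ n w| ≤ C * (1 + w.1 ^ 2 + w.2 ^ 2) ^ 3 := by
  by_cases hn : n = 0
  · subst hn
    exact ⟨0, fun w => by simp [ker3, ker4, ker5, oddKer₁, oddKer₂]⟩
  have hn' : n.1 ≠ 0 ∨ n.2 ≠ 0 := by
    by_contra! h
    exact hn (Prod.ext h.1 h.2)
  set q := Q n with hqd
  have hq : 0 < q := Q_pos hn'
  have amgm : ∀ x y : ℝ, |x * y| ≤ x ^ 2 + y ^ 2 := fun x y => by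
    rw [abs_le]; constructor <;> nlinarith [sq_nonneg (x + y), sq_nonneg (x - y)]
  have sq_le : ∀ x y : ℝ, |y ^ 2| ≤ x ^ 2 + y ^ 2 := fun x y => by
    rw [abs_of_nonneg (sq_nonneg y)]; linarith [sq_nonneg x]
  obtain ⟨C5, hC5⟩ : ∃ C, ∀ w, |ker5 n w| ≤ C := by
    by_cases h1 : n.1 = 0
    · exact ⟨0, fun w => by simp [ker5, h1]⟩
    refine ⟨|2 * n.1| / n.1 ^ 2, fun w => ?_⟩
    have e : ker5 n w = (2 * w.2 + 3 * w.1) ^ 2 / 4 * (2 * n.1) /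
        ((q + Q w) * (n.1 ^ 2 + w.1 ^ 2)) := by
      rw [ker5, ← hqd]
      generalize q + Q w = R, n.1 ^ 2 + w.1 ^ 2 = S
      ring
    rw [e]
    refine abs_mul_div_mul_le (by positivity) (by linarith [sq_nonneg w.1]) ?_ le_rfl
    rw [abs_of_nonneg (by positivity), Q]
    nlinarith [sq_nonneg w.1]
  refine ⟨|(2 * n.1 + n.2) / 2| / q + |(3 * n.1 + 2 * n.2) / 2| / q + |C5| + 4 * (|n.2| + 1) / q,
    fun w => ?_⟩
  have hR : q ≤ q + Q w := by linarith [Q_nonneg w]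
  have hW : 1 ≤ 1 + w.1 ^ 2 + w.2 ^ 2 := by linarith [sq_nonneg w.1, sq_nonneg w.2]
  have hW3 : 1 + w.1 ^ 2 + w.2 ^ 2 ≤ (1 + w.1 ^ 2 + w.2 ^ 2) ^ 3 := le_self_pow₀ hW (by norm_num)
  have lin : ∀ c x : ℝ, 0 ≤ c → |x| ≤ 4 * (1 + w.1 ^ 2 + w.2 ^ 2) → c ≤ |n.2| + 1 → |c * x| / q ≤
      4 * (|n.2| + 1) / q * (1 + w.1 ^ 2 + w.2 ^ 2) ^ 3 := fun c x hc hx hcn => by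
    rw [abs_mul, abs_of_nonneg hc, div_mul_eq_mul_div]
    refine div_le_div_of_nonneg_right ?_ hq.le
    calc c * |x| ≤ (|n.2| + 1) * (4 * (1 + w.1 ^ 2 + w.2 ^ 2)) := by gcongr
      _ ≤ (|n.2| + 1) * (4 * (1 + w.1 ^ 2 + w.2 ^ 2) ^ 3) := by gcongr
      _ = _ := by ring
  have hW1 := hW.trans hW3
  have s1 := sq_nonneg (w.1 - 1)
  have s2 := sq_nonneg (w.1 + 1)
  have s3 := sq_nonneg (w.2 - 1)
  have s4 := sq_nonneg (w.2 + 1)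
  ring_nf at s1 s2 s3 s4
  have s5 := sq_nonneg w.1
  have s6 := sq_nonneg w.2
  set W := (1 + w.1 ^ 2 + w.2 ^ 2) ^ 3
  have p3 : 0 ≤ |(2 * n.1 + n.2) / 2| / q := by positivity
  have p4 : 0 ≤ |(3 * n.1 + 2 * n.2) / 2| / q := by positivity
  have p5 : 0 ≤ |C5| := abs_nonneg _
  have p1 : 0 ≤ 4 * (|n.2| + 1) / q := by positivity
  have fin : ∀ {x A B C D : ℝ}, 0 ≤ A → 0 ≤ B → 0 ≤ C → 0 ≤ D → x ≤ A * W ∨ x ≤ B * W ∨ x ≤ C * W ∨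
      x ≤ D * W → x ≤ (A + B + C + D) * W := by
    intro x A B C D hA hB hC hD h
    have hW0 : 0 ≤ W := zero_le_one.trans hW1
    have := mul_nonneg hA hW0
    have := mul_nonneg hB hW0
    have := mul_nonneg hC hW0
    have := mul_nonneg hD hW0
    rcases h with h | h | h | h <;> linarith
  refine ⟨fin p3 p4 p5 p1 (.inl ?_), fin p3 p4 p5 p1 (.inr (.inl ?_)),
    fin p3 p4 p5 p1 (.inr (.inr (.inl ?_))), fin p3 p4 p5 p1 (.inr (.inr (.inr ?_))),
    fin p3 p4 p5 p1 (.inr (.inr (.inr ?_)))⟩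
  · have e : ker3 n w = w.2 ^ 2 * ((2 * n.1 + n.2) / 2) / ((n.2 ^ 2 + w.2 ^ 2) * (q + Q w)) := by
      rw [ker3, ← hqd]
      generalize q + Q w = R, n.2 ^ 2 + w.2 ^ 2 = S
      ring
    rw [e]
    exact (abs_mul_div_mul_le hq hR (sq_le _ _) le_rfl).trans (le_mul_of_one_le_right p3 hW1)
  · have e : ker4 n w = w.1 ^ 2 * ((3 * n.1 + 2 * n.2) / 2) /
        ((n.1 ^ 2 + w.1 ^ 2) * (q + Q w)) := by
      rw [ker4, ← hqd]
      generalize q + Q w = R, n.1 ^ 2 + w.1 ^ 2 = S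
      ring
    rw [e]
    exact (abs_mul_div_mul_le hq hR (sq_le _ _) le_rfl).trans (le_mul_of_one_le_right p4 hW1)
  · exact ((hC5 w).trans (le_abs_self C5)).trans (le_mul_of_one_le_right p5 hW1)
  · rw [oddKer₁, mul_comm w.2]
    refine (abs_mul_div_mul_le hq hR (amgm _ _) le_rfl).trans ?_
    have := lin 1 (2 * w.1 + w.2) zero_le_one (abs_le.2 ⟨by linarith, by linarith⟩)
      (by linarith [abs_nonneg n.2])
    rwa [one_mul] at this
  · rw [oddKer₂]
    split_ifs
    · refine (abs_mul_div_mul_le hq hR (amgm _ _) le_rfl).trans ?_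
      have := lin 1 w.1 zero_le_one (abs_le.2 ⟨by linarith, by linarith⟩)
        (by linarith [abs_nonneg n.2])
      rwa [one_mul] at this
    · refine (abs_mul_div_mul_le hq hR (amgm _ _) le_rfl).trans ?_
      have := lin |n.2| (3 * w.1 + 2 * w.2) (abs_nonneg _)
        (abs_le.2 ⟨by linarith, by linarith⟩) (by linarith)
      rwa [abs_mul, abs_abs, ← abs_mul] at this

theorem measurable_mordellKernel (n : ℝ × ℝ) : Measurable (mordellKernel n) := by
  unfold mordellKernel pKer pKer₀ hKer dKer pKer
  split_ifs <;> fun_prop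

theorem integrable_mordellKernel (n : ℝ × ℝ) {τ : ℂ} (hτ : 0 < τ.im) :
    Integrable fun w => (mordellKernel n w : ℂ) * qExp τ w := by
  obtain ⟨C, -, hC, -⟩ := exists_abs_gaussMean_le n
  refine integrable_ofReal_mul_qExp (measurable_mordellKernel n) (C := C) (fun w => ?_) hτ
  have := hC 0 w
  rwa [show latPt n 0 = n by simp [latPt]] at this

theorem integral_kernels (n : ℝ × ℝ) {τ : ℂ} (hτ : 0 < τ.im) :
    2 * (∫ w, (ker3 n w : ℂ) * qExp τ w) - (∫ w, (ker4 n w : ℂ) * qExp τ w) +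
      1 / 3 * ∫ w, (ker5 n w : ℂ) * qExp τ w =
    2 / 3 * ∫ w, (mordellKernel n w : ℂ) * qExp τ w := by
  obtain ⟨C, hC⟩ := exists_abs_kernels_le n
  have hQ := continuous_Q.measurable
  have i3 := integrable_ofReal_mul_qExp (f := ker3 n) (by unfold ker3; fun_prop)
    (fun w => (hC w).1) hτ
  have i4 := integrable_ofReal_mul_qExp (f := ker4 n) (by unfold ker4; fun_prop)
    (fun w => (hC w).2.1) hτ
  have i5 := integrable_ofReal_mul_qExp (f := ker5 n) (by unfold ker5; fun_prop)
    (fun w => (hC w).2.2.1) hτ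
  have j1 := integrable_ofReal_mul_qExp (f := oddKer₁ n) (by unfold oddKer₁; fun_prop)
    (fun w => (hC w).2.2.2.1) hτ
  have j2 := integrable_ofReal_mul_qExp (f := oddKer₂ n)
    (by unfold oddKer₂; split_ifs <;> fun_prop) (fun w => (hC w).2.2.2.2) hτ
  have hK := integrable_mordellKernel n hτ
  set c : ℝ := if n.1 = 0 then 1 / 2 else -(1 / (3 * n.1)) with hc
  have key : ∫ w, (2 * ((ker3 n w : ℂ) * qExp τ w) - (ker4 n w : ℂ) * qExp τ w +
      1 / 3 * ((ker5 n w : ℂ) * qExp τ w)) =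
      ∫ w, (2 / 3 * ((mordellKernel n w : ℂ) * qExp τ w) - (oddKer₁ n w : ℂ) * qExp τ w +
        (c : ℂ) * ((oddKer₂ n w : ℂ) * qExp τ w)) := by
    refine integral_congr_ae ?_
    filter_upwards [ae_fst_ne_zero, ae_snd_ne_zero] with w h1 h2
    have := congrArg (fun x : ℝ => (x : ℂ) * qExp τ w) (kernel_decomposition n h1 h2)
    rw [← hc] at this
    push_cast at this
    linear_combination this
  rw [integral_add ?_ (i5.const_mul _), integral_sub (i3.const_mul 2) i4,
    integral_add ?_ (j2.const_mul _), integral_sub (hK.const_mul _) j1, integral_oddKer₁] at key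
  · simp only [integral_const_mul] at key
    rwa [integral_oddKer₂, mul_zero, sub_zero, add_zero] at key
  · exact (hK.const_mul _).sub j1
  · exact (i3.const_mul 2).sub i4

/-! ### The theta integrals as Gaussian means -/

theorem latEllip_three (α : ℝ × ℝ) (k : ℤ × ℤ) :
    latEllip 3 α (1 / 2) (3 / 2) k = 2 * Q (latPt α k) := by
  simp only [latEllip, latL, latV, latPt, Q]
  push_cast
  ring

theorem latEllip_one_swap (α : ℝ × ℝ) (k : ℤ × ℤ) :
    latEllip 1 α.swap (3 / 2) (1 / 2) k.swap = 2 * Q (latPt α k) := by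
  simp only [latEllip, latL, latV, latPt, Q, Prod.fst_swap, Prod.snd_swap]
  push_cast
  ring

theorem rayWeight_three (α : ℝ × ℝ) (τ : ℂ) (ε : ℝ) (k : ℤ × ℤ) (w : ℝ × ℝ) :
    rayWeight 3 α (1 / 2) (3 / 2) τ ε k w =
      (gaussQ ε (latPt α k) : ℂ) * qExp (τ + ε * Complex.I) w := by
  rw [rayWeight, latEllip_three, Int.cast_ofNat, ellip_three, gaussQ, qExp, Complex.ofReal_exp,
    Complex.ofReal_exp, ← Complex.exp_add, ← Complex.exp_add]
  congr 1
  push_cast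
  linear_combination (-(2 * π * ε * Q w) : ℂ) * Complex.I_sq

theorem rayWeight_one_swap (α : ℝ × ℝ) (τ : ℂ) (ε : ℝ) (k : ℤ × ℤ) (w : ℝ × ℝ) :
    rayWeight 1 α.swap (3 / 2) (1 / 2) τ ε k.swap w.swap =
      (gaussQ ε (latPt α k) : ℂ) * qExp (τ + ε * Complex.I) w := by
  rw [rayWeight, latEllip_one_swap, Int.cast_one, ellip_one_swap, gaussQ, qExp, Complex.ofReal_exp,
    Complex.ofReal_exp, ← Complex.exp_add, ← Complex.exp_add]
  congr 1
  push_cast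
  linear_combination (-(2 * π * ε * Q w) : ℂ) * Complex.I_sq

theorem sqrt_half_mul_sqrt : (√(1 / 2) : ℝ) * √(3 / 2) = √3 / 2 := by
  rw [← sqrt_mul (by norm_num), show (1 / 2 * (3 / 2) : ℝ) = 3 / 2 ^ 2 by norm_num,
    sqrt_div (by norm_num), sqrt_sq (by norm_num)]

section

variable (α : ℝ × ℝ) (k : ℤ × ℤ) {τ : ℂ} {ε : ℝ}

theorem integral_term_theta3 (hτ : 0 < τ.im) (hε : 0 < ε) :
    ∫ p, thetaRayTerm (latL 1 α.swap) 1 α.swap (3 / 2) (1 / 2) τ (1 / 2) (3 / 2) k.swap p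
      ∂rayMeasure ε = 2 * √3 / π * ((gaussQ ε (latPt α k) : ℂ) *
        ∫ w, (ker3 (latPt α k) w : ℂ) * qExp (τ + ε * Complex.I) w) := by
  rw [integral_thetaRayTerm_latL 1 α.swap k.swap (by norm_num) (by norm_num) hτ hε,
    Measure.volume_eq_prod, ← integral_prod_swap, ← integral_const_mul (gaussQ ε (latPt α k) : ℂ)]
  congr 1
  · rw [mul_assoc, mul_comm (√(3 / 2) : ℂ), ← Complex.ofReal_mul, sqrt_half_mul_sqrt]
    push_cast
    ring
  · refine integral_congr_ae (.of_forall fun w => ?_)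
    have h : rayKernel 1 α.swap (3 / 2) (1 / 2) (latL 1 α.swap k.swap) (fun w => w.1 ^ 2)
        k.swap w.swap = ker3 (latPt α k) w := by
      rw [rayKernel, latEllip_one_swap, Int.cast_one, ellip_one_swap, ker3]
      simp only [latL, latV, latPt, Prod.fst_swap, Prod.snd_swap]
      push_cast
      congr 1 <;> ring
    simp only [h, rayWeight_one_swap]
    ring

theorem integral_term_theta4 (hτ : 0 < τ.im) (hε : 0 < ε) :
    ∫ p, thetaRayTerm (latL 3 α) 3 α (1 / 2) (3 / 2) τ (1 / 2) (3 / 2) k p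
      ∂rayMeasure ε = 2 * √3 / π * ((gaussQ ε (latPt α k) : ℂ) *
        ∫ w, (ker4 (latPt α k) w : ℂ) * qExp (τ + ε * Complex.I) w) := by
  rw [integral_thetaRayTerm_latL 3 α k (by norm_num) (by norm_num) hτ hε,
    ← integral_const_mul (gaussQ ε (latPt α k) : ℂ)]
  congr 1
  · rw [mul_assoc, ← Complex.ofReal_mul, sqrt_half_mul_sqrt]
    push_cast
    ring
  · refine integral_congr_ae (.of_forall fun w => ?_)
    have h : rayKernel 3 α (1 / 2) (3 / 2) (latL 3 α k) (fun w => w.1 ^ 2) k w =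
        ker4 (latPt α k) w := by
      rw [rayKernel, latEllip_three, Int.cast_ofNat, ellip_three, ker4]
      simp only [latL, latV, latPt]
      push_cast
      congr 1 <;> ring
    simp only [h, rayWeight_three]
    ring

theorem integral_term_theta5 (hτ : 0 < τ.im) (hε : 0 < ε) :
    ∫ p, thetaRayTerm (latV α) 3 α (1 / 2) (3 / 2) τ (3 / 2) (1 / 2) k p
      ∂rayMeasure ε = 2 * √3 / (3 * π) * ((gaussQ ε (latPt α k) : ℂ) *
        ∫ w, (ker5 (latPt α k) w : ℂ) * qExp (τ + ε * Complex.I) w) := by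
  rw [integral_thetaRayTerm_latV 3 α k (by norm_num) (by norm_num) hτ hε,
    ← integral_const_mul (gaussQ ε (latPt α k) : ℂ)]
  congr 1
  · rw [mul_assoc 4, ← Complex.ofReal_mul, sqrt_half_mul_sqrt]
    push_cast
    field_simp
    ring
  · refine integral_congr_ae (.of_forall fun w => ?_)
    have h : rayKernel 3 α (1 / 2) (3 / 2) (latV α k) (fun w => (2 * w.2 + (3 : ℤ) * w.1) ^ 2) k w =
        ker5 (latPt α k) w := by
      rw [rayKernel, latEllip_three, Int.cast_ofNat, ellip_three, ker5]
      simp only [latV, latPt]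
      congr 1
      ring
    simp only [h, rayWeight_three]
    ring

end

/-- The combination `2 θ₃ - θ₄ + θ₅` of the three integrands along the rays. -/
def rayTotal (α : ℝ × ℝ) (τ : ℂ) (p : ℝ × ℝ) : ℂ :=
  2 * thetaRay (latL 1 α.swap) 1 α.swap (3 / 2) (1 / 2) τ (1 / 2) (3 / 2) p -
    thetaRay (latL 3 α) 3 α (1 / 2) (3 / 2) τ (1 / 2) (3 / 2) p +
    thetaRay (latV α) 3 α (1 / 2) (3 / 2) τ (3 / 2) (1 / 2) p

theorem rayBounded_thetaRays (α : ℝ × ℝ) {τ : ℂ} (hτ : 0 < τ.im) :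
    RayBounded 0 (thetaRay (latL 1 α.swap) 1 α.swap (3 / 2) (1 / 2) τ (1 / 2) (3 / 2)) ∧
    RayBounded 0 (thetaRay (latL 3 α) 3 α (1 / 2) (3 / 2) τ (1 / 2) (3 / 2)) ∧
    RayBounded 0 (thetaRay (latV α) 3 α (1 / 2) (3 / 2) τ (3 / 2) (1 / 2)) :=
  ⟨rayBounded_thetaRay_latL _ _ (by norm_num) (by norm_num) hτ,
    rayBounded_thetaRay_latL _ _ (by norm_num) (by norm_num) hτ,
    rayBounded_thetaRay_latV _ _ (by norm_num) (by norm_num) hτ⟩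

theorem integrable_rayMeasure_mono {F : ℝ × ℝ → ℂ} (hF : Integrable F (rayMeasure 0)) {ε : ℝ}
    (hε : 0 < ε) : Integrable F (rayMeasure ε) := by
  rw [rayMeasure, Measure.prod_restrict] at hF ⊢
  exact hF.mono_measure (Measure.restrict_mono (prod_mono (Ioi_subset_Ioi hε.le) le_rfl) le_rfl)

theorem hasSum_integral_rayTotal (α : ℝ × ℝ) {τ : ℂ} (hτ : 0 < τ.im) {ε : ℝ} (hε : 0 < ε) :
    HasSum (fun k => 4 * √3 / (3 * π) * ((gaussQ ε (latPt α k) : ℂ) *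
      ∫ w, (mordellKernel (latPt α k) w : ℂ) * qExp (τ + ε * Complex.I) w))
      (∫ p, rayTotal α τ p ∂rayMeasure ε) := by
  have hτ' : 0 < (τ + ε * Complex.I).im := by simp; linarith
  obtain ⟨b3, b4, b5⟩ := rayBounded_thetaRays α hτ
  have i3 := integrable_rayMeasure_mono b3.integrable hε
  have i4 := integrable_rayMeasure_mono b4.integrable hε
  have i5 := integrable_rayMeasure_mono b5.integrable hε
  have e : ∫ p, rayTotal α τ p ∂rayMeasure ε = _ :=
    (integral_add ((i3.const_mul 2).sub i4) i5).trans
      (congrArg₂ _ ((integral_sub (i3.const_mul 2) i4).trans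
        (congrArg₂ _ (integral_const_mul _ _) rfl)) rfl)
  rw [e]
  have s3 := (Equiv.prodComm ℤ ℤ).hasSum_iff.2 (hasSum_integral_thetaRay_latL 1 α.swap (a := 3 / 2)
    (b := 1 / 2) (by norm_num) (by norm_num) hτ hε)
  have s4 := hasSum_integral_thetaRay_latL 3 α (a := 1 / 2) (b := 3 / 2) (by norm_num)
    (by norm_num) hτ hε
  have s5 := hasSum_integral_thetaRay_latV 3 α (a := 1 / 2) (b := 3 / 2) (by norm_num)
    (by norm_num) hτ hε
  refine (((s3.mul_left 2).sub s4).add s5).congr_fun fun k => ?_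
  simp only [Function.comp_apply, Equiv.prodComm_apply]
  rw [integral_term_theta3 α k hτ hε, integral_term_theta4 α k hτ hε,
    integral_term_theta5 α k hτ hε]
  have := integral_kernels (latPt α k) hτ'
  linear_combination (-(2 * √3 / π * gaussQ ε (latPt α k)) : ℂ) * this

theorem summable_gaussQ (α : ℝ × ℝ) {ε : ℝ} (hε : 0 < ε) :
    Summable fun k => gaussQ ε (latPt α k) := by
  simp_rw [gaussQ_eq]
  exact summable_latGauss 3 α (by positivity) (by positivity)

theorem integral_rayTotal (α : ℝ × ℝ) {τ : ℂ} (hτ : 0 < τ.im) {ε : ℝ} (hε : 0 < ε) :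
    ∫ p, rayTotal α τ p ∂rayMeasure ε = 4 * √3 / (3 * π) *
      ∫ w, (gaussMean α ε w : ℂ) * qExp (τ + ε * Complex.I) w := by
  have hτ' : 0 < (τ + ε * Complex.I).im := by simp; linarith
  obtain ⟨C, hC, hK, -⟩ := exists_abs_gaussMean_le α
  set F : ℤ × ℤ → ℝ × ℝ → ℂ := fun k w => (gaussQ ε (latPt α k) : ℂ) *
    ((mordellKernel (latPt α k) w : ℂ) * qExp (τ + ε * Complex.I) w) with hF
  have hi : ∀ k, Integrable (F k) := fun k => (integrable_mordellKernel _ hτ').const_mul _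
  have hg := (integrable_pow_mul_exp_neg_mul_Q (c := 2 * π * (τ + ε * Complex.I).im)
    (by positivity)).const_mul C
  have hs : Summable fun k => ∫ w, ‖F k w‖ := by
    refine .of_nonneg_of_le (fun k => integral_nonneg fun w => norm_nonneg _) (fun k => ?_)
      ((summable_gaussQ α hε).mul_right (∫ w : ℝ × ℝ, C * ((1 + w.1 ^ 2 + w.2 ^ 2) ^ 3 *
        exp (-(2 * π * (τ + ε * Complex.I).im * Q w)))))
    rw [← integral_const_mul]
    refine integral_mono (hi k).norm (hg.const_mul _) fun w => ?_
    have hq : 0 ≤ gaussQ ε (latPt α k) := (exp_pos _).le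
    simp only [hF, norm_mul, Complex.norm_real, norm_qExp, norm_of_nonneg hq, ← mul_assoc C]
    gcongr
    exact hK k w
  have h := (hasSum_integral_of_summable_integral_norm hi hs).mul_left (4 * √3 / (3 * π) : ℂ)
  simp only [hF, integral_const_mul] at h
  rw [(hasSum_integral_rayTotal α hτ hε).unique h]
  congr 1
  refine integral_congr_ae (.of_forall fun w => ?_)
  simp only [gaussMean]
  rw [Complex.ofReal_tsum, ← tsum_mul_right]
  refine tsum_congr fun k => ?_
  push_cast
  ring

/-! ### The limit `ε → 0` -/

theorem tendsto_integral_rayMeasure {F : ℝ × ℝ → ℂ} (hF : Integrable F (rayMeasure 0)) :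
    Tendsto (fun ε => ∫ p, F p ∂rayMeasure ε) (𝓝[>] 0) (𝓝 (∫ p, F p ∂rayMeasure 0)) := by
  have h : ∀ ε : ℝ, 0 < ε →
      ∫ p, ({p : ℝ × ℝ | ε < p.1}.indicator F) p ∂rayMeasure 0 = ∫ p, F p ∂rayMeasure ε := by
    intro ε hε
    have hm : MeasurableSet {p : ℝ × ℝ | ε < p.1} := measurableSet_lt measurable_const measurable_fst
    rw [integral_indicator hm, rayMeasure, rayMeasure, Measure.prod_restrict,
      Measure.prod_restrict, Measure.restrict_restrict hm]
    congr 2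
    ext p
    simp only [mem_inter_iff, mem_ofPred_eq, mem_prod, mem_Ioi]
    constructor
    · exact fun h => ⟨h.1, h.2.2⟩
    · exact fun h => ⟨h.1, hε.trans h.1, h.2⟩
  have key : Tendsto (fun ε => ∫ p, ({p : ℝ × ℝ | ε < p.1}.indicator F) p ∂rayMeasure 0) (𝓝[>] 0)
      (𝓝 (∫ p, F p ∂rayMeasure 0)) := by
    refine tendsto_integral_filter_of_dominated_convergence (fun p => ‖F p‖)
      (.of_forall fun ε => hF.1.indicator (measurableSet_lt measurable_const measurable_fst))
      (.of_forall fun ε => .of_forall fun p => norm_indicator_le_norm_self _ _) hF.norm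
      (ae_rayMeasure fun t s ht hs => ?_)
    refine tendsto_const_nhds.congr' ?_
    filter_upwards [mem_nhdsWithin_of_mem_nhds (Iio_mem_nhds ht)] with ε hε
    exact (indicator_of_mem (show (t, s) ∈ {p : ℝ × ℝ | ε < p.1} from hε) F).symm
  exact key.congr' (by filter_upwards [self_mem_nhdsWithin] with ε hε using h ε hε)

theorem ae_tendsto_gaussMean (α : ℝ × ℝ) : ∀ᵐ w : ℝ × ℝ,
    Tendsto (fun ε => -(2 * Complex.I) / π ^ 2 * ((gaussMean α ε w : ℝ) : ℂ)) (𝓝[>] 0)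
      (𝓝 (g2 α w)) := by
  filter_upwards [ae_fst_ne_zero, ae_snd_ne_zero, (measurePreserving_shear (Or.inl rfl)
    (3 / 2)).quasiMeasurePreserving.ae ae_snd_ne_zero] with w h1 h2 h3
  exact tendsto_gaussMean α h1 h2 (by simpa using h3)

theorem measurable_gaussMean (α : ℝ × ℝ) (ε : ℝ) : Measurable (gaussMean α ε) := by
  unfold gaussMean
  exact Measurable.tsum fun k => (measurable_mordellKernel _).mul_const _

theorem exists_norm_gaussMean_le (α : ℝ × ℝ) : ∃ C : ℝ, 0 ≤ C ∧
    ∀ᶠ ε in 𝓝[>] (0 : ℝ), ∀ w : ℝ × ℝ,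
      ‖-(2 * Complex.I) / π ^ 2 * ((gaussMean α ε w : ℝ) : ℂ)‖ ≤
        C * (1 + w.1 ^ 2 + w.2 ^ 2) ^ 3 := by
  obtain ⟨C, hC, -, h⟩ := exists_abs_gaussMean_le α
  refine ⟨‖(-(2 * Complex.I) / π ^ 2 : ℂ)‖ * C, by positivity, ?_⟩
  filter_upwards [Ioo_mem_nhdsGT zero_lt_one] with ε hε w
  rw [norm_mul, Complex.norm_real, mul_assoc]
  gcongr
  exact h ε hε.1 hε.2.le w

theorem integrable_mordellIntegrand (α : ℝ × ℝ) {τ : ℂ} (hτ : 0 < τ.im) :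
    Integrable (mordellIntegrand α τ) := by
  obtain ⟨C, -, hC⟩ := exists_norm_gaussMean_le α
  refine integrable_mul_qExp (C := C) (f := g2 α) ?_ ?_ hτ
  · exact aestronglyMeasurable_of_tendsto_ae (𝓝[>] (0 : ℝ))
      (fun ε => ((Complex.measurable_ofReal.comp
        (measurable_gaussMean α ε)).const_mul _).aestronglyMeasurable) (ae_tendsto_gaussMean α)
  · filter_upwards [ae_tendsto_gaussMean α] with w hw
    refine le_of_tendsto hw.norm ?_
    filter_upwards [hC] with ε hε using hε w

theorem tendsto_integral_gaussMean (α : ℝ × ℝ) {τ : ℂ} (hτ : 0 < τ.im) :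
    Tendsto (fun ε : ℝ => ∫ w, -(2 * Complex.I) / π ^ 2 * (gaussMean α ε w : ℂ) *
      qExp (τ + ε * Complex.I) w) (𝓝[>] 0) (𝓝 (∫ w, mordellIntegrand α τ w)) := by
  obtain ⟨C, hC0, hC⟩ := exists_norm_gaussMean_le α
  refine tendsto_integral_filter_of_dominated_convergence
    (fun w => C * ((1 + w.1 ^ 2 + w.2 ^ 2) ^ 3 * exp (-(2 * π * τ.im * Q w)))) ?_ ?_
    ((integrable_pow_mul_exp_neg_mul_Q (by positivity)).const_mul C) ?_
  · exact .of_forall fun ε => (((Complex.measurable_ofReal.comp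
      (measurable_gaussMean α ε)).const_mul _).mul
        (continuous_qExp _).measurable).aestronglyMeasurable
  · filter_upwards [hC, self_mem_nhdsWithin] with ε hε hε0
    refine .of_forall fun w => ?_
    have hQ := Q_nonneg w
    have hε0' : (0 : ℝ) < ε := hε0
    rw [norm_mul, norm_qExp, ← mul_assoc]
    gcongr
    · exact hε w
    · simp
      exact hε0'.le
  · filter_upwards [ae_tendsto_gaussMean α] with w hw
    refine hw.mul (Tendsto.mono_left ?_ nhdsWithin_le_nhds)
    have : Continuous fun ε : ℝ => qExp (τ + ε * Complex.I) w := by unfold qExp; fun_prop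
    simpa [qExp] using this.tendsto 0

theorem integral_rayTotal_zero (α : ℝ × ℝ) {τ : ℂ} (hτ : 0 < τ.im) :
    -(√3 * Complex.I / (2 * π)) * ∫ p, rayTotal α τ p ∂rayMeasure 0 =
      ∫ w, mordellIntegrand α τ w := by
  obtain ⟨b3, b4, b5⟩ := rayBounded_thetaRays α hτ
  have h1 := (tendsto_integral_rayMeasure (F := rayTotal α τ) (((b3.integrable.const_mul 2).sub
    b4.integrable).add b5.integrable)).const_mul (-(√3 * Complex.I / (2 * π)))
  refine tendsto_nhds_unique h1 ((tendsto_integral_gaussMean α hτ).congr' ?_)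
  filter_upwards [self_mem_nhdsWithin] with ε hε
  rw [integral_rayTotal α hτ hε]
  simp_rw [mul_assoc (-(2 * Complex.I) / (π : ℂ) ^ 2)]
  rw [integral_const_mul, ← mul_assoc]
  congr 1
  have h3 : ((√3 : ℝ) : ℂ) ^ 2 = 3 := by
    rw [← Complex.ofReal_pow, sq_sqrt (by norm_num)]; norm_num
  have hpi : (π : ℂ) ≠ 0 := Complex.ofReal_ne_zero.2 pi_ne_zero
  field_simp
  linear_combination 4 * h3

/-! ### The iterated integrals -/

theorem iteratedIntegrable_of_ray {f : ℂ → ℂ → ℂ} {F : ℝ × ℝ → ℂ}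
    (h : ∀ t s : ℝ, f (t * Complex.I) (t * Complex.I + s * Complex.I) = F (t, s))
    (hi : Integrable F (rayMeasure 0))
    (ho : ∀ t, 0 < t → IntegrableOn (fun s => F (t, s)) (Ioi 0)) :
    IteratedIntegrable f ∧ iteratedIntegral f = -∫ p, F p ∂rayMeasure 0 := by
  have e : ∀ t : ℝ, rayIntegral (fun w₂ => f (0 + t * Complex.I) w₂) (0 + t * Complex.I) =
      (∫ s in Ioi (0 : ℝ), F (t, s)) * Complex.I := fun t => by
    rw [rayIntegral, integral_mul_const]
    simp only [zero_add, h]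
  refine ⟨⟨fun t ht => ?_, ?_⟩, ?_⟩
  · unfold RayIntegrable
    simp only [h]
    exact ho t ht
  · unfold RayIntegrable
    simp only [e]
    exact hi.integral_prod_left.mul_const _
  · rw [iteratedIntegral, rayIntegral]
    simp only [e]
    rw [rayMeasure, integral_prod _ hi, integral_mul_const, integral_mul_const, mul_assoc,
      Complex.I_mul_I, mul_neg_one]

theorem rayPow_eq (τ ρ₁ ρ₂ : ℂ) (t s : ℝ) :
    (-Complex.I * (t * Complex.I + τ)) ^ ρ₁ *
      (-Complex.I * (t * Complex.I + s * Complex.I + τ)) ^ ρ₂ = rayPow τ ρ₁ ρ₂ (t, s) := by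
  rw [rayPow]
  congr 2
  · linear_combination (-t : ℂ) * Complex.I_sq
  · push_cast
    linear_combination (-t - s : ℂ) * Complex.I_sq

theorem iteratedIntegrable_integrand34 (α : ℝ × ℝ) {τ : ℂ} (hτ : 0 < τ.im) :
    IteratedIntegrable (integrand34 α τ) ∧ iteratedIntegral (integrand34 α τ) =
      -∫ p, (2 * thetaRay (latL 1 α.swap) 1 α.swap (3 / 2) (1 / 2) τ (1 / 2) (3 / 2) p -
        thetaRay (latL 3 α) 3 α (1 / 2) (3 / 2) τ (1 / 2) (3 / 2) p) ∂rayMeasure 0 := by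
  obtain ⟨b3, b4, -⟩ := rayBounded_thetaRays α hτ
  refine iteratedIntegrable_of_ray (fun t s => ?_) ((b3.integrable.const_mul 2).sub b4.integrable)
    fun t ht => ((b3.integrableOn ht).const_mul 2).sub (b4.integrableOn ht)
  rw [integrand34, rayPow_eq, ← add_mul, ← Complex.ofReal_add, theta3_I_mul, theta4_I_mul,
    thetaRay, thetaRay]
  ring

theorem iteratedIntegrable_integrand5 (α : ℝ × ℝ) {τ : ℂ} (hτ : 0 < τ.im) :
    IteratedIntegrable (integrand5 α τ) ∧ iteratedIntegral (integrand5 α τ) =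
      -∫ p, thetaRay (latV α) 3 α (1 / 2) (3 / 2) τ (3 / 2) (1 / 2) p ∂rayMeasure 0 := by
  obtain ⟨-, -, b5⟩ := rayBounded_thetaRays α hτ
  refine iteratedIntegrable_of_ray (fun t s => ?_) b5.integrable fun t ht => b5.integrableOn ht
  rw [integrand5, rayPow_eq, ← add_mul, ← Complex.ofReal_add, theta5_I_mul, thetaRay]

theorem H2_eq_integral (α : ℝ × ℝ) {τ : ℂ} (hτ : 0 < τ.im) :
    H2 α τ = ∫ w, mordellIntegrand α τ w := by
  obtain ⟨b3, b4, b5⟩ := rayBounded_thetaRays α hτ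
  have e : ∫ p, rayTotal α τ p ∂rayMeasure 0 = _ :=
    integral_add ((b3.integrable.const_mul 2).sub b4.integrable) b5.integrable
  rw [← integral_rayTotal_zero α hτ, e, H2, (iteratedIntegrable_integrand34 α hτ).2,
    (iteratedIntegrable_integrand5 α hτ).2]
  ring

end DoubleMordell

end

theorem mainTheorem3 (α : ℝ × ℝ) (τ : ℂ) (hτ : 0 < τ.im) :
    -- the theta series converge absolutely on the product of two upper half-planes
    (∀ w₁ w₂ : ℂ, 0 < w₁.im → 0 < w₂.im →
      Summable (DoubleMordell.theta3Term α w₁ w₂) ∧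
      Summable (DoubleMordell.theta4Term α w₁ w₂) ∧
      Summable (DoubleMordell.theta5Term α w₁ w₂)) ∧
    -- all the integrals converge
    DoubleMordell.IteratedIntegrable (DoubleMordell.integrand34 α τ) ∧
    DoubleMordell.IteratedIntegrable (DoubleMordell.integrand5 α τ) ∧
    MeasureTheory.Integrable (DoubleMordell.mordellIntegrand α τ)
      (MeasureTheory.volume : MeasureTheory.Measure (ℝ × ℝ)) ∧
    -- and the double theta integral is the double Mordell integral
    DoubleMordell.H2 α τ = ∫ w : ℝ × ℝ, DoubleMordell.mordellIntegrand α τ w := by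
  exact ⟨fun w₁ w₂ h₁ h₂ => ⟨DoubleMordell.summable_theta3Term α h₁ h₂,
    DoubleMordell.summable_theta4Term α h₁ h₂, DoubleMordell.summable_theta5Term α h₁ h₂⟩,
    (DoubleMordell.iteratedIntegrable_integrand34 α hτ).1,
    (DoubleMordell.iteratedIntegrable_integrand5 α hτ).1,
    DoubleMordell.integrable_mordellIntegrand α hτ, DoubleMordell.H2_eq_integral α hτ⟩
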